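/- A \emph{polyhedron} (solid) is the convex hull of finitely many points of $\mathbb{R}^3$ that has nonempty interior; its \emph{faces} are its two-dimensional faces. A polyhedron is \emph{uniform} if each of its faces is a regular polygon and it is vertex-transitive, i.e. for any two of its vertices some isometry of $\mathbb{R}^3$ that maps the polyhedron onto itself carries the first vertex to the second. An \emph{Archimedean solid} is a uniform polyhedron that is not similar to any of the following: the five Platonic solids (regular tetrahedron, cube, octahedron, dodecahedron, icosahedron), the uniform $n$-gonal prisms (regular $n$-gons as bases and squares as lateral faces, $n\ge 3$), and the uniform $n$-gonal antiprisms (regular $n$-gons as bases and equilateral triangles as lateral faces, $n\ge 3$). A solid $S$ \emph{admits a $k$-face embedding} in a solid $S_2$ if some solid $S_1$ similar to $S$ is a proper subset of $S_2$ and $\partial S_1\cap\partial S_2$ is the union of exactly $k$ distinct faces of $S_1$. \textbf{Theorem.} Let $T$ be the regular tetrahedron and let $S$ be a uniform polyhedron. Then $S$ admits a $4$-face embedding in $T$ if and only if $S$ is (similar to) the regular icosahedron or the regular octahedron, or $S$ is an Archimedean solid. -/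

import Mathlib

namespace Solid

open Real Set

noncomputable section

/-- Euclidean three-space. -/
abbrev E3 : Type := EuclideanSpace ℝ (Fin 3)

/-- Two subsets of space are similar: one is the image of the other under a similarity
transformation of space (possibly orientation reversing). -/
def IsSimilar (A B : Set E3) : Prop :=
  ∃ f : E3 ≃ᵈ E3, f '' A = B

/-- A (convex) polyhedron or solid: the convex hull of finitely many points of space which is
three-dimensional. -/
def IsPolyhedron (S : Set E3) : Prop :=
  (∃ V : Set E3, V.Finite ∧ S = convexHull ℝ V) ∧ (interior S).Nonempty

/-- `F` is a (two-dimensional) face of `S`: the intersection of `S` with a supporting plane, of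
dimension two. -/
def IsFace (S F : Set E3) : Prop :=
  IsExposed ℝ S F ∧ Module.finrank ℝ (vectorSpan ℝ F) = 2

/-- `F` is a regular (convex) polygon in some plane of space: its vertices are
`c + cos (2πk/n) u + sin (2πk/n) w`, `0 ≤ k < n`, where `u`, `w` are orthogonal nonzero vectors of
the same length (the circumradius) and `n ≥ 3`. -/
def IsRegularPolygon (F : Set E3) : Prop :=
  ∃ n : ℕ, 3 ≤ n ∧ ∃ c u w : E3, u ≠ 0 ∧ ‖u‖ = ‖w‖ ∧ inner ℝ u w = 0 ∧
    F = convexHull ℝ (range fun k : Fin n =>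
      c + cos (2 * π * (k : ℕ) / n) • u + sin (2 * π * (k : ℕ) / n) • w)

/-- Every vertex can be carried to every other vertex by an isometry of space preserving `S`. -/
def IsVertexTransitive (S : Set E3) : Prop :=
  ∀ x ∈ S.extremePoints ℝ, ∀ y ∈ S.extremePoints ℝ, ∃ g : E3 ≃ᵢ E3, g '' S = S ∧ g x = y

/-- A uniform polyhedron: regular faces and vertex-transitive. -/
def IsUniform (S : Set E3) : Prop :=
  IsPolyhedron S ∧ (∀ F, IsFace S F → IsRegularPolygon F) ∧ IsVertexTransitive S

/-! The five regular (Platonic) solids in standard coordinates. -/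

/-- The regular tetrahedron. -/
def tetrahedron : Set E3 :=
  convexHull ℝ {!₂[1, 1, 1], !₂[1, -1, -1], !₂[-1, 1, -1], !₂[-1, -1, 1]}

/-- The cube, with vertices `(±1, ±1, ±1)`. -/
def cube : Set E3 :=
  convexHull ℝ {x : E3 | ∀ i, |x i| = 1}

/-- The regular octahedron, with vertices `(±1, 0, 0)`, `(0, ±1, 0)`, `(0, 0, ±1)`. -/
def octahedron : Set E3 :=
  convexHull ℝ {x : E3 | ∃ i : Fin 3, |x i| = 1 ∧ x (i + 1) = 0 ∧ x (i + 2) = 0}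

/-- The regular dodecahedron, with vertices `(±1, ±1, ±1)` and the cyclic permutations of
`(0, ±φ⁻¹, ±φ)`. -/
def dodecahedron : Set E3 :=
  convexHull ℝ ({x : E3 | ∀ i, |x i| = 1} ∪
    {x : E3 | ∃ i : Fin 3,
      x i = 0 ∧ |x (i + 1)| = goldenRatio⁻¹ ∧ |x (i + 2)| = goldenRatio})

/-- The regular icosahedron, with vertices the cyclic permutations of `(0, ±1, ±φ)`. -/
def icosahedron : Set E3 :=
  convexHull ℝ {x : E3 | ∃ i : Fin 3, x i = 0 ∧ |x (i + 1)| = 1 ∧ |x (i + 2)| = goldenRatio}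

/-- The uniform `n`-gonal prism: two parallel regular `n`-gons of circumradius `1`, at distance
equal to their side length `2 sin (π/n)`, so that the lateral faces are squares. -/
def prism (n : ℕ) : Set E3 :=
  convexHull ℝ {x : E3 | ∃ k : Fin n,
    x 0 = cos (2 * π * (k : ℕ) / n) ∧ x 1 = sin (2 * π * (k : ℕ) / n) ∧ |x 2| = sin (π / n)}

/-- The uniform `n`-gonal antiprism: two parallel regular `n`-gons of circumradius `1`, rotated by
`π/n` against each other, at the height `±√(sin² (π/n) - sin² (π/2n))` at which the lateral edges
have the same length `2 sin (π/n)` as the sides of the two `n`-gons. -/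
def antiprism (n : ℕ) : Set E3 :=
  convexHull ℝ (range fun k : Fin (2 * n) =>
    (!₂[cos (π * (k : ℕ) / n), sin (π * (k : ℕ) / n),
      (-1) ^ (k : ℕ) * √(sin (π / n) ^ 2 - sin (π / (2 * n)) ^ 2)] : E3))

/-- The Platonic solids. -/
def IsPlatonic (S : Set E3) : Prop :=
  IsSimilar S tetrahedron ∨ IsSimilar S cube ∨ IsSimilar S octahedron ∨
    IsSimilar S dodecahedron ∨ IsSimilar S icosahedron

/-- The Archimedean solids: the uniform polyhedra other than the Platonic solids, the prisms and
the antiprisms. -/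
def IsArchimedean (S : Set E3) : Prop :=
  IsUniform S ∧ ¬ IsPlatonic S ∧
    (∀ n : ℕ, 3 ≤ n → ¬ IsSimilar S (prism n)) ∧
    (∀ n : ℕ, 3 ≤ n → ¬ IsSimilar S (antiprism n))

/-- `S₁` is placed inside `S₂` with exactly `k` faces on the boundary: `S₁` is a proper subset of
`S₂` and `∂S₁ ∩ ∂S₂` consists of exactly `k` faces of `S₁`. -/
def IsFaceEmbedded (k : ℕ) (S₁ S₂ : Set E3) : Prop :=
  S₁ ⊂ S₂ ∧ ∃ 𝓕 : Finset (Set E3), 𝓕.card = k ∧ (∀ F ∈ 𝓕, IsFace S₁ F) ∧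
    frontier S₁ ∩ frontier S₂ = ⋃ F ∈ 𝓕, F

/-- `S₁` admits a `k`-face embedding in `S₂`; the size and the position of `S₁` are free. -/
def AdmitsFaceEmbedding (k : ℕ) (S₁ S₂ : Set E3) : Prop :=
  ∃ S : Set E3, IsSimilar S₁ S ∧ IsFaceEmbedded k S S₂

end

end Solid

/-!
# Uniform polyhedra with a 4-face embedding in the regular tetrahedron

No classification of the uniform polyhedra is needed: the proof only uses the symmetries of the
solid in one direction and the normals of its faces in the other.

*Existence of an embedding.* A uniform polyhedron is, up to a translation, the convex hull of a
finite set `W` on which its group `G` of linear symmetries acts transitively (`exists_center`). This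
finite group contains rotations of order three about different axes, or it preserves a line
(`exists_axes_or_exists_line`).

In the first case, vectors of a fixed length on the axes of order three form a finite set that is
invariant under the rotations by `120°` about its members. Looking at a closest pair of axes, one
finds that the set consists of the vertices of a cube or of a regular dodecahedron
(`IsAxisSystem.exists_image_eq`). In particular the solid is invariant under the rotations of a
regular tetrahedron. If no vertex lies on an axis of the tetrahedron, then the solid is scaled until
it touches the faces of the tetrahedron; a touching vertex has three different images under the
rotations about the normal of the face, so the solid touches each face of the tetrahedron in a face
of its own (`admitsFaceEmbedding_of_tetrahedral`). This also covers the octahedron and the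
icosahedron. If a vertex lies on an axis, then by transitivity all vertices do, and the solid is a
tetrahedron, a cube or a dodecahedron (`isPlatonic_of_subset_axes`).

In the second case, the vertices lie in two planes orthogonal to the line, and regularity of the
faces leaves only the prisms, the antiprisms and the tetrahedron (`isSimilar_of_axis`). Hence an
Archimedean solid has an embedding.

*Exclusion of the other solids.* The four faces of an embedded copy on the boundary of the
tetrahedron lie in its four different faces (`finrank_face_of_isFaceEmbedded`). So the solid has
four faces whose normals, of squared length `3`, have mutual inner products `-1`
(`exists_normals_of_admitsFaceEmbedding`). The normals of a cube, a dodecahedron, a prism or an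
`n`-gonal antiprism with `n ≥ 4` contain no such quadruple. A tetrahedron that touches all four
faces in this way is the entire tetrahedron, hence not a proper subset. Finally, the triangular
antiprism is an octahedron (`isSimilar_antiprism_three`).
-/

namespace Solid

open Real Set

noncomputable section

/-! ### Coordinates, cross product and rotations -/

theorem inner_eq (x y : E3) : inner ℝ x y = x 0 * y 0 + x 1 * y 1 + x 2 * y 2 := by
  simp [PiLp.inner_apply, Fin.sum_univ_three, mul_comm]

theorem ext_coord {x y : E3} (h0 : x 0 = y 0) (h1 : x 1 = y 1) (h2 : x 2 = y 2) : x = y := by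
  ext i
  fin_cases i <;> assumption

/-- The cross product of `ℝ³`, on the Euclidean space. -/
def cross (x y : E3) : E3 :=
  !₂[x 1 * y 2 - x 2 * y 1, x 2 * y 0 - x 0 * y 2, x 0 * y 1 - x 1 * y 0]

@[simp] theorem cross_zero (x y : E3) : cross x y 0 = x 1 * y 2 - x 2 * y 1 := rfl
@[simp] theorem cross_one (x y : E3) : cross x y 1 = x 2 * y 0 - x 0 * y 2 := rfl
@[simp] theorem cross_two (x y : E3) : cross x y 2 = x 0 * y 1 - x 1 * y 0 := rfl

/-- Rodrigues' formula: for `‖r‖ = 1` and `k = cos θ`, `σ = sin θ`, the rotation by the angle `θ`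
about the axis `r`. -/
def rod (r : E3) (k σ : ℝ) (x : E3) : E3 :=
  k • x + ((1 - k) * inner ℝ r x) • r + σ • cross r x

/-- For `‖v‖² = 3` and `ε = ±1`, the rotation by `±120°` about the axis `v`. With this
normalization of the axis, Rodrigues' formula has rational coefficients. -/
def trot (ε : ℝ) (v y : E3) : E3 :=
  (2⁻¹ : ℝ) • (-y + (inner ℝ v y : ℝ) • v + ε • cross v y)

theorem trot_apply (ε : ℝ) (v y : E3) (i : Fin 3) :
    trot ε v y i = 2⁻¹ * (-y i + (v 0 * y 0 + v 1 * y 1 + v 2 * y 2) * v i + ε * cross v y i) := by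
  simp only [trot, inner_eq, PiLp.smul_apply, PiLp.add_apply, PiLp.neg_apply, smul_eq_mul]

theorem rod_apply (r : E3) (k σ : ℝ) (x : E3) (i : Fin 3) :
    rod r k σ x i =
      k * x i + (1 - k) * (r 0 * x 0 + r 1 * x 1 + r 2 * x 2) * r i + σ * cross r x i := by
  simp [rod, inner_eq]

theorem cross_neg_left (x y : E3) : cross (-x) y = -cross x y := by
  apply ext_coord <;> simp <;> ring

theorem cross_smul_right (a : ℝ) (x y : E3) : cross x (a • y) = a • cross x y := by
  apply ext_coord <;> simp <;> ring

theorem cross_smul_left (a : ℝ) (x y : E3) : cross (a • x) y = a • cross x y := by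
  apply ext_coord <;> simp <;> ring

theorem inner_cross_cross (a b c d : E3) :
    inner ℝ (cross a b) (cross c d) = (inner ℝ a c * inner ℝ b d - inner ℝ a d * inner ℝ b c : ℝ) := by
  simp only [inner_eq, cross_zero, cross_one, cross_two]; ring

theorem inner_cross_self_left (a b : E3) : inner ℝ a (cross a b) = (0 : ℝ) := by
  simp only [inner_eq, cross_zero, cross_one, cross_two]; ring

theorem inner_cross_self_right (a b : E3) : inner ℝ b (cross a b) = (0 : ℝ) := by
  simp only [inner_eq, cross_zero, cross_one, cross_two]; ring

/-- A linear isometry commutes with the cross product up to its determinant `ε = ±1`. -/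
theorem exists_map_cross (g : E3 ≃ₗᵢ[ℝ] E3) :
    ∃ ε : ℝ, (ε = 1 ∨ ε = -1) ∧ ∀ a b, cross (g a) (g b) = ε • g (cross a b) := by
  set u := fun i : Fin 3 => g (EuclideanSpace.single i 1) with hu
  have hg : ∀ a : E3, g a = a 0 • u 0 + a 1 • u 1 + a 2 • u 2 := by
    intro a
    have : a = a 0 • EuclideanSpace.single 0 (1 : ℝ) + a 1 • EuclideanSpace.single 1 (1 : ℝ)
        + a 2 • EuclideanSpace.single 2 (1 : ℝ) := by
      apply ext_coord <;> simp
    conv_lhs => rw [this]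
    simp [hu, map_add, map_smul]
  set ε : ℝ := inner ℝ (cross (u 0) (u 1)) (u 2) with hε
  have key : ∀ a b, cross (g a) (g b) = ε • g (cross a b) := by
    intro a b
    refine ext_inner_right ℝ fun w => ?_
    obtain ⟨c, rfl⟩ := g.surjective w
    rw [inner_smul_left, LinearIsometryEquiv.inner_map_map, hε, hg a, hg b, hg c]
    simp only [inner_eq, cross_zero, cross_one, cross_two, PiLp.add_apply, PiLp.smul_apply,
      smul_eq_mul, RCLike.conj_to_real]
    ring
  refine ⟨ε, ?_, key⟩
  have h1 := congrArg (fun v => (inner ℝ v v : ℝ))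
    (key (EuclideanSpace.single 0 1) (EuclideanSpace.single 1 1))
  simp only [inner_cross_cross, inner_smul_left, inner_smul_right,
    LinearIsometryEquiv.inner_map_map] at h1
  simp [inner_eq] at h1
  have : (ε - 1) * (ε + 1) = 0 := by linarith
  rcases mul_eq_zero.1 this with h | h
  · left; linarith
  · right; linarith

theorem map_trot (g : E3 ≃ₗᵢ[ℝ] E3) {ε : ℝ} (hε : ∀ a b, cross (g a) (g b) = ε • g (cross a b))
    (h1 : ε = 1 ∨ ε = -1) (σ : ℝ) (v y : E3) : g (trot σ v y) = trot (ε * σ) (g v) (g y) := by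
  have h2 : ε * ε = 1 := by rcases h1 with h | h <;> rw [h] <;> norm_num
  have : (ε * σ) * ε = σ := by linear_combination σ * h2
  simp only [trot, map_smul, map_add, map_neg, LinearIsometryEquiv.inner_map_map, hε, smul_smul,
    this]

theorem map_rod (g : E3 ≃ₗᵢ[ℝ] E3) {ε : ℝ} (hε : ∀ a b, cross (g a) (g b) = ε • g (cross a b))
    (h1 : ε = 1 ∨ ε = -1) (r : E3) (k σ : ℝ) (y : E3) :
    g (rod r k σ y) = rod (g r) k (ε * σ) (g y) := by
  have h2 : ε * ε = 1 := by rcases h1 with h | h <;> rw [h] <;> norm_num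
  have : (ε * σ) * ε = σ := by linear_combination σ * h2
  simp only [rod, map_smul, map_add, LinearIsometryEquiv.inner_map_map, hε, smul_smul, this]

/-- Rotations about a common axis compose by adding their angles. -/
theorem rod_rod {r : E3} (hr : (inner ℝ r r : ℝ) = 1) (k σ k' σ' : ℝ) (x : E3) :
    rod r k σ (rod r k' σ' x) = rod r (k * k' - σ * σ') (k * σ' + σ * k') x := by
  rw [inner_eq] at hr
  have h2 : r 2 * r 2 = 1 - r 0 * r 0 - r 1 * r 1 := by linarith
  apply ext_coord <;> simp only [rod_apply, cross_zero, cross_one, cross_two]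
  · linear_combination (((1 - k) * (1 - k') * (r 0 * x 0 + r 1 * x 1 + r 2 * x 2) * r 0)
      - σ * σ' * x 0) * hr
  · linear_combination (((1 - k) * (1 - k') * (r 0 * x 0 + r 1 * x 1 + r 2 * x 2) * r 1)
      - σ * σ' * x 1) * hr
  · linear_combination (((1 - k) * (1 - k') * (r 0 * x 0 + r 1 * x 1 + r 2 * x 2) * r 2)
      - σ * σ' * x 2) * hr

theorem rod_one_zero (r x : E3) : rod r 1 0 x = x := by simp [rod]

theorem cross_add_right (a x y : E3) : cross a (x + y) = cross a x + cross a y := by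
  apply ext_coord <;> simp <;> ring

theorem cross_self (a : E3) : cross a a = 0 := by
  apply ext_coord <;> simp <;> ring

theorem cross_cross (a b c : E3) :
    cross a (cross b c) = (inner ℝ a c : ℝ) • b - (inner ℝ a b : ℝ) • c := by
  apply ext_coord <;> simp [inner_eq] <;> ring

theorem inner_normalize {v : E3} (hv : v ≠ 0) :
    (inner ℝ (‖v‖⁻¹ • v) (‖v‖⁻¹ • v) : ℝ) = 1 := by
  have : ‖v‖ ≠ 0 := norm_ne_zero_iff.2 hv
  rw [inner_smul_left, inner_smul_right, real_inner_self_eq_norm_sq]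
  simp
  field_simp

theorem exists_unit_orthogonal (r : E3) :
    ∃ u : E3, (inner ℝ r u : ℝ) = 0 ∧ (inner ℝ u u : ℝ) = 1 := by
  have key : ∀ v : E3, v ≠ 0 → inner ℝ r v = (0 : ℝ) →
      ∃ u : E3, (inner ℝ r u : ℝ) = 0 ∧ (inner ℝ u u : ℝ) = 1 := by
    intro v hv h
    refine ⟨‖v‖⁻¹ • v, by simp [inner_smul_right, h], ?_⟩
    exact inner_normalize hv
  by_cases h : r 0 = 0 ∧ r 1 = 0
  · refine key !₂[1, 0, 0] (fun h0 => ?_) (by simp [inner_eq, h.1])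
    simpa using congrArg (fun v : E3 => v 0) h0
  · refine key !₂[-r 1, r 0, 0] (fun h0 => h ?_) (by simp [inner_eq]; ring)
    have h1 := congrArg (fun v : E3 => v 0) h0
    have h2 := congrArg (fun v : E3 => v 1) h0
    simp at h1 h2
    exact ⟨h2, h1⟩

/-- A linear isometry of `ℝ³` of determinant one has a fixed axis: in terms of the matrix `M`,
`det (M - 1) = det M - tr (adj M) + tr M - 1 = 0`, since `adj M = Mᵀ`. -/
theorem exists_unit_fixed (g : E3 ≃ₗᵢ[ℝ] E3)
    (hg : ∀ a b, cross (g a) (g b) = g (cross a b)) :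
    ∃ r, (inner ℝ r r : ℝ) = 1 ∧ g r = r := by
  set e : Fin 3 → E3 := fun i => EuclideanSpace.single i 1 with he
  let M : Matrix (Fin 3) (Fin 3) ℝ := Matrix.of fun i j => g (e j) i
  have hc01 : cross (e 0) (e 1) = e 2 := by apply ext_coord <;> simp [he]
  have hc12 : cross (e 1) (e 2) = e 0 := by apply ext_coord <;> simp [he]
  have hc20 : cross (e 2) (e 0) = e 1 := by apply ext_coord <;> simp [he]
  have h01 := hg (e 0) (e 1)
  have h12 := hg (e 1) (e 2)
  have h20 := hg (e 2) (e 0)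
  rw [hc01] at h01
  rw [hc12] at h12
  rw [hc20] at h20
  have h0 : (inner ℝ (g (e 0)) (g (e 0)) : ℝ) = 1 := by
    rw [LinearIsometryEquiv.inner_map_map]; simp [he]
  rw [inner_eq] at h0
  have a0 := congrArg (fun v : E3 => v 0) h12
  have a1 := congrArg (fun v : E3 => v 1) h12
  have a2 := congrArg (fun v : E3 => v 2) h12
  have b1 := congrArg (fun v : E3 => v 1) h20
  have c2 := congrArg (fun v : E3 => v 2) h01
  simp only [cross_zero, cross_one, cross_two] at a0 a1 a2 b1 c2
  have hdet : (M - 1).det = 0 := by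
    rw [Matrix.det_fin_three]
    simp only [Matrix.sub_apply, Matrix.one_apply, M, Matrix.of_apply]
    simp
    linear_combination (g (e 0) 0 - 1) * a0 + g (e 0) 1 * a1 + g (e 0) 2 * a2 - b1 - c2 + h0
  obtain ⟨v, hv, hMv⟩ := Matrix.exists_mulVec_eq_zero_iff.2 hdet
  set x : E3 := WithLp.toLp 2 v with hx
  have hx0 : x ≠ 0 := fun h => hv (by simpa [hx] using h)
  have hgx : g x = x := by
    have hxe : x = v 0 • e 0 + v 1 • e 1 + v 2 • e 2 := by
      apply ext_coord <;> simp [he, hx]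
    have h3 : ∀ i, g x i = x i := by
      intro i
      have h4 := congrFun hMv i
      simp only [Matrix.mulVec, dotProduct, Fin.sum_univ_three, Matrix.sub_apply, Pi.zero_apply,
        M, Matrix.of_apply] at h4
      rw [hxe, map_add, map_add, map_smul, map_smul, map_smul, ← hxe]
      simp only [PiLp.add_apply, PiLp.smul_apply, smul_eq_mul]
      have h5 : (1 : Matrix (Fin 3) (Fin 3) ℝ) i 0 * v 0 + (1 : Matrix (Fin 3) (Fin 3) ℝ) i 1 * v 1
          + (1 : Matrix (Fin 3) (Fin 3) ℝ) i 2 * v 2 = x i := by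
        fin_cases i <;> simp [hx, Matrix.one_apply]
      linarith
    exact ext_coord (h3 0) (h3 1) (h3 2)
  refine ⟨‖x‖⁻¹ • x, ?_, by rw [map_smul, hgx]⟩
  exact inner_normalize hx0

/-- Every orthonormal triple is the image of the standard basis under a linear isometry. -/
theorem exists_isometry_of_frame (a b c : E3) (haa : inner ℝ a a = (1 : ℝ))
    (hbb : inner ℝ b b = (1 : ℝ)) (hcc : inner ℝ c c = (1 : ℝ)) (hab : inner ℝ a b = (0 : ℝ))
    (hac : inner ℝ a c = (0 : ℝ)) (hbc : inner ℝ b c = (0 : ℝ)) :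
    ∃ φ : E3 ≃ₗᵢ[ℝ] E3, ∀ x, φ x = x 0 • a + x 1 • b + x 2 • c := by
  have hn : ∀ v : E3, inner ℝ v v = (1 : ℝ) → ‖v‖ = 1 := fun v hv => by
    rw [real_inner_self_eq_norm_sq] at hv
    nlinarith [norm_nonneg v]
  have ho : Orthonormal ℝ ![a, b, c] := by
    constructor
    · intro i; fin_cases i
      exacts [hn a haa, hn b hbb, hn c hcc]
    · intro i j hij
      fin_cases i <;> fin_cases j <;> simp_all [real_inner_comm]
  have hcard : Fintype.card (Fin 3) = Module.finrank ℝ E3 := by simp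
  have hs : ⊤ ≤ Submodule.span ℝ (range ![a, b, c]) := by
    rw [ho.linearIndependent.span_eq_top_of_card_eq_finrank hcard]
  let B := OrthonormalBasis.mk ho hs
  refine ⟨B.repr.symm, fun x => ?_⟩
  rw [← B.sum_repr_symm]
  simp [B, Fin.sum_univ_three]

/-- A linear isometry of determinant one is a rotation about some axis. -/
theorem exists_eq_rod (g : E3 ≃ₗᵢ[ℝ] E3) (hg : ∀ a b, cross (g a) (g b) = g (cross a b)) :
    ∃ r k σ, (inner ℝ r r : ℝ) = 1 ∧ k ^ 2 + σ ^ 2 = 1 ∧ ∀ x, g x = rod r k σ x := by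
  obtain ⟨r, hr, hgr⟩ := exists_unit_fixed g hg
  obtain ⟨u, hru, hu⟩ := exists_unit_orthogonal r
  have hur : (inner ℝ u r : ℝ) = 0 := by rw [real_inner_comm]; exact hru
  set w := cross r u with hw
  have hww : (inner ℝ w w : ℝ) = 1 := by rw [hw, inner_cross_cross, hr, hu, hru]; ring
  have hrw : (inner ℝ r w : ℝ) = 0 := inner_cross_self_left r u
  have huw : (inner ℝ u w : ℝ) = 0 := inner_cross_self_right r u
  have hcw : cross r w = -u := by rw [hw, cross_cross, hru, hr]; simp
  obtain ⟨φ, hφ⟩ := exists_isometry_of_frame r u w hr hu hww hru hrw huw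
  obtain ⟨y, hy⟩ := φ.surjective (g u)
  rw [hφ] at hy
  have hrgu : (inner ℝ r (g u) : ℝ) = 0 := by
    rw [← hru, ← LinearIsometryEquiv.inner_map_map g r u, hgr]
  have hy0 : y 0 = 0 := by
    rw [← hy] at hrgu
    simpa only [inner_add_right, inner_smul_right, hr, hru, hrw, mul_one, mul_zero, add_zero]
      using hrgu
  have hgu : g u = y 1 • u + y 2 • w := by rw [← hy, hy0]; simp
  have hgw : g w = y 1 • w - y 2 • u := by
    rw [hw, ← hg, hgr, hgu, cross_add_right, cross_smul_right, cross_smul_right, hcw]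
    simp [sub_eq_add_neg]
  refine ⟨r, y 1, y 2, hr, ?_, fun x => ?_⟩
  · have h := LinearIsometryEquiv.inner_map_map g u u
    rw [hgu, hu] at h
    simp only [inner_add_left, inner_add_right, inner_smul_left, inner_smul_right, hu, hww, huw,
      real_inner_comm u w] at h
    simp at h
    nlinarith
  · obtain ⟨z, rfl⟩ := φ.surjective x
    have h1 : (inner ℝ r (φ z) : ℝ) = z 0 := by
      rw [hφ]; simp only [inner_add_right, inner_smul_right, hr, hru, hrw]; ring
    have h2 : cross r (φ z) = z 1 • w - z 2 • u := by
      rw [hφ]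
      simp only [cross_add_right, cross_smul_right, cross_self, hcw, ← hw]
      module
    rw [rod, h1, h2, hφ, map_add, map_add, map_smul, map_smul, map_smul, hgr, hgu, hgw]
    module

/-- Two pairs of vectors with the same lengths and the same angle are related by a linear
isometry. -/
theorem exists_isometry_of_pair {p q p' q' : E3} (hpp : (inner ℝ p p : ℝ) = inner ℝ p' p')
    (hqq : (inner ℝ q q : ℝ) = inner ℝ q' q') (hpq : (inner ℝ p q : ℝ) = inner ℝ p' q')
    (hp : p ≠ 0) (hli : (inner ℝ p q : ℝ) ^ 2 < inner ℝ p p * inner ℝ q q) :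
    ∃ φ : E3 ≃ₗᵢ[ℝ] E3, φ p = p' ∧ φ q = q' := by
  have hA : 0 < (inner ℝ p p : ℝ) := real_inner_self_pos.2 hp
  set A : ℝ := inner ℝ p p with hAdef
  set C : ℝ := inner ℝ p q with hCdef
  set B : ℝ := inner ℝ q q with hBdef
  have hD : 0 < A * B - C ^ 2 := by linarith
  have frame : ∀ x y : E3, inner ℝ x x = A → inner ℝ y y = B → inner ℝ x y = C →
      ∃ φ : E3 ≃ₗᵢ[ℝ] E3, φ !₂[√A, 0, 0] = x ∧
        φ !₂[C / √A, √(A * B - C ^ 2) / √A, 0] = y := by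
    intro x y hx hy hxy
    have hyx : inner ℝ y x = C := by rw [real_inner_comm]; exact hxy
    have sA : √A ^ 2 = A := Real.sq_sqrt hA.le
    have sA0 : √A ≠ 0 := (Real.sqrt_pos.2 hA).ne'
    have sD : √(A * B - C ^ 2) ^ 2 = A * B - C ^ 2 := Real.sq_sqrt hD.le
    have sD0 : √(A * B - C ^ 2) ≠ 0 := (Real.sqrt_pos.2 hD).ne'
    have iw : ∀ z : E3, inner ℝ z (A • y - C • x) = (A * inner ℝ z y - C * inner ℝ z x : ℝ) :=
      fun z => by rw [inner_sub_right, inner_smul_right, inner_smul_right]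
    have ixw : inner ℝ x (A • y - C • x) = (0 : ℝ) := by rw [iw, hxy, hx]; ring
    have iww : inner ℝ (A • y - C • x) (A • y - C • x) = (A * (A * B - C ^ 2) : ℝ) := by
      rw [iw, inner_sub_left, inner_sub_left, inner_smul_left, inner_smul_left, inner_smul_left,
        inner_smul_left, hx, hy, hxy, hyx]; simp; ring
    obtain ⟨φ, hφ⟩ := exists_isometry_of_frame ((√A)⁻¹ • x)
      ((√A * √(A * B - C ^ 2))⁻¹ • (A • y - C • x))
      (cross ((√A)⁻¹ • x) ((√A * √(A * B - C ^ 2))⁻¹ • (A • y - C • x)))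
      (by
        rw [inner_smul_left, inner_smul_right, hx]; simp; field_simp; linarith)
      (by
        rw [inner_smul_left, inner_smul_right, iww]; simp; field_simp; rw [sA, sD]; ring)
      (by
        rw [inner_cross_cross]
        simp only [inner_smul_left, inner_smul_right, hx, iww, ixw]
        simp; field_simp
        rw [show √A ^ 4 = (√A ^ 2) ^ 2 by ring, sA, sD])
      (by
        simp only [inner_smul_left, inner_smul_right, ixw]; simp)
      (inner_cross_self_left _ _) (inner_cross_self_right _ _)
    refine ⟨φ, ?_, ?_⟩
    · rw [hφ]; simp [smul_smul, sA0]
    · rw [hφ]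
      simp only [smul_smul, smul_sub]
      have h1 : C / √A * (√A)⁻¹ = C / A := by field_simp; rw [sA]
      have h2 : √(A * B - C ^ 2) / √A * ((√A * √(A * B - C ^ 2))⁻¹ * A) = 1 := by
        field_simp; rw [sA]
      have h3 : √(A * B - C ^ 2) / √A * ((√A * √(A * B - C ^ 2))⁻¹ * C) = C / A := by
        field_simp; rw [sA]; ring
      simp only [Matrix.cons_val_zero, Matrix.cons_val_one, Matrix.cons_val, h1, h2, h3]
      simp
  obtain ⟨φ, h1, h2⟩ := frame p q rfl rfl rfl
  obtain ⟨ψ, h3, h4⟩ := frame p' q' hpp.symm hqq.symm hpq.symm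
  exact ⟨φ.symm.trans ψ, by rw [LinearIsometryEquiv.trans_apply, ← h1]; simp [h3],
    by rw [LinearIsometryEquiv.trans_apply, ← h2]; simp [h4]⟩

/-! ### Systems of three-fold axes -/

theorem trot_neg_axis (ε : ℝ) (v y : E3) : trot ε (-v) y = trot (-ε) v y := by
  apply ext_coord <;> simp [trot_apply] <;> ring

theorem inner_trot (σ : ℝ) (a b y : E3) :
    (inner ℝ y (trot σ b a) : ℝ) =
      2⁻¹ * (-inner ℝ y a + inner ℝ b a * inner ℝ y b + σ * inner ℝ y (cross b a)) := by
  rw [trot, inner_smul_right, inner_add_right, inner_add_right, inner_smul_right,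
    inner_smul_right, inner_neg_right]

/-- A finite set of vectors of squared length `3`, closed under negation and under the rotations by
`120°` about its members. The axes of the rotations of order three in a finite group form such a
set. -/
structure IsAxisSystem (P : Set E3) : Prop where
  finite : P.Finite
  inner_self : ∀ x ∈ P, (inner ℝ x x : ℝ) = 3
  neg_mem : ∀ x ∈ P, -x ∈ P
  trot_mem : ∀ x ∈ P, ∀ y ∈ P, trot 1 x y ∈ P

theorem IsAxisSystem.trot_mem' {P : Set E3} (hP : IsAxisSystem P) {σ : ℝ} (hσ : σ = 1 ∨ σ = -1)
    {x y : E3} (hx : x ∈ P) (hy : y ∈ P) : trot σ x y ∈ P := by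
  rcases hσ with rfl | rfl
  · exact hP.trot_mem x hx y hy
  · rw [← trot_neg_axis]; exact hP.trot_mem _ (hP.neg_mem x hx) y hy

theorem IsAxisSystem.map {P : Set E3} (hP : IsAxisSystem P) (φ : E3 ≃ₗᵢ[ℝ] E3) :
    IsAxisSystem (φ '' P) where
  finite := hP.finite.image _
  inner_self := by
    rintro _ ⟨x, hx, rfl⟩
    rw [LinearIsometryEquiv.inner_map_map, hP.inner_self x hx]
  neg_mem := by
    rintro _ ⟨x, hx, rfl⟩
    exact ⟨-x, hP.neg_mem x hx, map_neg φ x⟩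
  trot_mem := by
    rintro _ ⟨x, hx, rfl⟩ _ ⟨y, hy, rfl⟩
    obtain ⟨ε, h1, hε⟩ := exists_map_cross φ
    refine ⟨trot ε x y, hP.trot_mem' h1 hx hy, ?_⟩
    rw [map_trot φ hε h1]
    rcases h1 with rfl | rfl <;> norm_num

/-- Three consecutive vertices `a`, `b`, `d` of a spherical polygon with equal sides and all
interior angles `120°` determine the next one. -/
theorem trot_polygon {a b : E3} {C σ : ℝ} (hb : (inner ℝ b b : ℝ) = 3)
    (hab : (inner ℝ b a : ℝ) = C) (hσ : σ = 1 ∨ σ = -1) :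
    trot σ (trot σ b a) b = a + ((C + 1) / 2) • (trot σ b a - b) := by
  have h2 : σ * σ = 1 := by rcases hσ with h | h <;> rw [h] <;> norm_num
  set d := trot σ b a with hd
  have h1 : (inner ℝ d b : ℝ) = C := by
    rw [real_inner_comm, hd, inner_trot, hb, inner_cross_self_left, hab]; ring
  have h3 : σ • cross b a = (2 : ℝ) • d + a - C • b := by
    rw [hd, trot, hab]; module
  have h4 : cross d b = (2⁻¹ : ℝ) • (cross b a + σ • ((3 : ℝ) • a - C • b)) := by
    rw [← hb, ← hab, hd]
    apply ext_coord <;>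
      simp only [cross_zero, cross_one, cross_two, trot_apply, inner_eq, PiLp.smul_apply,
        PiLp.add_apply, PiLp.sub_apply, smul_eq_mul] <;> ring
  have h5 : σ • cross d b = d + (2 : ℝ) • a - C • b := by
    rw [h4, smul_comm, smul_add, smul_smul, h2, h3]; module
  rw [trot, h1, h5]
  module

/-- In a system of three-fold axes that is not a single line, a closest pair of axes encloses the
angle of two adjacent vertices of a cube or of a dodecahedron. Otherwise, the polygon with interior
angles `120°` that starts with the pair would have two closer vertices. -/
theorem IsAxisSystem.exists_closest {P : Set E3} (hP : IsAxisSystem P)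
    (h : ∃ x ∈ P, ∃ y ∈ P, y ≠ x ∧ y ≠ -x) :
    ∃ p ∈ P, ∃ q ∈ P, ((inner ℝ p q : ℝ) = 1 ∨ (inner ℝ p q : ℝ) = √5) ∧
      ∀ x ∈ P, ∀ y ∈ P, y ≠ x → y ≠ -x → (inner ℝ x y : ℝ) ≤ inner ℝ p q := by
  let A : Set (E3 × E3) := {z | z.1 ∈ P ∧ z.2 ∈ P ∧ z.2 ≠ z.1 ∧ z.2 ≠ -z.1}
  have hA : A.Finite := (hP.finite.prod hP.finite).subset fun z hz => ⟨hz.1, hz.2.1⟩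
  have hne : A.Nonempty := by
    obtain ⟨x, hx, y, hy, h1, h2⟩ := h
    exact ⟨(x, y), hx, hy, h1, h2⟩
  obtain ⟨⟨p, q⟩, ⟨hp, hq, hqp, hqp'⟩, hmax⟩ :=
    exists_max_image A (fun z => (inner ℝ z.1 z.2 : ℝ)) hA hne
  simp only at hp hq hqp hqp' hmax
  have hmax' : ∀ x ∈ P, ∀ y ∈ P, y ≠ x → y ≠ -x → (inner ℝ x y : ℝ) ≤ inner ℝ p q :=
    fun x hx y hy h1 h2 => hmax (x, y) ⟨hx, hy, h1, h2⟩
  refine ⟨p, hp, q, hq, ?_, hmax'⟩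
  set C : ℝ := inner ℝ p q with hC
  have hpp := hP.inner_self p hp
  have hqq := hP.inner_self q hq
  have hqpC : (inner ℝ q p : ℝ) = C := by rw [real_inner_comm]
  have hC3 : C < 3 := by
    have : 0 < (inner ℝ (p - q) (p - q) : ℝ) :=
      real_inner_self_pos.2 (sub_ne_zero.2 (Ne.symm hqp))
    rw [inner_sub_left, inner_sub_right, inner_sub_right, hpp, hqq, hqpC] at this
    linarith
  have hC0 : 0 ≤ C := by
    have := hmax' p hp (-q) (hP.neg_mem q hq) (fun h => hqp' (by rw [← h, neg_neg]))
      (fun h => hqp (neg_injective h))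
    rw [inner_neg_right] at this
    linarith
  have near : ∀ x ∈ P, (inner ℝ p x : ℝ) = 3 ∨ (inner ℝ p x : ℝ) ≤ C := by
    intro x hx
    by_cases h1 : x = p
    · left; rw [h1, hpp]
    · right
      by_cases h2 : x = -p
      · rw [h2, inner_neg_right, hpp]; linarith
      · exact hmax' p hp x hx h1 h2
  -- The vertices `p`, `q`, `p₂`, `p₃`, `p₄`, `p₅` of the polygon.
  set p₂ := trot 1 q p with hp₂
  have m₂ : p₂ ∈ P := hP.trot_mem q hq p hp
  set p₃ := trot 1 p₂ q with hp₃
  have m₃ : p₃ ∈ P := hP.trot_mem _ m₂ q hq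
  set p₄ := trot 1 p₃ p₂ with hp₄
  have m₄ : p₄ ∈ P := hP.trot_mem _ m₃ _ m₂
  set p₅ := trot 1 p₄ p₃ with hp₅
  have m₅ : p₅ ∈ P := hP.trot_mem _ m₄ _ m₃
  have c₂ : (inner ℝ p₂ q : ℝ) = C := by
    rw [real_inner_comm, hp₂, inner_trot, hqq, inner_cross_self_left, hqpC]; ring
  have c₃ : (inner ℝ p₃ p₂ : ℝ) = C := by
    rw [real_inner_comm, hp₃, inner_trot, hP.inner_self _ m₂, inner_cross_self_left, c₂]; ring
  have e₃ : p₃ = p + ((C + 1) / 2) • (p₂ - q) := trot_polygon hqq hqpC (Or.inl rfl)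
  have e₄ : p₄ = q + ((C + 1) / 2) • (p₃ - p₂) :=
    trot_polygon (hP.inner_self _ m₂) c₂ (Or.inl rfl)
  have e₅ : p₅ = p₂ + ((C + 1) / 2) • (p₄ - p₃) :=
    trot_polygon (hP.inner_self _ m₃) c₃ (Or.inl rfl)
  -- The inner products of `p` with the vertices of the polygon, as polynomials in `C`. That of `p₅`
  -- is `3` exactly if the polygon is a pentagon that closes up, that is, if `C = √5`.
  have i₂ : (inner ℝ p p₂ : ℝ) = (C ^ 2 - 3) / 2 := by
    rw [hp₂, inner_trot, inner_cross_self_right, hqpC, hpp, ← hC]; ring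
  have i₃ : (inner ℝ p p₃ : ℝ) = 3 + ((C + 1) / 2) * ((C ^ 2 - 3) / 2 - C) := by
    rw [e₃, inner_add_right, inner_smul_right, inner_sub_right, hpp, i₂]
  have i₄ : (inner ℝ p p₄ : ℝ) = 3 - (3 - C) * (C - 1) ^ 2 * (C + 3) / 8 := by
    rw [e₄, inner_add_right, inner_smul_right, inner_sub_right, i₃, i₂, ← hC]; ring
  have i₅ : (inner ℝ p p₅ : ℝ) = 3 - (3 - C) * (C ^ 2 - 5) ^ 2 / 16 := by
    rw [e₅, inner_add_right, inner_smul_right, inner_sub_right, i₄, i₃, i₂]; ring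
  have n₄ := near _ m₄
  have n₅ := near _ m₅
  rw [i₄] at n₄
  rw [i₅] at n₅
  have hC3' : 0 < 3 - C := by linarith
  -- If `p₅ = p`, then `C = √5`. Otherwise `p₅` is not closer to `p` than `q`, which forces `C ≤ 1`,
  -- and then `p₄` is too close to `p` unless `p₄ = p` and `C = 1`.
  rcases n₅ with n₅ | n₅
  · right
    have h1 : (3 - C) * (C ^ 2 - 5) ^ 2 = 0 := by linarith
    have h2 : C ^ 2 - 5 = 0 := by
      rcases mul_eq_zero.1 h1 with h | h
      · linarith
      · exact pow_eq_zero_iff (two_ne_zero) |>.1 h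
    rw [← Real.sqrt_sq hC0]
    congr 1
    linarith
  · left
    have h1 : 0 ≤ (3 - C) * ((C ^ 2 - 5) ^ 2 / 16 - 1) := by linarith
    have h2 : 0 ≤ (C ^ 2 - 5) ^ 2 / 16 - 1 := nonneg_of_mul_nonneg_right h1 hC3'
    have h3 : (9 - C ^ 2) * (1 - C ^ 2) ≥ 0 := by linarith
    have h4 : C ^ 2 < 9 := by
      have := pow_lt_pow_left₀ (by linarith : C < 3) hC0 two_ne_zero
      linarith
    have h5 : 0 ≤ 1 - C ^ 2 := nonneg_of_mul_nonneg_right h3 (by linarith)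
    have h6 : C ≤ 1 := by nlinarith
    rcases n₄ with n₄ | n₄
    · have h7 : ((3 - C) * (C + 3)) * (C - 1) ^ 2 = 0 := by linarith
      rcases mul_eq_zero.1 h7 with h | h
      · nlinarith
      · have := pow_eq_zero_iff (two_ne_zero) |>.1 h
        linarith
    · exfalso
      have h7 : 0 ≤ (3 - C) * ((C - 1) ^ 2 * (C + 3) / 8 - 1) := by linarith
      have h8 := nonneg_of_mul_nonneg_right h7 hC3'
      have h9 : (C - 1) ^ 2 ≤ 1 := by
        rw [sq_le_one_iff_abs_le_one, abs_le]
        exact ⟨by linarith, by linarith⟩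
      have h10 := mul_le_mul h9 (by linarith : C + 3 ≤ 4) (by linarith) zero_le_one
      linarith

/-- The vertices of the cube. -/
def cubeVertices : Set E3 := {x : E3 | ∀ i, |x i| = 1}

/-- The vertices of the dodecahedron. -/
def dodecahedronVertices : Set E3 :=
  {x : E3 | ∀ i, |x i| = 1} ∪
    {x : E3 | ∃ i : Fin 3,
      x i = 0 ∧ |x (i + 1)| = goldenRatio⁻¹ ∧ |x (i + 2)| = goldenRatio}

theorem trot_diag (a b c : ℝ) : trot 1 !₂[1, 1, 1] !₂[a, b, c] = !₂[c, a, b] := by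
  apply ext_coord <;> simp [trot_apply] <;> ring

/-- Two adjacent vertices of the cube generate all of them under the rotations about the first one
and the negation. -/
theorem IsAxisSystem.cubeVertices_subset {Q : Set E3} (hQ : IsAxisSystem Q)
    (h1 : !₂[1, 1, 1] ∈ Q) (h2 : !₂[1, 1, -1] ∈ Q) : cubeVertices ⊆ Q := by
  have cyc : ∀ a b c : ℝ, (!₂[a, b, c] : E3) ∈ Q → (!₂[c, a, b] : E3) ∈ Q := fun a b c h => by
    rw [← trot_diag]; exact hQ.trot_mem _ h1 _ h
  have neg : ∀ a b c : ℝ, (!₂[a, b, c] : E3) ∈ Q → (!₂[-a, -b, -c] : E3) ∈ Q := fun a b c h => by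
    have h3 := hQ.neg_mem _ h
    rwa [show -(!₂[a, b, c] : E3) = !₂[-a, -b, -c] by apply ext_coord <;> simp] at h3
  have h3 := cyc _ _ _ h2
  have h4 := cyc _ _ _ h3
  have k1 := neg _ _ _ h1
  have k2 := neg _ _ _ h2
  have k3 := neg _ _ _ h3
  have k4 := neg _ _ _ h4
  simp only [neg_neg] at k2 k3 k4
  intro x hx
  have e : x = !₂[x 0, x 1, x 2] := by apply ext_coord <;> simp
  rw [e]
  rcases eq_or_eq_neg_of_abs_eq (hx 0) with a | a <;>
  rcases eq_or_eq_neg_of_abs_eq (hx 1) with b | b <;>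
  rcases eq_or_eq_neg_of_abs_eq (hx 2) with c | c <;> rw [a, b, c] <;> assumption

theorem IsAxisSystem.eq_cubeVertices {Q : Set E3} (hQ : IsAxisSystem Q)
    (h1 : !₂[1, 1, 1] ∈ Q) (h2 : !₂[1, 1, -1] ∈ Q)
    (hmax : ∀ x ∈ Q, ∀ y ∈ Q, y ≠ x → y ≠ -x → (inner ℝ x y : ℝ) ≤ 1) : Q = cubeVertices := by
  have hsub := hQ.cubeVertices_subset h1 h2
  refine Subset.antisymm (fun x hx => ?_) hsub
  by_contra hxc
  -- A further point `x` would have inner product at most `1` with all vertices of the cube, hence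
  -- `|x 0| + |x 1| + |x 2| ≤ 1`, which contradicts `‖x‖ ^ 2 = 3`.
  have key : ∀ s t u : ℝ, |s| = 1 → |t| = 1 → |u| = 1 → s * x 0 + t * x 1 + u * x 2 ≤ 1 := by
    intro s t u hs ht hu
    have hm : (!₂[s, t, u] : E3) ∈ cubeVertices := by
      intro i; fin_cases i <;> simpa
    have := hmax _ (hsub hm) x hx (fun h => hxc (h ▸ hm)) (fun h => hxc ?_)
    · simpa [inner_eq] using this
    · rw [h]; intro i; simpa using hm i
  have hxx := hQ.inner_self x hx
  rw [inner_eq] at hxx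
  have habs : ∀ a : ℝ, ∃ s : ℝ, |s| = 1 ∧ s * a = |a| := fun a => by
    rcases le_total 0 a with h | h
    · exact ⟨1, by simp, by rw [abs_of_nonneg h, one_mul]⟩
    · exact ⟨-1, by simp, by rw [abs_of_nonpos h]; ring⟩
  obtain ⟨s, hs, hs'⟩ := habs (x 0)
  obtain ⟨t, ht, ht'⟩ := habs (x 1)
  obtain ⟨u, hu, hu'⟩ := habs (x 2)
  have := key s t u hs ht hu
  rw [hs', ht', hu'] at this
  rw [← abs_mul_abs_self (x 0), ← abs_mul_abs_self (x 1), ← abs_mul_abs_self (x 2)] at hxx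
  nlinarith [abs_nonneg (x 0), abs_nonneg (x 1), abs_nonneg (x 2)]

theorem goldenRatio_inv_eq : goldenRatio⁻¹ = goldenRatio - 1 := by
  rw [inv_goldenRatio]
  linarith [goldenRatio_add_goldenConj]

/-- Two adjacent vertices of the dodecahedron generate all of them under the rotations about the
points obtained and the negation. -/
theorem IsAxisSystem.dodecahedronVertices_subset {Q : Set E3} (hQ : IsAxisSystem Q)
    (h1 : !₂[1, 1, 1] ∈ Q) (h2 : !₂[0, goldenRatio⁻¹, goldenRatio] ∈ Q) :
    dodecahedronVertices ⊆ Q := by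
  have hg := goldenRatio_sq
  have cyc : ∀ a b c : ℝ, (!₂[a, b, c] : E3) ∈ Q → (!₂[c, a, b] : E3) ∈ Q := fun a b c h => by
    rw [← trot_diag]; exact hQ.trot_mem _ h1 _ h
  have neg : ∀ a b c : ℝ, (!₂[a, b, c] : E3) ∈ Q → (!₂[-a, -b, -c] : E3) ∈ Q := fun a b c h => by
    have h3 := hQ.neg_mem _ h
    rwa [show -(!₂[a, b, c] : E3) = !₂[-a, -b, -c] by apply ext_coord <;> simp] at h3
  rw [goldenRatio_inv_eq] at h2
  have h3 : (!₂[-1, 1, 1] : E3) ∈ Q := by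
    have := hQ.trot_mem _ h2 _ h1
    convert this using 1
    apply ext_coord <;> simp [trot_apply]
    · ring
    · linear_combination -hg
    · linear_combination -hg
  have h4 : (!₂[0, -(goldenRatio - 1), goldenRatio] : E3) ∈ Q := by
    have := hQ.trot_mem' (Or.inr rfl) h2 h1
    convert this using 1
    apply ext_coord <;> simp [trot_apply]
    · linear_combination -hg
    · linear_combination -hg
  have h5 : (!₂[1, 1, -1] : E3) ∈ Q := cyc _ _ _ (cyc _ _ _ h3)
  rintro x (hx | ⟨i, hx⟩)
  · exact hQ.cubeVertices_subset h1 h5 hx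
  have a1 := cyc _ _ _ h2
  have a2 := cyc _ _ _ a1
  have b1 := cyc _ _ _ h4
  have b2 := cyc _ _ _ b1
  have c0 := neg _ _ _ h2
  have c1 := neg _ _ _ a1
  have c2 := neg _ _ _ a2
  have d0 := neg _ _ _ h4
  have d1 := neg _ _ _ b1
  have d2 := neg _ _ _ b2
  rw [neg_zero] at c0 c1 c2 d0 d1 d2
  rw [neg_neg] at d0 d1 d2
  have e : x = !₂[x 0, x 1, x 2] := by apply ext_coord <;> simp
  rw [e]
  rw [goldenRatio_inv_eq] at hx
  obtain ⟨hx0, hx1, hx2⟩ := hx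
  fin_cases i <;> simp at hx0 hx1 hx2 <;>
  rcases eq_or_eq_neg_of_abs_eq hx1 with b | b <;>
  rcases eq_or_eq_neg_of_abs_eq hx2 with c | c <;> rw [hx0, b, c] <;> assumption

theorem IsAxisSystem.eq_dodecahedronVertices {Q : Set E3} (hQ : IsAxisSystem Q)
    (h1 : !₂[1, 1, 1] ∈ Q) (h2 : !₂[0, goldenRatio⁻¹, goldenRatio] ∈ Q)
    (hmax : ∀ x ∈ Q, ∀ y ∈ Q, y ≠ x → y ≠ -x → (inner ℝ x y : ℝ) ≤ √5) :
    Q = dodecahedronVertices := by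
  have hsub := hQ.dodecahedronVertices_subset h1 h2
  refine Subset.antisymm (fun x hx => ?_) hsub
  by_contra hxc
  have hneg : ∀ y ∈ dodecahedronVertices, -y ∈ dodecahedronVertices := by
    rintro y (hy | ⟨i, hy⟩)
    · exact Or.inl fun i => by simpa using hy i
    · exact Or.inr ⟨i, by simpa using hy⟩
  -- The inner product of a further point `x` with every vertex has absolute value at most `√5`.
  have key : ∀ y ∈ dodecahedronVertices,
      0 ≤ (inner ℝ y x : ℝ) ^ 2 * (5 - (inner ℝ y x : ℝ) ^ 2) := by
    intro y hy
    have a := hmax _ (hsub hy) x hx (fun h => hxc (h ▸ hy)) (fun h => hxc (h ▸ hneg y hy))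
    have b := hmax _ (hsub (hneg y hy)) x hx (fun h => hxc (h ▸ hneg y hy))
      (fun h => hxc (by rw [h, neg_neg]; exact hy))
    rw [inner_neg_left] at b
    have h5 : √5 ^ 2 = (5 : ℝ) := Real.sq_sqrt (by norm_num)
    have : (inner ℝ y x : ℝ) ^ 2 ≤ 5 := by
      rw [← h5]; exact sq_le_sq' (by linarith) a
    exact mul_nonneg (sq_nonneg _) (by linarith)
  have hxx := hQ.inner_self x hx
  rw [inner_eq] at hxx
  set g := goldenRatio with hg
  set k := goldenRatio⁻¹ with hk
  have hgpos : 0 < g := goldenRatio_pos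
  have hkpos : 0 < k := inv_pos.2 hgpos
  have hkg : k * g = 1 := inv_mul_cancel₀ hgpos.ne'
  have hs : k ^ 2 + g ^ 2 = 3 := by
    rw [hk, goldenRatio_inv_eq]; linear_combination 2 * goldenRatio_sq
  have h4 : k ^ 4 + g ^ 4 = 7 := by
    linear_combination (k ^ 2 + g ^ 2 + 3) * hs - 2 * (k * g + 1) * hkg
  have cube : ∀ s t : ℝ, |s| = 1 → |t| = 1 → (!₂[1, s, t] : E3) ∈ dodecahedronVertices :=
    fun s t hs ht => Or.inl fun i => by fin_cases i <;> simp [hs, ht]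
  have hk' : |k| = k := abs_of_pos hkpos
  have hg' : ∀ s : ℝ, |s| = 1 → |s * g| = g := fun s hs => by
    rw [abs_mul, hs, one_mul, abs_of_pos hgpos]
  have r0 : ∀ s : ℝ, |s| = 1 → (!₂[0, k, s * g] : E3) ∈ dodecahedronVertices := fun s hs =>
    Or.inr ⟨0, rfl, hk', hg' s hs⟩
  have r1 : ∀ s : ℝ, |s| = 1 → (!₂[s * g, 0, k] : E3) ∈ dodecahedronVertices := fun s hs =>
    Or.inr ⟨1, rfl, hk', hg' s hs⟩
  have r2 : ∀ s : ℝ, |s| = 1 → (!₂[k, s * g, 0] : E3) ∈ dodecahedronVertices := fun s hs =>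
    Or.inr ⟨2, rfl, hk', hg' s hs⟩
  have p1 : |(1 : ℝ)| = 1 := abs_one
  have p2 : |(-1 : ℝ)| = 1 := by simp
  have q1 := key _ (cube 1 1 p1 p1)
  have q2 := key _ (cube 1 (-1) p1 p2)
  have q3 := key _ (cube (-1) 1 p2 p1)
  have q4 := key _ (cube (-1) (-1) p2 p2)
  have q5 := key _ (r0 1 p1)
  have q6 := key _ (r0 (-1) p2)
  have q7 := key _ (r1 1 p1)
  have q8 := key _ (r1 (-1) p2)
  have q9 := key _ (r2 1 p1)
  have q10 := key _ (r2 (-1) p2)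
  -- The vertices form a spherical `4`-design: the values `t` of the ten products satisfy
  -- `∑ t ^ 2 = 10 * ‖x‖ ^ 2` and `∑ t ^ 4 = 18 * ‖x‖ ^ 4`, so that `∑ t ^ 2 * (5 - t ^ 2) = -12`.
  have hsum := add_nonneg (add_nonneg (add_nonneg (add_nonneg q1 q2) (add_nonneg q3 q4))
    (add_nonneg (add_nonneg q5 q6) (add_nonneg q7 q8))) (add_nonneg q9 q10)
  simp only [inner_eq, Matrix.cons_val_zero, Matrix.cons_val_one, Matrix.cons_val] at hsum
  have : (-12 : ℝ) ≥ 0 := by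
    refine hsum.trans_eq ?_
    linear_combination (10 * (x 0 ^ 2 + x 1 ^ 2 + x 2 ^ 2)) * hs
      - 2 * (x 0 ^ 4 + x 1 ^ 4 + x 2 ^ 4) * h4
      - 12 * (k * g + 1) * (x 0 ^ 2 * x 1 ^ 2 + x 1 ^ 2 * x 2 ^ 2 + x 2 ^ 2 * x 0 ^ 2) * hkg
      + (50 - 18 * (x 0 ^ 2 + x 1 ^ 2 + x 2 ^ 2) - 18 * 3) * hxx
  norm_num at this

/-- A system of three-fold axes that is not a single line consists, up to a linear isometry, of
the vertices of a cube or of those of a dodecahedron. -/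
theorem IsAxisSystem.exists_image_eq {P : Set E3} (hP : IsAxisSystem P)
    (h : ∃ x ∈ P, ∃ y ∈ P, y ≠ x ∧ y ≠ -x) :
    ∃ φ : E3 ≃ₗᵢ[ℝ] E3, φ '' P = cubeVertices ∨ φ '' P = dodecahedronVertices := by
  obtain ⟨p, hp, q, hq, hC, hmax⟩ := hP.exists_closest h
  have hpp := hP.inner_self p hp
  have hqq := hP.inner_self q hq
  have hp0 : p ≠ 0 := by rintro rfl; simp at hpp
  have hmax' : ∀ φ : E3 ≃ₗᵢ[ℝ] E3, ∀ x ∈ φ '' P, ∀ y ∈ φ '' P, y ≠ x → y ≠ -x →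
      (inner ℝ x y : ℝ) ≤ inner ℝ p q := by
    rintro φ _ ⟨x, hx, rfl⟩ _ ⟨y, hy, rfl⟩ h1 h2
    rw [LinearIsometryEquiv.inner_map_map]
    exact hmax x hx y hy (fun h => h1 (by rw [h])) (fun h => h2 (by rw [h, map_neg]))
  rcases hC with hC | hC
  · obtain ⟨φ, h1, h2⟩ := exists_isometry_of_pair (p' := !₂[1, 1, 1]) (q' := !₂[1, 1, -1])
      (by rw [hpp, inner_eq]; simp; norm_num) (by rw [hqq, inner_eq]; simp; norm_num)
      (by rw [hC, inner_eq]; simp) hp0 (by rw [hC, hpp, hqq]; norm_num)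
    exact ⟨φ, Or.inl ((hP.map φ).eq_cubeVertices (h1 ▸ mem_image_of_mem φ hp)
      (h2 ▸ mem_image_of_mem φ hq) (hC ▸ hmax' φ))⟩
  · have h5 : √5 ^ 2 = (5 : ℝ) := Real.sq_sqrt (by norm_num)
    obtain ⟨φ, h1, h2⟩ := exists_isometry_of_pair (p' := !₂[1, 1, 1])
      (q' := !₂[0, goldenRatio⁻¹, goldenRatio])
      (by rw [hpp, inner_eq]; simp; norm_num)
      (by
        rw [hqq, inner_eq, goldenRatio_inv_eq]; simp
        linear_combination -2 * goldenRatio_sq)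
      (by rw [hC, inner_eq, goldenRatio_inv_eq]; simp [goldenRatio]; ring) hp0
      (by rw [hC, hpp, hqq, h5]; norm_num)
    exact ⟨φ, Or.inr ((hP.map φ).eq_dodecahedronVertices (h1 ▸ mem_image_of_mem φ hp)
      (h2 ▸ mem_image_of_mem φ hq) (hC ▸ hmax' φ))⟩

/-! ### Finite groups of linear isometries -/

theorem cross_comm_neg (x y : E3) : cross x y = -cross y x := by
  apply ext_coord <;> simp <;> ring

theorem rod_neg_axis (r : E3) (k σ : ℝ) (x : E3) : rod (-r) k σ x = rod r k (-σ) x := by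
  apply ext_coord <;> simp [rod_apply] <;> ring

theorem trot_trot_neg {v : E3} (hv : (inner ℝ v v : ℝ) = 3) (y : E3) :
    trot 1 v (trot (-1) v y) = y := by
  rw [inner_eq] at hv
  apply ext_coord <;> simp only [trot_apply, cross_zero, cross_one, cross_two]
  · linear_combination (4⁻¹ * (v 0 * y 0 + v 1 * y 1 + v 2 * y 2) * v 0 + 4⁻¹ * y 0) * hv
  · linear_combination (4⁻¹ * (v 0 * y 0 + v 1 * y 1 + v 2 * y 2) * v 1 + 4⁻¹ * y 1) * hv
  · linear_combination (4⁻¹ * (v 0 * y 0 + v 1 * y 1 + v 2 * y 2) * v 2 + 4⁻¹ * y 2) * hv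

theorem eq_of_trot_eq {v w : E3} (h : ∀ y, trot 1 v y = trot 1 w y) : v = w := by
  have h0 := h !₂[1, 0, 0]
  have h1 := h !₂[0, 1, 0]
  have h2 := h !₂[0, 0, 1]
  have a1 := congrArg (fun x : E3 => x 1) h0
  have a2 := congrArg (fun x : E3 => x 2) h0
  have b0 := congrArg (fun x : E3 => x 0) h1
  have b2 := congrArg (fun x : E3 => x 2) h1
  have c0 := congrArg (fun x : E3 => x 0) h2
  have c1 := congrArg (fun x : E3 => x 1) h2
  simp [trot_apply] at a1 a2 b0 b2 c0 c1
  apply ext_coord <;> linarith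

/-- A vector orthogonal to two non-parallel vectors and to their cross product vanishes. -/
theorem eq_zero_of_orthogonal {w p q : E3} (hpq : cross p q ≠ 0) (h1 : (inner ℝ w p : ℝ) = 0)
    (h2 : (inner ℝ w q : ℝ) = 0) (h3 : (inner ℝ w (cross p q) : ℝ) = 0) : w = 0 := by
  have h4 : cross w (cross p q) = 0 := by rw [cross_cross, h1, h2]; simp
  have h5 := inner_cross_cross w (cross p q) w (cross p q)
  rw [h4, h3, inner_zero_left] at h5
  have h6 : (inner ℝ (cross p q) (cross p q) : ℝ) ≠ 0 := (real_inner_self_pos.2 hpq).ne'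
  have h7 : (inner ℝ w w : ℝ) = 0 := by
    rcases mul_eq_zero.1 (show (inner ℝ w w * inner ℝ (cross p q) (cross p q) : ℝ) = 0 by linarith)
      with h | h
    · exact h
    · exact absurd h h6
  exact inner_self_eq_zero.1 h7

theorem eq_or_eq_neg_of_inner_sq {p q : E3} (hp : (inner ℝ p p : ℝ) = 1)
    (hq : (inner ℝ q q : ℝ) = 1) (h : (inner ℝ p q : ℝ) ^ 2 = 1) : q = p ∨ q = -p := by
  have hqp : (inner ℝ q p : ℝ) = inner ℝ p q := real_inner_comm _ _
  rw [sq] at h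
  rcases mul_self_eq_one_iff.1 h with h1 | h1
  · left
    rw [← sub_eq_zero, ← inner_self_eq_zero (𝕜 := ℝ), inner_sub_left, inner_sub_right,
      inner_sub_right, hqp, hp, hq, h1]
    norm_num
  · right
    rw [eq_neg_iff_add_eq_zero, ← inner_self_eq_zero (𝕜 := ℝ), inner_add_left, inner_add_right,
      inner_add_right, hqp, hp, hq, h1]
    norm_num

variable {G : Subgroup (E3 ≃ₗᵢ[ℝ] E3)}

/-- The axes, of squared length `3`, of the rotations by `120°` in a group of linear isometries. -/
def axes (G : Subgroup (E3 ≃ₗᵢ[ℝ] E3)) : Set E3 :=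
  {v | (inner ℝ v v : ℝ) = 3 ∧ ∃ g ∈ G, ∀ y, g y = trot 1 v y}

theorem neg_mem_axes {v : E3} (hv : v ∈ axes G) : -v ∈ axes G := by
  obtain ⟨hvv, g, hg, h⟩ := hv
  refine ⟨by rw [inner_neg_neg, hvv], g⁻¹, G.inv_mem hg, fun y => ?_⟩
  rw [trot_neg_axis]
  apply g.injective
  rw [h (trot (-1) v y), trot_trot_neg hvv]
  exact g.apply_symm_apply y

theorem map_mem_axes {v : E3} (hv : v ∈ axes G) {h : E3 ≃ₗᵢ[ℝ] E3} (hh : h ∈ G) :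
    h v ∈ axes G := by
  obtain ⟨hvv, g, hg, hgv⟩ := hv
  obtain ⟨ε, h1, hε⟩ := exists_map_cross h
  have hn : (inner ℝ (h v) (h v) : ℝ) = 3 := by rw [LinearIsometryEquiv.inner_map_map, hvv]
  have key : ∀ y, (h * g * h⁻¹) y = trot ε (h v) y := fun y => by
    have : (h * g * h⁻¹) y = h (g (h.symm y)) := rfl
    rw [this, hgv, map_trot h hε h1, h.apply_symm_apply, mul_one]
  have hm : h * g * h⁻¹ ∈ G := G.mul_mem (G.mul_mem hh hg) (G.inv_mem hh)
  rcases h1 with rfl | rfl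
  · exact ⟨hn, _, hm, key⟩
  · rw [← neg_neg (h v)]
    refine neg_mem_axes ⟨by rw [inner_neg_neg, hn], _, hm, fun y => ?_⟩
    rw [key, trot_neg_axis]

theorem isAxisSystem_axes (hG : (G : Set (E3 ≃ₗᵢ[ℝ] E3)).Finite) : IsAxisSystem (axes G) where
  finite := by
    have : axes G ⊆ ⋃ g ∈ (G : Set (E3 ≃ₗᵢ[ℝ] E3)), {v | ∀ y, g y = trot 1 v y} := by
      rintro v ⟨-, g, hg, h⟩
      exact mem_biUnion hg h
    refine (hG.biUnion fun g _ => Set.Subsingleton.finite ?_).subset this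
    intro v hv w hw
    exact eq_of_trot_eq fun y => (hv y).symm.trans (hw y)
  inner_self := fun _ hx => hx.1
  neg_mem := fun _ => neg_mem_axes
  trot_mem := by
    rintro x ⟨-, g, hg, h⟩ y hy
    rw [← h]
    exact map_mem_axes hy hg

/-- The group `G` contains a rotation with axis `r` and cosine `k` of the angle. -/
def HasRot (G : Subgroup (E3 ≃ₗᵢ[ℝ] E3)) (r : E3) (k : ℝ) : Prop :=
  (inner ℝ r r : ℝ) = 1 ∧ ∃ g ∈ G, ∃ σ, k ^ 2 + σ ^ 2 = 1 ∧ ∀ x, g x = rod r k σ x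

/-- The sine of the angle may be chosen with either sign, since `G` contains the inverse rotation.
-/
theorem HasRot.exists_of_sin {r : E3} {k σ : ℝ} (h : HasRot G r k) (hσ : k ^ 2 + σ ^ 2 = 1) :
    ∃ g ∈ G, ∀ x, g x = rod r k σ x := by
  obtain ⟨hr, g, hg, τ, hτ, h⟩ := h
  have : (σ - τ) * (σ + τ) = 0 := by linarith
  rcases mul_eq_zero.1 this with h1 | h1
  · obtain rfl : σ = τ := by linarith
    exact ⟨g, hg, h⟩
  · obtain rfl : τ = -σ := by linarith
    refine ⟨g⁻¹, G.inv_mem hg, fun x => g.injective ?_⟩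
    rw [h (rod r k σ x), rod_rod hr, show k * k - -σ * σ = 1 by linarith,
      show k * σ + -σ * k = 0 by ring, rod_one_zero]
    exact g.apply_symm_apply x

theorem HasRot.map {r : E3} {k : ℝ} (h : HasRot G r k) {f : E3 ≃ₗᵢ[ℝ] E3} (hf : f ∈ G) :
    HasRot G (f r) k := by
  obtain ⟨hr, g, hg, τ, hτ, h⟩ := h
  obtain ⟨ε, h1, hε⟩ := exists_map_cross f
  refine ⟨by rw [LinearIsometryEquiv.inner_map_map, hr], f * g * f⁻¹,
    G.mul_mem (G.mul_mem hf hg) (G.inv_mem hf), ε * τ, ?_, fun y => ?_⟩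
  · rcases h1 with rfl | rfl <;> linarith
  · have : (f * g * f⁻¹) y = f (g (f.symm y)) := rfl
    rw [this, h, map_rod f hε h1, f.apply_symm_apply]

theorem HasRot.neg {r : E3} {k : ℝ} (h : HasRot G r k) : HasRot G (-r) k := by
  obtain ⟨hr, g, hg, τ, hτ, h⟩ := h
  exact ⟨by rw [inner_neg_neg, hr], g, hg, -τ, by linarith, fun x => by
    rw [rod_neg_axis, neg_neg, h]⟩

theorem HasRot.double {r : E3} {k : ℝ} (h : HasRot G r k) : HasRot G r (2 * k ^ 2 - 1) := by
  obtain ⟨hr, g, hg, τ, hτ, h⟩ := h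
  refine ⟨hr, g * g, G.mul_mem hg hg, 2 * k * τ, ?_, fun x => ?_⟩
  · linear_combination 4 * k ^ 2 * hτ
  · have : (g * g) x = g (g x) := rfl
    rw [this, h, h, rod_rod hr]
    congr 1
    · linarith
    · ring

theorem HasRot.triple {r : E3} {k : ℝ} (h : HasRot G r k) : HasRot G r (4 * k ^ 3 - 3 * k) := by
  obtain ⟨hr, g, hg, τ, hτ, h⟩ := h
  refine ⟨hr, g * (g * g), G.mul_mem hg (G.mul_mem hg hg), (4 * k ^ 2 - 1) * τ, ?_, fun x => ?_⟩
  · linear_combination (4 * k ^ 2 - 1) ^ 2 * hτ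
  · have : (g * (g * g)) x = g (g (g x)) := rfl
    rw [this, h, h, h, rod_rod hr, rod_rod hr]
    congr 1
    · linear_combination -3 * k * hτ
    · linear_combination -τ * hτ

theorem HasRot.mem_axes {r : E3} (h : HasRot G r (-1 / 2)) : √3 • r ∈ axes G := by
  have h3 : √3 ^ 2 = (3 : ℝ) := Real.sq_sqrt (by norm_num)
  obtain ⟨g, hg, hgx⟩ := h.exists_of_sin (σ := √3 / 2) (by rw [div_pow √3, h3]; norm_num)
  refine ⟨by rw [inner_smul_left, inner_smul_right, h.1]; simp, g, hg, fun y => ?_⟩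
  rw [hgx, rod, trot, inner_smul_left, cross_smul_left, smul_smul, RCLike.conj_to_real]
  simp only [smul_add, smul_smul]
  rw [show (2⁻¹ * (√3 * inner ℝ r y * √3) : ℝ) = (1 - -1 / 2) * inner ℝ r y by
    linear_combination (inner ℝ r y / 2) * h3]
  module

/-- A linear isometry of order three in the group is a rotation about a vector of `axes G`. -/
theorem exists_mem_axes_of_cube {g : E3 ≃ₗᵢ[ℝ] E3} (hg : g ∈ G) (h3 : ∀ x, g (g (g x)) = x)
    {y : E3} (hy : g y ≠ y) : (axes G).Nonempty := by
  obtain ⟨ε, h1, hε⟩ := exists_map_cross g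
  -- The determinant of `g` is one, since that of its cube is.
  have hε1 : ε = 1 := by
    have := hε (g (g !₂[1, 0, 0])) (g (g !₂[0, 1, 0]))
    rw [h3, h3, hε, hε, map_smul, map_smul, map_smul, h3] at this
    have h2 := congrArg (fun v : E3 => v 2) this
    simp at h2
    rcases h1 with h | h
    · exact h
    · rw [h] at h2; norm_num at h2
  obtain ⟨r, k, σ, hr, hkσ, hrod⟩ := exists_eq_rod g (by simpa [hε1] using hε)
  obtain ⟨u, hu, huu⟩ := exists_unit_orthogonal r
  have h4 := h3 u
  rw [hrod, hrod, hrod, rod_rod hr, rod_rod hr] at h4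
  have h5 := congrArg (fun v : E3 => (inner ℝ u v : ℝ)) h4
  simp only [rod, inner_add_right, inner_smul_right, inner_cross_self_right, huu, hu] at h5
  -- This is `cos 3θ = 1`.
  have h6 : (k - 1) * (2 * k + 1) ^ 2 = 0 := by linear_combination h5 + 3 * k * hkσ
  rcases mul_eq_zero.1 h6 with h | h
  · exfalso
    have hk : k = 1 := by linarith
    have hs : σ = 0 := by
      rw [hk] at hkσ
      exact pow_eq_zero_iff two_ne_zero |>.1 (by linarith)
    apply hy
    rw [hrod, hk, hs, rod_one_zero]
  · have hk : k = -1 / 2 := by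
      have := pow_eq_zero_iff two_ne_zero |>.1 h
      linarith
    exact ⟨_, HasRot.mem_axes ⟨hr, g, hg, σ, hk ▸ hkσ, hk ▸ hrod⟩⟩

/-- If a rotation by an angle of cosine `k ∈ [0, 1)` maps `v` to `±v`, then `v` is on its axis. -/
theorem inner_sq_of_rod_eq {r v : E3} {k σ N : ℝ} (hv : (inner ℝ v v : ℝ) = N) (hN : 0 < N)
    (hk0 : 0 ≤ k) (hk1 : k < 1) (h : rod r k σ v = v ∨ rod r k σ v = -v) :
    (inner ℝ r v : ℝ) ^ 2 = N := by
  have h1 : (inner ℝ v (rod r k σ v) : ℝ) = k * N + (1 - k) * inner ℝ r v ^ 2 := by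
    simp only [rod, inner_add_right, inner_smul_right, inner_cross_self_right, hv,
      real_inner_comm r v]
    ring
  rcases h with h | h
  · rw [h, hv] at h1
    have : (1 - k) * (inner ℝ r v ^ 2 - N) = 0 := by linarith
    rcases mul_eq_zero.1 this with h | h <;> linarith
  · rw [h, inner_neg_right, hv] at h1
    exfalso
    have := mul_nonneg hk0 hN.le
    have := mul_nonneg (sub_nonneg.2 hk1.le) (sq_nonneg (inner ℝ r v : ℝ))
    linarith

theorem eq_smul_of_inner_sq {r v : E3} (hr : (inner ℝ r r : ℝ) = 1)
    (h : (inner ℝ r v : ℝ) ^ 2 = inner ℝ v v) : v = (inner ℝ r v : ℝ) • r := by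
  rw [← sub_eq_zero, ← inner_self_eq_zero (𝕜 := ℝ)]
  simp only [inner_sub_left, inner_sub_right, inner_smul_left, inner_smul_right, hr,
    real_inner_comm r v, RCLike.conj_to_real, ← h]
  ring

/-- Rotations by an acute or right angle about non-parallel axes of one orbit generate rotations
of order three: the rotations about a closest pair `p`, `q` of such axes must map `q` and `p`, in
opposite directions, to the same point. -/
theorem exists_axes_of_acute (hG : (G : Set (E3 ≃ₗᵢ[ℝ] E3)).Finite) {r : E3} {k : ℝ}
    (hr : HasRot G r k) (hk0 : 0 ≤ k) (hk1 : k < 1) {f : E3 ≃ₗᵢ[ℝ] E3} (hf : f ∈ G)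
    (hfr : f r ≠ r) (hfr' : f r ≠ -r) : ∃ x ∈ axes G, ∃ y ∈ axes G, y ≠ x ∧ y ≠ -x := by
  -- The orbit of the axis, closed under negation.
  let X : Set E3 := {x | ∃ h ∈ G, x = h r ∨ x = -h r}
  have hX : X.Finite := by
    refine ((hG.image fun h => h r).union (hG.image fun h => -h r)).subset ?_
    rintro x ⟨h, hh, rfl | rfl⟩
    · exact Or.inl ⟨h, hh, rfl⟩
    · exact Or.inr ⟨h, hh, rfl⟩
  have hXrot : ∀ x ∈ X, HasRot G x k := by
    rintro x ⟨h, hh, rfl | rfl⟩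
    · exact hr.map hh
    · exact (hr.map hh).neg
  have hXneg : ∀ x ∈ X, -x ∈ X := by
    rintro x ⟨h, hh, rfl | rfl⟩
    · exact ⟨h, hh, Or.inr rfl⟩
    · exact ⟨h, hh, Or.inl (neg_neg _)⟩
  have hXmap : ∀ g ∈ G, ∀ x ∈ X, g x ∈ X := by
    rintro g hg x ⟨h, hh, rfl | rfl⟩
    · exact ⟨g * h, G.mul_mem hg hh, Or.inl rfl⟩
    · exact ⟨g * h, G.mul_mem hg hh, Or.inr (map_neg g (h r))⟩
  let A : Set (E3 × E3) := {z | z.1 ∈ X ∧ z.2 ∈ X ∧ z.2 ≠ z.1 ∧ z.2 ≠ -z.1}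
  have hA : A.Finite := (hX.prod hX).subset fun z hz => ⟨hz.1, hz.2.1⟩
  have hne : A.Nonempty :=
    ⟨(r, f r), ⟨1, G.one_mem, Or.inl rfl⟩, ⟨f, hf, Or.inl rfl⟩, hfr, hfr'⟩
  obtain ⟨⟨p, q⟩, ⟨hp, hq, hqp, hqp'⟩, hmax⟩ :=
    exists_max_image A (fun z => (inner ℝ z.1 z.2 : ℝ)) hA hne
  simp only at hp hq hqp hqp' hmax
  have hmax' : ∀ x ∈ X, ∀ y ∈ X, y ≠ x → y ≠ -x → (inner ℝ x y : ℝ) ≤ inner ℝ p q :=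
    fun x hx y hy h1 h2 => hmax (x, y) ⟨hx, hy, h1, h2⟩
  set c : ℝ := inner ℝ p q with hc
  have hpp := (hXrot p hp).1
  have hqq := (hXrot q hq).1
  have hqpc : (inner ℝ q p : ℝ) = c := by rw [real_inner_comm]
  have hc2 : c ^ 2 ≠ 1 := fun h => by
    rcases eq_or_eq_neg_of_inner_sq hpp hqq h with h | h
    · exact hqp h
    · exact hqp' h
  have hc1 : c < 1 := by
    have : c ≤ 1 := by
      have := real_inner_mul_inner_self_le p q
      rw [hpp, hqq, ← hc] at this
      nlinarith
    exact lt_of_le_of_ne this fun h => hc2 (by rw [h]; norm_num)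
  have hc0 : 0 ≤ c := by
    have := hmax' p hp (-q) (hXneg q hq) (fun h => hqp' (by rw [← h, neg_neg]))
      (fun h => hqp (neg_injective h))
    rw [inner_neg_right] at this
    linarith
  set σ := √(1 - k ^ 2) with hσ
  have hσ2 : σ ^ 2 = 1 - k ^ 2 := Real.sq_sqrt (by nlinarith)
  have hσ0 : σ ≠ 0 := fun h => by rw [h] at hσ2; nlinarith
  obtain ⟨gp, hgp, hgpx⟩ := (hXrot p hp).exists_of_sin (σ := σ) (by rw [hσ2]; ring)
  obtain ⟨gq, hgq, hgqx⟩ := (hXrot q hq).exists_of_sin (σ := σ) (by rw [hσ2]; ring)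
  have hgq' : ∀ x, gq (rod q k (-σ) x) = x := fun x => by
    rw [hgqx, rod_rod hqq, show k * k - σ * -σ = 1 by nlinarith,
      show k * -σ + σ * k = 0 by ring, rod_one_zero]
  have hgp' : ∀ x, gp (rod p k (-σ) x) = x := fun x => by
    rw [hgpx, rod_rod hpp, show k * k - σ * -σ = 1 by nlinarith,
      show k * -σ + σ * k = 0 by ring, rod_one_zero]
  have hcross : cross q p = -cross p q := cross_comm_neg q p
  -- Both `a` and `b` are again in `X`; they are mirror images of each other in the plane that
  -- bisects `p` and `q`.
  set a := gp q with ha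
  set b := rod q k (-σ) p with hb
  have hbX : b ∈ X := by
    have : b = gq⁻¹ p := gq.injective (by rw [hgq']; exact (gq.apply_symm_apply p).symm)
    rw [this]
    exact hXmap _ (G.inv_mem hgq) p hp
  have haX : a ∈ X := hXmap _ hgp q hq
  have ea : a = k • q + ((1 - k) * c) • p + σ • cross p q := by rw [ha, hgpx, rod, ← hc]
  have eb : b = k • p + ((1 - k) * c) • q + σ • cross p q := by
    rw [hb, rod, hqpc, hcross]; module
  have hab : (inner ℝ a b : ℝ) =
      k ^ 2 * c + 2 * k * (1 - k) * c + (1 - k) ^ 2 * c ^ 3 + (1 - k ^ 2) * (1 - c ^ 2) := by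
    rw [ea, eb, ← hσ2]
    simp only [inner_add_left, inner_add_right, inner_smul_left, inner_smul_right,
      inner_cross_self_left, inner_cross_self_right, inner_cross_cross, hpp, hqq, hqpc, ← hc,
      real_inner_comm p (cross p q), real_inner_comm q (cross p q), RCLike.conj_to_real]
    ring
  -- If `a` and `b` were different, they would be closer to each other than `p` and `q`.
  have hba : b = a := by
    by_contra h1
    have h2 : (inner ℝ a b : ℝ) ≤ c := by
      by_cases h2 : b = -a
      · rw [h2, inner_neg_right, ha, LinearIsometryEquiv.inner_map_map, hqq]; linarith
      · exact hmax' a haX b hbX h1 h2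
    rw [hab] at h2
    have h3 : (1 - c ^ 2) * ((1 - k) * ((1 + k) - c * (1 - k))) ≤ 0 := by linarith
    have h4 : 0 < 1 - c ^ 2 := by nlinarith
    have h5 : 0 < (1 + k) - c * (1 - k) := by nlinarith
    have := mul_pos h4 (mul_pos (sub_pos.2 hk1) h5)
    linarith
  have hk : (1 - k) * c = k := by
    have h1 : (k - (1 - k) * c) • (p - q) = 0 := by
      rw [eb, ea] at hba
      have := sub_eq_zero.2 hba
      rw [← this]; module
    rcases smul_eq_zero.1 h1 with h | h
    · linarith
    · exact absurd (sub_eq_zero.1 h).symm hqp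
  -- The product of the two rotations permutes the points `p`, `q`, `a` cyclically, so that its cube
  -- is the identity.
  have s1 : gp (gq p) = q := by
    have : gq p = rod p k (-σ) q := by
      rw [hgqx, rod, rod, hqpc, ← hc, hcross, hk]; module
    rw [this, hgp']
  have s2 : gp (gq q) = a := by
    have : gq q = q := by
      rw [hgqx, rod, hqq, cross_self]; module
    rw [this]
  have s3 : gp (gq a) = p := by
    rw [← hba, hgq', hgpx, rod, hpp, cross_self]; module
  have hpq : cross p q ≠ 0 := fun h => by
    have := inner_cross_cross p q p q
    rw [h, inner_zero_left, hpp, hqq, hqpc, ← hc] at this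
    apply hc2; linarith
  have cube : ∀ x, (gp * gq) ((gp * gq) ((gp * gq) x)) = x := by
    intro x
    set T := gp * gq with hT
    have t1 : T p = q := s1
    have t2 : T q = a := s2
    have t3 : T a = p := s3
    have ort : ∀ z, T (T (T z)) = z → (inner ℝ (T (T (T x)) - x) z : ℝ) = 0 := fun z hz => by
      rw [inner_sub_left]
      nth_rewrite 1 [← hz]
      simp only [LinearIsometryEquiv.inner_map_map, sub_self]
    have o1 := ort p (by rw [t1, t2, t3])
    have o2 := ort q (by rw [t2, t3, t1])
    have o3 := ort a (by rw [t3, t1, t2])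
    rw [ea, inner_add_right, inner_add_right, inner_smul_right, inner_smul_right,
      inner_smul_right, o1, o2] at o3
    have o4 : (inner ℝ (T (T (T x)) - x) (cross p q) : ℝ) = 0 := by
      simpa [hσ0] using o3
    exact sub_eq_zero.1 (eq_zero_of_orthogonal hpq o1 o2 o4)
  obtain ⟨v, hv⟩ := exists_mem_axes_of_cube (G.mul_mem hgp hgq) cube (y := p)
    (fun h => hqp (by rw [← s1]; exact h))
  by_contra hcon
  push Not at hcon
  -- If there were only one axis `v` of order three, then `gp` and `gq` would map its line onto
  -- itself, and `p` and `q` would both be on this line.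
  have stay : ∀ g ∈ G, g v = v ∨ g v = -v := fun g hg => by
    by_contra h
    push Not at h
    exact h.2 (hcon v hv (g v) (map_mem_axes hv hg) h.1)
  have i1 := inner_sq_of_rod_eq hv.1 (by norm_num) hk0 hk1 (hgpx v ▸ stay gp hgp)
  have i2 := inner_sq_of_rod_eq hv.1 (by norm_num) hk0 hk1 (hgqx v ▸ stay gq hgq)
  have e1 := eq_smul_of_inner_sq hpp (i1.trans hv.1.symm)
  have e2 : (inner ℝ q v : ℝ) = inner ℝ p v * c := by
    conv_lhs => rw [e1]
    rw [inner_smul_right, hqpc]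
  rw [e2, mul_pow, i1] at i2
  exact hc2 (by linarith)

theorem rod_half_turn (r x : E3) : rod r (-1) 0 x = (2 * inner ℝ r x : ℝ) • r - x := by
  rw [rod]; module

theorem HasRot.exists_half_turn {r : E3} (h : HasRot G r (-1)) :
    ∃ g ∈ G, ∀ x, g x = (2 * inner ℝ r x : ℝ) • r - x := by
  obtain ⟨g, hg, h⟩ := h.exists_of_sin (σ := 0) (by norm_num)
  exact ⟨g, hg, fun x => by rw [h, rod_half_turn]⟩

/-- Suppose that every element of determinant one in `G` is the identity or a half-turn. Then `G`
maps some line onto itself: the axes of the half-turns are at most three mutually orthogonal lines,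
and no element of `G` permutes three of them cyclically. -/
theorem exists_axis_of_half_turns
    (hG : ∀ g ∈ G, (∀ a b, cross (g a) (g b) = g (cross a b)) →
      (∀ x, g x = x) ∨ ∃ r, HasRot G r (-1) ∧ ∀ x, g x = (2 * inner ℝ r x : ℝ) • r - x) :
    ∃ e : E3, e ≠ 0 ∧ ∀ g ∈ G, g e = e ∨ g e = -e := by
  have sq1 : ∀ g ∈ G, ∀ f ∈ G, ∀ ε : ℝ, (ε = 1 ∨ ε = -1) →
      (∀ a b, cross (g a) (g b) = ε • g (cross a b)) →
      (∀ a b, cross (f a) (f b) = ε • f (cross a b)) →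
      ∀ a b, cross ((g * f) a) ((g * f) b) = (g * f) (cross a b) := by
    intro g _ f _ ε h1 hg hf a b
    change cross (g (f a)) (g (f b)) = g (f (cross a b))
    rw [hg, hf, map_smul, smul_smul]
    rcases h1 with rfl | rfl <;> simp
  -- All elements of determinant one are involutions; so the square of every element has order at
  -- most two, and the fourth power is the identity.
  have invol : ∀ g ∈ G, (∀ a b, cross (g a) (g b) = g (cross a b)) → ∀ x, g (g x) = x := by
    intro g hg hd x
    rcases hG g hg hd with h | ⟨r, hr, h⟩
    · rw [h, h]
    · rw [h, h, inner_sub_right, inner_smul_right, hr.1]; module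
  by_cases hex : ∃ a, HasRot G a (-1)
  · obtain ⟨a, ha⟩ := hex
    by_contra hcon
    push Not at hcon
    have hne : ∀ r : E3, (inner ℝ r r : ℝ) = 1 → r ≠ 0 := by rintro r h rfl; simp at h
    -- Distinct axes of half-turns are orthogonal, because the half-turns commute.
    have orth : ∀ a b, HasRot G a (-1) → HasRot G b (-1) → b ≠ a → b ≠ -a →
        (inner ℝ a b : ℝ) = 0 := by
      intro a b ha hb h1 h2
      obtain ⟨f, hf, hfx⟩ := ha.exists_half_turn
      obtain ⟨g, hg, hgx⟩ := hb.exists_half_turn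
      have hba : (inner ℝ b a : ℝ) = inner ℝ a b := real_inner_comm _ _
      have gb : g b = b := by rw [hgx, hb.1]; module
      have det : ∀ h : E3 ≃ₗᵢ[ℝ] E3, ∀ r : E3, (inner ℝ r r : ℝ) = 1 →
          (∀ x, h x = (2 * inner ℝ r x : ℝ) • r - x) →
          ∀ a b, cross (h a) (h b) = (1 : ℝ) • h (cross a b) := by
        intro h r hr hh
        obtain ⟨ε, h1, hε⟩ := exists_map_cross h
        rcases h1 with rfl | rfl
        · exact hε
        · exfalso
          obtain ⟨u, hru, huu⟩ := exists_unit_orthogonal r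
          have hr' : h r = r := by rw [hh, hr]; module
          have hu' : h u = -u := by rw [hh, hru]; module
          have hc : h (cross r u) = -cross r u := by
            rw [hh, inner_cross_self_left]; module
          have := hε r u
          rw [hr', hu', hc, cross_comm_neg, cross_neg_left, ← cross_comm_neg] at this
          simp only [neg_smul, one_smul, neg_neg] at this
          have h0 : cross r u = 0 := by
            have h3 : (2 : ℝ) • cross r u = 0 := by
              rw [two_smul]
              nth_rewrite 1 [← this]
              exact neg_add_cancel _
            simpa using h3
          have h4 := inner_cross_cross r u r u
          rw [h0, hr, huu, hru] at h4
          simp at h4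
      have comm := invol _ (G.mul_mem hf hg) (sq1 f hf g hg 1 (Or.inl rfl) (det f a ha.1 hfx)
        (det g b hb.1 hgx)) b
      change f (g (f (g b))) = b at comm
      rw [gb] at comm
      have comm2 : g (f b) = f b := by
        have hff : ∀ x, f (f x) = x := fun x => by
          rw [hfx (f x), hfx x, inner_sub_right, inner_smul_right, ha.1]; module
        rw [← hff (g (f b)), comm]
      rw [hgx, hfx] at comm2
      have i1 := congrArg (fun v : E3 => (inner ℝ a v : ℝ)) comm2
      simp only [inner_sub_right, inner_smul_right, ha.1, hb.1, hba] at i1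
      have i2 : (inner ℝ a b : ℝ) * (inner ℝ a b ^ 2 - 1) = 0 := by linarith
      rcases mul_eq_zero.1 i2 with h | h
      · exact h
      · rcases eq_or_eq_neg_of_inner_sq ha.1 hb.1 (by linarith) with h | h
        · exact absurd h h1
        · exact absurd h h2
    -- The line of `a` is not preserved by some `f`, so that `b = f a` is a second axis of a
    -- half-turn; the only possible third one is orthogonal to both.
    obtain ⟨f, hf, hfa, hfa'⟩ := hcon a (hne a ha.1)
    set b := f a with hb
    have hbr : HasRot G b (-1) := ha.map hf
    have hab : (inner ℝ a b : ℝ) = 0 := orth a b ha hbr hfa hfa'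
    have hba : (inner ℝ b a : ℝ) = 0 := by rw [real_inner_comm]; exact hab
    set d := cross a b with hd
    have hdd : (inner ℝ d d : ℝ) = 1 := by rw [hd, inner_cross_cross, ha.1, hbr.1, hab]; ring
    have hd0 : cross a b ≠ 0 := hne d hdd
    have lines : ∀ r, HasRot G r (-1) → (r = a ∨ r = -a) ∨ (r = b ∨ r = -b) ∨ (r = d ∨ r = -d) := by
      intro r hr
      by_contra h
      push Not at h
      obtain ⟨⟨h1, h2⟩, ⟨h3, h4⟩, h5, h6⟩ := h
      have o1 := orth a r ha hr h1 h2
      have o2 := orth b r hbr hr h3 h4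
      rw [real_inner_comm] at o1 o2
      have hcc : cross r (cross a b) = 0 := by rw [cross_cross, o1, o2]; simp
      have h7 := inner_cross_cross r d r d
      rw [hcc, inner_zero_left, hr.1, hdd, real_inner_comm r d] at h7
      rcases eq_or_eq_neg_of_inner_sq hdd hr.1 (by rw [real_inner_comm]; linarith) with h | h
      · exact h5 h
      · exact h6 h
    have hda : (inner ℝ d a : ℝ) = 0 := by rw [real_inner_comm]; exact inner_cross_self_left a b
    have hdb : (inner ℝ d b : ℝ) = 0 := by rw [real_inner_comm]; exact inner_cross_self_right a b
    have had : (inner ℝ a d : ℝ) = 0 := inner_cross_self_left a b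
    have hbd : (inner ℝ b d : ℝ) = 0 := inner_cross_self_right a b
    have comp : ∀ w : E3, (inner ℝ w a : ℝ) = 0 → (inner ℝ w b : ℝ) = 0 →
        (inner ℝ w d : ℝ) = 0 → w = 0 := fun w => eq_zero_of_orthogonal hd0
    have invol4 : ∀ g ∈ G, ∀ x, g (g (g (g x))) = x := by
      intro g hg x
      obtain ⟨ε, h1, hε⟩ := exists_map_cross g
      exact invol _ (G.mul_mem hg hg) (sq1 g hg g hg ε h1 hε hε) x
    -- Different lines have different images.
    have par : ∀ g ∈ G, ∀ y, (g a = y ∨ g a = -y) → ¬ (g b = y ∨ g b = -y) := by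
      intro g hg y h1 h2
      have h3 : (inner ℝ (g a) (g b) : ℝ) = 0 := by rw [LinearIsometryEquiv.inner_map_map, hab]
      have h4 : (inner ℝ (g a) (g a) : ℝ) = 1 := by rw [LinearIsometryEquiv.inner_map_map, ha.1]
      rcases h1 with h1 | h1 <;> rcases h2 with h2 | h2 <;> rw [h1] at h3 h4 <;> rw [h2] at h3 <;>
        (try simp only [inner_neg_left, inner_neg_right, neg_neg] at h3 h4) <;> linarith
    have pm : ∀ g : E3 ≃ₗᵢ[ℝ] E3, ∀ {x y z : E3}, (x = y ∨ x = -y) → (g y = z ∨ g y = -z) →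
        (g x = z ∨ g x = -z) := by
      rintro g x y z (rfl | rfl) (h | h)
      · exact Or.inl h
      · exact Or.inr h
      · right; rw [map_neg, h]
      · left; rw [map_neg, h, neg_neg]
    -- If `x`, `y`, `z` are orthogonal, then a unit vector orthogonal to `y` and `z` is `±x`.
    have perp : ∀ x y z w : E3,
        (inner ℝ x x : ℝ) = 1 → (inner ℝ w w : ℝ) = 1 → (inner ℝ x y : ℝ) = 0 →
        (inner ℝ x z : ℝ) = 0 → (∀ v : E3, (inner ℝ v x : ℝ) = 0 → (inner ℝ v y : ℝ) = 0 →
          (inner ℝ v z : ℝ) = 0 → v = 0) → (inner ℝ w y : ℝ) = 0 → (inner ℝ w z : ℝ) = 0 →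
        (w = x ∨ w = -x) := by
      intro x y z w hx hw hxy hxz hc hwy hwz
      have h := hc (w - (inner ℝ w x : ℝ) • x)
        (by rw [inner_sub_left, inner_smul_left, hx]; simp)
        (by rw [inner_sub_left, inner_smul_left, hwy, hxy]; simp)
        (by rw [inner_sub_left, inner_smul_left, hwz, hxz]; simp)
      have h2 := sub_eq_zero.1 h
      refine eq_or_eq_neg_of_inner_sq hx hw ?_
      have h3 := congrArg (fun v : E3 => (inner ℝ v w : ℝ)) h2
      simp only [inner_smul_left, hw, real_inner_comm w x, RCLike.conj_to_real] at h3
      rw [real_inner_comm, sq]; exact h3.symm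
    have sgn : ∀ {x y : E3}, (x = y ∨ x = -y) → ∀ w : E3, (inner ℝ y w : ℝ) = 0 →
        (inner ℝ x w : ℝ) = 0 := by
      rintro x y (rfl | rfl) w h
      · exact h
      · rw [inner_neg_left, h, neg_zero]
    -- No element of the group permutes the three lines cyclically.
    have cyc : ∀ g ∈ G, ∀ x y z : E3, (inner ℝ z z : ℝ) = 1 → (inner ℝ y x : ℝ) = 0 →
        (inner ℝ x z : ℝ) = 0 → (inner ℝ y z : ℝ) = 0 → (∀ v : E3, (inner ℝ v x : ℝ) = 0 →
          (inner ℝ v y : ℝ) = 0 → (inner ℝ v z : ℝ) = 0 → v = 0) →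
        (g x = y ∨ g x = -y) → ¬ (g y = z ∨ g y = -z) := by
      intro g hg x y z hz hyx hxz hyz hc h1 h2
      have h3 : g (g x) = z ∨ g (g x) = -z := pm g h1 h2
      have h4 : g (g z) = x ∨ g (g z) = -x := by
        have h5 : z = g (g x) ∨ z = -g (g x) := by
          rcases h3 with h | h
          · exact Or.inl h.symm
          · right; rw [h, neg_neg]
        have := pm g (pm g h5 (Or.inl rfl)) (Or.inl rfl)
        rwa [invol4 g hg] at this
      have flip : ∀ {u v : E3}, (u = v ∨ u = -v) → (v = u ∨ v = -u) := by
        rintro u v (rfl | rfl)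
        · exact Or.inl rfl
        · exact Or.inr (neg_neg _).symm
      have hzx : (inner ℝ z x : ℝ) = 0 := by rw [real_inner_comm]; exact hxz
      have hgz : g z = 0 := hc _
        (by
          rw [← LinearIsometryEquiv.inner_map_map g]
          refine sgn h4 _ ?_
          rw [real_inner_comm]
          exact sgn h1 _ hyx)
        (by
          rw [real_inner_comm]
          refine sgn (flip h1) _ ?_
          rw [LinearIsometryEquiv.inner_map_map, hxz])
        (by
          rw [real_inner_comm]
          refine sgn (flip h2) _ ?_
          rw [LinearIsometryEquiv.inner_map_map, hyz])
      have : (inner ℝ (g z) (g z) : ℝ) = 1 := by rw [LinearIsometryEquiv.inner_map_map, hz]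
      rw [hgz] at this
      simp at this
    -- The map `f` interchanges the lines of `a` and `b` and preserves that of `d`. By assumption
    -- some `h` moves the line of `d`; then `h` or `f * h` would permute the three lines cyclically.
    have f1 : f a = b ∨ f a = -b := Or.inl rfl
    have f2 : f b = a ∨ f b = -a := by
      rcases lines _ (hbr.map hf) with h | h | h
      · exact h
      · exact absurd h (par f hf b f1)
      · exact absurd h (cyc f hf a b d hdd hba had hbd comp f1)
    have unit : ∀ g : E3 ≃ₗᵢ[ℝ] E3, (inner ℝ (g d) (g d) : ℝ) = 1 := fun g => by
      rw [LinearIsometryEquiv.inner_map_map, hdd]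
    have image : ∀ g : E3 ≃ₗᵢ[ℝ] E3, ∀ {x y : E3}, (g x = y ∨ g x = -y) →
        (inner ℝ d x : ℝ) = 0 → (inner ℝ (g d) y : ℝ) = 0 := by
      intro g x y h hx
      rw [← LinearIsometryEquiv.inner_map_map g] at hx
      rcases h with h | h <;> rw [h] at hx
      · exact hx
      · simpa using hx
    have f3 : f d = d ∨ f d = -d :=
      perp d a b (f d) hdd (unit f) hda hdb
        (fun v h1 h2 h3 => comp v h2 h3 h1) (image f f2 hdb) (image f f1 hda)
    obtain ⟨h, hh, hhd, hhd'⟩ := hcon d (hne d hdd)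
    have notd : ¬ (h d = d ∨ h d = -d) := fun h' => h'.elim hhd hhd'
    have toab : ∀ {x y : E3}, (inner ℝ (h d) x : ℝ) = 0 → (inner ℝ (h d) y : ℝ) = 0 →
        x = a → y = b → False := by
      intro x y h1 h2 hx hy
      rw [hx] at h1
      rw [hy] at h2
      exact notd (perp d a b (h d) hdd (unit h) hda hdb
        (fun v h1 h2 h3 => comp v h2 h3 h1) h1 h2)
    have fh : f * h ∈ G := G.mul_mem hf hh
    have comp2 : ∀ v : E3, (inner ℝ v a : ℝ) = 0 → (inner ℝ v d : ℝ) = 0 →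
        (inner ℝ v b : ℝ) = 0 → v = 0 := fun v h1 h2 h3 => comp v h1 h3 h2
    have comp3 : ∀ v : E3, (inner ℝ v b : ℝ) = 0 → (inner ℝ v d : ℝ) = 0 →
        (inner ℝ v a : ℝ) = 0 → v = 0 := fun v h1 h2 h3 => comp v h3 h1 h2
    have hd_a : (h a = d ∨ h a = -d) → False := by
      intro ha1
      have hb1 : h b = b ∨ h b = -b := by
        rcases lines _ (hbr.map hh) with h1 | h1 | h1
        · exact absurd ha1 (cyc h hh b a d hdd hab hbd had
            (fun v h1 h2 h3 => comp v h2 h1 h3) h1)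
        · exact h1
        · exact absurd h1 (par h hh d ha1)
      have hd1 : h d = a ∨ h d = -a :=
        perp a b d (h d) ha.1 (unit h) hab had comp (image h hb1 hdb) (image h ha1 hda)
      exact cyc _ fh a d b hbr.1 hda hab hdb comp2 (pm f ha1 f3) (pm f hd1 f1)
    have hd_b : (h b = d ∨ h b = -d) → False := by
      intro hb1
      have ha1 : h a = a ∨ h a = -a := by
        rcases lines _ (ha.map hh) with h1 | h1 | h1
        · exact h1
        · exact absurd hb1 (cyc h hh a b d hdd hba had hbd comp h1)
        · exact absurd hb1 (par h hh d h1)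
      have hd1 : h d = b ∨ h d = -b :=
        perp b a d (h d) hbr.1 (unit h) hba hbd
          (fun v h1 h2 h3 => comp v h2 h1 h3) (image h ha1 hda) (image h hb1 hdb)
      exact cyc _ fh b d a ha.1 hdb hba hda comp3 (pm f hb1 f3) (pm f hd1 f2)
    rcases lines _ (ha.map hh) with h1 | h1 | h1
    · rcases lines _ (hbr.map hh) with h2 | h2 | h2
      · exact par h hh a h1 h2
      · exact toab (image h h1 hda) (image h h2 hdb) rfl rfl
      · exact hd_b h2
    · rcases lines _ (hbr.map hh) with h2 | h2 | h2
      · exact toab (image h h2 hdb) (image h h1 hda) rfl rfl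
      · exact par h hh b h1 h2
      · exact hd_b h2
    · exact hd_a h1
  -- There are no half-turns, so that `G` consists of the identity and at most one isometry `g` of
  -- determinant `-1`, an involution. It is the negation or fixes a vector of the form `x + g x`.
  · have triv : ∀ g ∈ G, (∀ a b, cross (g a) (g b) = g (cross a b)) → ∀ x, g x = x := by
      intro g hg hd
      rcases hG g hg hd with h | ⟨r, hr, -⟩
      · exact h
      · exact absurd ⟨r, hr⟩ hex
    have hu : (!₂[1, 0, 0] : E3) ≠ 0 := fun h => by
      simpa using congrArg (fun v : E3 => v 0) h
    by_cases h : ∀ g ∈ G, ∀ a b, cross (g a) (g b) = g (cross a b)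
    · exact ⟨!₂[1, 0, 0], hu, fun g hg => Or.inl (triv g hg (h g hg) _)⟩
    · push Not at h
      obtain ⟨g, hg, a, b, hgab⟩ := h
      have neg : ∀ f ∈ G, (∀ x, f x = x) ∨
          ∀ a b, cross (f a) (f b) = (-1 : ℝ) • f (cross a b) := by
        intro f hf
        obtain ⟨ε, h1, hε⟩ := exists_map_cross f
        rcases h1 with rfl | rfl
        · exact Or.inl (triv f hf (by simpa using hε))
        · exact Or.inr hε
      have hgn := (neg g hg).resolve_left fun h => hgab (by rw [h, h, h])
      have hgg : ∀ x, g (g x) = x :=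
        triv _ (G.mul_mem hg hg) (sq1 g hg g hg (-1) (Or.inr rfl) hgn hgn)
      have all : ∀ f ∈ G, (∀ x, f x = x) ∨ ∀ x, f x = g x := by
        intro f hf
        refine (neg f hf).imp id fun hfn x => ?_
        have := triv _ (G.mul_mem hf hg) (sq1 f hf g hg (-1) (Or.inr rfl) hfn hgn) (g x)
        change f (g (g x)) = g x at this
        rwa [hgg] at this
      by_cases hx : ∀ x, x + g x = 0
      · refine ⟨!₂[1, 0, 0], hu, fun f hf => ?_⟩
        rcases all f hf with h | h
        · exact Or.inl (h _)
        · right; rw [h, eq_neg_iff_add_eq_zero, add_comm, hx]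
      · push Not at hx
        obtain ⟨x, hx⟩ := hx
        refine ⟨x + g x, hx, fun f hf => Or.inl ?_⟩
        rcases all f hf with h | h
        · exact h _
        · rw [h, map_add, hgg, add_comm]

/-- A finite group of linear isometries of space maps some line onto itself, or it contains
rotations of order three about different axes. -/
theorem exists_axes_or_exists_line (hG : (G : Set (E3 ≃ₗᵢ[ℝ] E3)).Finite) :
    (∃ x ∈ axes G, ∃ y ∈ axes G, y ≠ x ∧ y ≠ -x) ∨
      ∃ e : E3, e ≠ 0 ∧ ∀ g ∈ G, g e = e ∨ g e = -e := by
  by_contra hcon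
  push Not at hcon
  obtain ⟨hax, hline⟩ := hcon
  have hne : ∀ r : E3, (inner ℝ r r : ℝ) = 1 → r ≠ 0 := by rintro r h rfl; simp at h
  have acute : ∀ r k, HasRot G r k → 0 ≤ k → ¬ k < 1 := by
    intro r k hr hk0 hk1
    obtain ⟨f, hf, h1, h2⟩ := hline r (hne r hr.1)
    obtain ⟨x, hx, y, hy, h3, h4⟩ := exists_axes_of_acute hG hr hk0 hk1 hf h1 h2
    exact h4 (hax x hx y hy h3)
  have noaxis : ∀ v, v ∉ axes G := by
    intro v hv
    obtain ⟨f, hf, h1, h2⟩ := hline v (by rintro rfl; simpa using hv.1)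
    exact h2 (hax v hv _ (map_mem_axes hv hf) h1)
  -- The cosines of the angle `θ`, of `2θ` and of `3θ` are negative or `1`. This leaves only the
  -- identity, the half-turns and the rotations of order three, and the latter have been excluded.
  have cos : ∀ r k, HasRot G r k → k = 1 ∨ k = -1 := by
    intro r k hr
    by_contra h
    push Not at h
    have hle : k ^ 2 ≤ 1 := by
      obtain ⟨-, g, -, σ, h, -⟩ := hr
      nlinarith [sq_nonneg σ]
    have hk1 : k < 1 := lt_of_le_of_ne (by nlinarith) h.1
    have hkm : -1 < k := lt_of_le_of_ne (by nlinarith) (Ne.symm h.2)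
    have hk0 : k < 0 := by
      by_contra h
      exact acute r k hr (not_lt.1 h) hk1
    have h2 : 2 * k ^ 2 - 1 < 0 := by
      by_contra h
      exact acute r _ hr.double (not_lt.1 h) (by nlinarith)
    have h3 : (k - 1) * (2 * k + 1) ^ 2 = 0 := by
      have := acute r _ hr.triple (by nlinarith [mul_nonneg (neg_nonneg.2 hk0.le) (neg_nonneg.2 h2.le)])
      nlinarith [sq_nonneg (2 * k + 1)]
    rcases mul_eq_zero.1 h3 with h4 | h4
    · linarith
    · have h5 := pow_eq_zero_iff two_ne_zero |>.1 h4
      have hk : k = -1 / 2 := by linarith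
      exact noaxis _ (HasRot.mem_axes (hk ▸ hr))
  obtain ⟨e, he, h⟩ := exists_axis_of_half_turns (G := G) fun g hg hd => by
    obtain ⟨r, k, σ, hr, hkσ, hrod⟩ := exists_eq_rod g hd
    rcases cos r k ⟨hr, g, hg, σ, hkσ, hrod⟩ with rfl | rfl
    · have hs : σ = 0 := pow_eq_zero_iff two_ne_zero |>.1 (by linarith)
      exact Or.inl fun x => by rw [hrod, hs, rod_one_zero]
    · have hs : σ = 0 := pow_eq_zero_iff two_ne_zero |>.1 (by linarith)
      exact Or.inr ⟨r, ⟨hr, g, hg, σ, hkσ, hrod⟩, fun x => by rw [hrod, hs, rod_half_turn]⟩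
  obtain ⟨g, hg, h1, h2⟩ := hline e he
  rcases h g hg with h3 | h3
  · exact h1 h3
  · exact h2 h3

/-! ### Similarities and the symmetry group of a uniform polyhedron -/

theorem IsSimilar.symm {A B : Set E3} (h : IsSimilar A B) : IsSimilar B A := by
  obtain ⟨f, rfl⟩ := h
  exact ⟨f.symm, by rw [← image_comp]; simp⟩

theorem IsSimilar.trans {A B C : Set E3} (h : IsSimilar A B) (h' : IsSimilar B C) :
    IsSimilar A C := by
  obtain ⟨f, rfl⟩ := h
  obtain ⟨g, rfl⟩ := h'
  exact ⟨f.trans g, by rw [← image_comp]; rfl⟩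

theorem AdmitsFaceEmbedding.congr {k : ℕ} {A B C : Set E3} (h : IsSimilar A B)
    (hB : AdmitsFaceEmbedding k B C) : AdmitsFaceEmbedding k A C := by
  obtain ⟨S, h1, h2⟩ := hB
  exact ⟨S, h.trans h1, h2⟩

/-- The convex hull of `W` is similar to that of the image of `W` under a similarity given by a
translation, a nonzero factor and a linear isometry. -/
theorem isSimilar_convexHull_image (W : Set E3) (c : E3) {μ : ℝ} (hμ : μ ≠ 0)
    (φ : E3 ≃ₗᵢ[ℝ] E3) :
    IsSimilar (convexHull ℝ W) (convexHull ℝ ((fun x => c + μ • φ x) '' W)) := by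
  refine ⟨φ.toIsometryEquiv.toDilationEquiv.trans (DilationEquiv.smulTorsor c hμ), ?_⟩
  let A : E3 →ᵃ[ℝ] E3 := (AffineMap.const ℝ E3 c) + (μ • φ.toLinearEquiv.toLinearMap).toAffineMap
  have hA : (A : E3 → E3) = fun x => c + μ • φ x := rfl
  rw [← hA, ← AffineMap.image_convexHull]
  apply image_congr
  intro x _
  change μ • φ x + c = c + μ • φ x
  exact add_comm _ _

theorem isSimilar_smul (W : Set E3) {μ : ℝ} (hμ : μ ≠ 0) :
    IsSimilar (convexHull ℝ ((fun x => μ • x) '' W)) (convexHull ℝ W) := by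
  have := (isSimilar_convexHull_image W 0 hμ (LinearIsometryEquiv.refl ℝ E3)).symm
  simpa using this

/-- The group of the linear isometries that preserve `W`. -/
def symmetryGroup (W : Set E3) : Subgroup (E3 ≃ₗᵢ[ℝ] E3) where
  carrier := {g | g '' W = W}
  mul_mem' := by
    intro f g hf hg
    change (fun x => f (g x)) '' W = W
    have : (fun x => f (g x)) '' W = f '' (g '' W) := (image_comp f g W)
    rw [this, show g '' W = W from hg]
    exact hf
  one_mem' := by
    change (fun x => x) '' W = W
    simp
  inv_mem' := by
    intro f hf
    change f.symm '' W = W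
    conv_lhs => rw [← show f '' W = W from hf]
    rw [← image_comp]
    simp

theorem map_mem_of_symmetry {W : Set E3} {g : E3 ≃ₗᵢ[ℝ] E3} (hg : g ∈ symmetryGroup W) {x : E3}
    (hx : x ∈ W) : g x ∈ W := by
  have : g '' W = W := hg
  rw [← this]
  exact mem_image_of_mem g hx

theorem inner_eq_of_mem_convexHull {W : Set E3} {u : E3} {k : ℝ}
    (h : ∀ w ∈ W, (inner ℝ u w : ℝ) = k) : ∀ x ∈ convexHull ℝ W, (inner ℝ u x : ℝ) = k := by
  have hsub : convexHull ℝ W ⊆ {x | (inner ℝ u x : ℝ) = k} := by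
    refine convexHull_min h ?_
    intro x hx y hy a b _ _ hab
    simp only [mem_ofPred_eq] at hx hy ⊢
    rw [inner_add_right, inner_smul_right, inner_smul_right, hx, hy, ← add_mul, hab, one_mul]
  exact hsub

/-- A solid is not contained in a plane. -/
theorem exists_inner_ne {W : Set E3} (hW : (interior (convexHull ℝ W)).Nonempty) {u : E3}
    (hu : u ≠ 0) (k : ℝ) : ∃ w ∈ W, (inner ℝ u w : ℝ) ≠ k := by
  by_contra h
  push Not at h
  have hsub := inner_eq_of_mem_convexHull h
  obtain ⟨x, hx⟩ := hW
  have hcont : Filter.Tendsto (fun t : ℝ => x + t • u) (nhds 0) (nhds x) := by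
    have : Continuous fun t : ℝ => x + t • u := by fun_prop
    simpa using this.tendsto 0
  have hev := hcont.eventually (isOpen_interior.mem_nhds hx)
  obtain ⟨ε, hε, hball⟩ := Metric.eventually_nhds_iff.1 hev
  have h1 := hsub _ (interior_subset hx)
  have h2 := hsub _ (interior_subset (hball (y := ε / 2) (by
    rw [Real.dist_eq, sub_zero, abs_of_pos (by linarith)]; linarith)))
  simp only [inner_add_right, inner_smul_right] at h1 h2
  have h3 : 0 < (inner ℝ u u : ℝ) := real_inner_self_pos.2 hu
  have : ε / 2 * (inner ℝ u u : ℝ) = 0 := by linarith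
  have := mul_pos (half_pos hε) h3
  linarith

theorem span_eq_top_of_solid {W : Set E3} (hW : (interior (convexHull ℝ W)).Nonempty) :
    Submodule.span ℝ W = ⊤ := by
  rw [← Submodule.orthogonal_eq_bot_iff]
  rw [Submodule.eq_bot_iff]
  intro u hu
  by_contra h
  obtain ⟨w, hw, hne⟩ := exists_inner_ne hW h 0
  exact hne (by rw [real_inner_comm]; exact hu w (Submodule.subset_span hw))

theorem finite_symmetryGroup {W : Set E3} (hfin : W.Finite)
    (hW : (interior (convexHull ℝ W)).Nonempty) :
    (symmetryGroup W : Set (E3 ≃ₗᵢ[ℝ] E3)).Finite := by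
  have hf : Finite W := hfin
  refine Set.Finite.of_injOn (f := fun g : E3 ≃ₗᵢ[ℝ] E3 => fun w : W => g w)
    (t := {f | ∀ w, f w ∈ W}) (fun g hg w => map_mem_of_symmetry hg w.2) ?_
    (Set.Finite.pi' fun _ => hfin)
  intro g _ h _ hgh
  apply LinearIsometryEquiv.toLinearEquiv_injective
  apply LinearEquiv.toLinearMap_injective
  refine LinearMap.ext_on (span_eq_top_of_solid hW) fun w hw => ?_
  exact congrFun hgh ⟨w, hw⟩

/-- A vertex-transitive polyhedron is, up to a translation, the convex hull of a finite set on
which the linear isometries that preserve it act transitively. -/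
theorem exists_center {S : Set E3} (hS : IsPolyhedron S) (hT : IsVertexTransitive S) :
    ∃ (c : E3) (W : Set E3), W.Finite ∧ S = convexHull ℝ ((fun x => c + x) '' W) ∧
      (interior (convexHull ℝ W)).Nonempty ∧
      ∀ x ∈ W, ∀ y ∈ W, ∃ g ∈ symmetryGroup W, g x = y := by
  obtain ⟨⟨V₀, hV₀, hSV₀⟩, hint⟩ := hS
  set V := S.extremePoints ℝ with hV
  have hVfin : V.Finite := hV₀.subset (by rw [hV, hSV₀]; exact extremePoints_convexHull_subset)
  have hSV : convexHull ℝ V = S := by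
    have hc : IsCompact S := by rw [hSV₀]; exact hV₀.isCompact_convexHull ℝ
    have hconv : Convex ℝ S := by rw [hSV₀]; exact convex_convexHull ℝ _
    have := closure_convexHull_extremePoints hc hconv
    rwa [(hVfin.isClosed_convexHull ℝ).closure_eq] at this
  have hVne : V.Nonempty := by
    rw [← convexHull_nonempty_iff (𝕜 := ℝ), hSV]
    exact hint.mono interior_subset
  set F := hVfin.toFinset with hF
  have hn : (F.card : ℝ) ≠ 0 := by
    have : F.Nonempty := by simpa [hF] using hVne
    exact_mod_cast this.card_pos.ne'
  -- The center is the centroid of the vertices; every isometry that preserves `S` fixes it.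
  set c : E3 := (F.card : ℝ)⁻¹ • ∑ v ∈ F, v with hc
  -- Such an isometry acts on the vectors from the center by a linear isometry, and it permutes the
  -- vertices.
  have key : ∀ g : E3 ≃ᵢ E3, g '' S = S →
      ∃ L : E3 ≃ₗᵢ[ℝ] E3, (∀ x, g x - c = L (x - c)) ∧ ∀ v ∈ V, g v ∈ V := by
    intro g hg
    set A := g.toRealAffineIsometryEquiv with hA
    have hAg : ∀ x, A x = g x := fun x => by rw [hA, IsometryEquiv.coeFn_toRealAffineIsometryEquiv]
    set L := A.linearIsometryEquiv with hL
    have hlin : ∀ x y, g x - g y = L (x - y) := fun x y => by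
      rw [← hAg, ← hAg]
      exact (A.map_vsub x y).symm
    have hVmap : ∀ v ∈ V, g v ∈ V := by
      intro v hv
      rw [hV, mem_extremePoints] at hv ⊢
      refine ⟨hg ▸ mem_image_of_mem g hv.1, fun x hx y hy hxy => ?_⟩
      rw [← hg] at hx hy
      obtain ⟨x, hx, rfl⟩ := hx
      obtain ⟨y, hy, rfl⟩ := hy
      have h1 : v ∈ openSegment ℝ x y := by
        obtain ⟨a, b, ha, hb, hab, h⟩ := hxy
        refine ⟨a, b, ha, hb, hab, ?_⟩
        have e : L (a • x + b • y - v) = 0 := by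
          have hb' : a = 1 - b := by linarith
          have h2 : L (a • x + b • y - v) = a • L (x - v) + b • L (y - v) := by
            rw [← map_smul, ← map_smul, ← map_add]
            congr 1
            rw [hb']; module
          rw [h2, ← hlin, ← hlin, ← h, hb']; module
        rw [← sub_eq_zero]
        exact L.injective (by rw [e, map_zero])
      obtain ⟨e1, e2⟩ := hv.2 x hx y hy h1
      exact ⟨by rw [e1], by rw [e2]⟩
    have hsum : ∑ v ∈ F, g v = ∑ v ∈ F, v := by
      refine Finset.sum_nbij g (fun v hv => ?_) g.injective.injOn ?_ (fun _ _ => rfl)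
      · simp only [hF, Finite.mem_toFinset] at hv ⊢
        exact hVmap v hv
      · have himg : g '' (F : Set E3) ⊆ F := by
          rintro _ ⟨v, hv, rfl⟩
          simp only [hF, Finite.coe_toFinset] at hv ⊢
          exact hVmap v hv
        exact (Finset.surjOn_of_injOn_of_card_le g (fun v hv => himg ⟨v, hv, rfl⟩)
          g.injective.injOn le_rfl)
    have hgc : g c = c := by
      have h1 : ∑ v ∈ F, L (v - c) = 0 := by
        rw [← map_sum, Finset.sum_sub_distrib, Finset.sum_const, hc, ← Nat.cast_smul_eq_nsmul ℝ,
          smul_smul, mul_inv_cancel₀ hn, one_smul, sub_self, map_zero]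
      have h2 : ∑ v ∈ F, L (v - c) = (F.card : ℝ) • (c - g c) := by
        simp_rw [← hlin]
        rw [Finset.sum_sub_distrib, Finset.sum_const, hsum, ← Nat.cast_smul_eq_nsmul ℝ, smul_sub]
        congr 1
        rw [hc, smul_smul, mul_inv_cancel₀ hn, one_smul]
      rw [h1] at h2
      rcases smul_eq_zero.1 h2.symm with h | h
      · exact absurd h hn
      · exact (sub_eq_zero.1 h).symm
    exact ⟨L, fun x => by rw [← hlin, hgc], hVmap⟩
  refine ⟨c, (fun x => x - c) '' V, hVfin.image _, ?_, ?_, ?_⟩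
  · rw [← image_comp, ← hSV]
    congr 1
    ext x
    simp
  · have himg : convexHull ℝ ((fun x => x - c) '' V) = (fun x => x - c) '' S := by
      have h1 : (fun x : E3 => x - c) = (AffineMap.id ℝ E3 - AffineMap.const ℝ E3 c : E3 →ᵃ[ℝ] E3) :=
        rfl
      rw [h1, ← AffineMap.image_convexHull, hSV]
    rw [himg]
    have h2 : interior ((fun x => x - c) '' S) = (fun x => x - c) '' interior S :=
      ((Homeomorph.subRight c).image_interior S).symm
    rw [h2]
    exact hint.image _
  · rintro _ ⟨x, hx, rfl⟩ _ ⟨y, hy, rfl⟩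
    obtain ⟨g, hg, hgx⟩ := hT x hx y hy
    obtain ⟨L, hL, hLV⟩ := key g hg
    obtain ⟨L', hL', hLV'⟩ := key g.symm (by
      conv_lhs => rw [← hg]
      rw [← image_comp]; simp)
    refine ⟨L, ?_, by rw [← hL, hgx]⟩
    change L '' _ = _
    refine Subset.antisymm ?_ ?_
    · rintro _ ⟨_, ⟨v, hv, rfl⟩, rfl⟩
      exact ⟨g v, hLV v hv, hL v⟩
    · rintro _ ⟨v, hv, rfl⟩
      refine ⟨g.symm v - c, ⟨_, hLV' v hv, rfl⟩, ?_⟩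
      rw [← hL, g.apply_symm_apply]

/-! ### The tetrahedron and embeddings of solids with tetrahedral symmetry -/

theorem eq_smul_cross_of_orthogonal {w x y : E3} (hxy : cross x y ≠ 0)
    (hx : (inner ℝ w x : ℝ) = 0) (hy : (inner ℝ w y : ℝ) = 0) :
    ∃ s : ℝ, w = s • cross x y := by
  have hn : (inner ℝ (cross x y) (cross x y) : ℝ) ≠ 0 := (real_inner_self_pos.2 hxy).ne'
  refine ⟨inner ℝ w (cross x y) / inner ℝ (cross x y) (cross x y), ?_⟩
  rw [← sub_eq_zero]
  refine eq_zero_of_orthogonal hxy ?_ ?_ ?_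
  · rw [inner_sub_left, inner_smul_left, hx, real_inner_comm x (cross x y), inner_cross_self_left]
    simp
  · rw [inner_sub_left, inner_smul_left, hy, real_inner_comm y (cross x y), inner_cross_self_right]
    simp
  · rw [inner_sub_left, inner_smul_left, RCLike.conj_to_real, div_mul_cancel₀ _ hn, sub_self]

/-- Vectors orthogonal to two directions of a plane are parallel. -/
theorem inner_sq_eq_of_orthogonal {u w x y : E3} (hxy : cross x y ≠ 0)
    (hux : (inner ℝ u x : ℝ) = 0) (huy : (inner ℝ u y : ℝ) = 0)
    (hwx : (inner ℝ w x : ℝ) = 0) (hwy : (inner ℝ w y : ℝ) = 0) :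
    (inner ℝ u w : ℝ) ^ 2 = inner ℝ u u * inner ℝ w w := by
  obtain ⟨s, rfl⟩ := eq_smul_cross_of_orthogonal hxy hux huy
  obtain ⟨t, rfl⟩ := eq_smul_cross_of_orthogonal hxy hwx hwy
  simp only [inner_smul_left, inner_smul_right, RCLike.conj_to_real]
  ring

theorem linearIndependent_of_cross_ne_zero {x y : E3} (h : cross x y ≠ 0) :
    LinearIndependent ℝ ![x, y] := by
  rw [LinearIndependent.pair_iff]
  intro s t hst
  have h1 : s • cross x y = cross (s • x + t • y) y := by
    apply ext_coord <;> simp <;> ring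
  have h2 : t • cross x y = cross x (s • x + t • y) := by
    apply ext_coord <;> simp <;> ring
  rw [hst, show cross 0 y = 0 by apply ext_coord <;> simp] at h1
  rw [hst, show cross x 0 = 0 by apply ext_coord <;> simp] at h2
  exact ⟨(smul_eq_zero.1 h1).resolve_right h, (smul_eq_zero.1 h2).resolve_right h⟩

/-- A set in a plane that contains three non-collinear points spans a two-dimensional space of
directions. -/
theorem finrank_vectorSpan_eq_two {F : Set E3} {u : E3} (hu : u ≠ 0) {k : ℝ}
    (hF : ∀ x ∈ F, (inner ℝ u x : ℝ) = k) {a b d : E3} (ha : a ∈ F) (hb : b ∈ F) (hd : d ∈ F)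
    (h : cross (b - a) (d - a) ≠ 0) : Module.finrank ℝ (vectorSpan ℝ F) = 2 := by
  apply le_antisymm
  · have hsub : vectorSpan ℝ F ≤ (Submodule.span ℝ {u})ᗮ := by
      rw [vectorSpan_def, Submodule.span_le]
      rintro _ ⟨x, hx, y, hy, rfl⟩
      rw [SetLike.mem_coe, Submodule.mem_orthogonal_singleton_iff_inner_right]
      change (inner ℝ u (x - y) : ℝ) = 0
      rw [inner_sub_right, hF x hx, hF y hy, sub_self]
    have h1 := Submodule.finrank_mono hsub
    have h2 := Submodule.finrank_add_finrank_orthogonal (Submodule.span ℝ {u})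
    rw [finrank_span_singleton hu, finrank_euclideanSpace_fin] at h2
    omega
  · have hli := linearIndependent_of_cross_ne_zero h
    have h1 : Submodule.span ℝ (range ![b - a, d - a]) ≤ vectorSpan ℝ F := by
      rw [Submodule.span_le]
      rintro _ ⟨i, rfl⟩
      fin_cases i
      · exact vsub_mem_vectorSpan ℝ hb ha
      · exact vsub_mem_vectorSpan ℝ hd ha
    have h2 := Submodule.finrank_mono h1
    rwa [finrank_span_eq_card hli, Fintype.card_fin] at h2

/-- A point and its two images under the rotations of order three about an axis through the origin
form an equilateral triangle, which is nondegenerate if the point is not on the axis. -/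
theorem cross_trot_sub_ne_zero {t a : E3} (ht : (inner ℝ t t : ℝ) = 3) (h : cross t a ≠ 0) :
    cross (trot 1 t a - a) (trot (-1) t a - a) ≠ 0 := by
  set u := cross t a with hu
  have hc : cross t u = (inner ℝ t a : ℝ) • t - (3 : ℝ) • a := by rw [hu, cross_cross, ht]
  have e1 : trot 1 t a - a = (2⁻¹ : ℝ) • (cross t u + u) := by
    rw [hc, trot, ← hu]; module
  have e2 : trot (-1) t a - a = (2⁻¹ : ℝ) • (cross t u + (-1 : ℝ) • u) := by
    rw [hc, trot, ← hu]; module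
  have e3 : cross (cross t u + u) (cross t u + (-1 : ℝ) • u) = (2 : ℝ) • cross u (cross t u) := by
    apply ext_coord <;> simp only [cross_zero, cross_one, cross_two, PiLp.add_apply,
      PiLp.smul_apply, smul_eq_mul] <;> ring
  have hut : (inner ℝ u t : ℝ) = 0 := by rw [real_inner_comm]; exact inner_cross_self_left t a
  rw [e1, e2, cross_smul_left, cross_smul_right, e3, cross_cross, hut]
  intro h0
  have h1 := congrArg (fun v : E3 => (inner ℝ v t : ℝ)) h0
  simp only [zero_smul, sub_zero, inner_smul_left, ht, inner_zero_left] at h1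
  have h2 : 0 < (inner ℝ u u : ℝ) := real_inner_self_pos.2 h
  simp at h1
  exact h h1

/-- The vertices of the regular tetrahedron. They are also the inner normals of its faces. -/
def tet : Fin 4 → E3 := ![!₂[1, 1, 1], !₂[1, -1, -1], !₂[-1, 1, -1], !₂[-1, -1, 1]]

theorem inner_tet_zero (x : E3) : (inner ℝ (tet 0) x : ℝ) = x 0 + x 1 + x 2 := by
  simp [tet, inner_eq]

theorem inner_tet_one (x : E3) : (inner ℝ (tet 1) x : ℝ) = x 0 - x 1 - x 2 := by
  simp [tet, inner_eq]; ring

theorem inner_tet_two (x : E3) : (inner ℝ (tet 2) x : ℝ) = -x 0 + x 1 - x 2 := by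
  simp [tet, inner_eq]; ring

theorem inner_tet_three (x : E3) : (inner ℝ (tet 3) x : ℝ) = -x 0 - x 1 + x 2 := by
  simp [tet, inner_eq]; ring

theorem inner_tet_self (i : Fin 4) : (inner ℝ (tet i) (tet i) : ℝ) = 3 := by
  rw [inner_eq]
  fin_cases i <;> simp [tet] <;> norm_num

theorem inner_tet_of_ne {i j : Fin 4} (h : i ≠ j) : (inner ℝ (tet i) (tet j) : ℝ) = -1 := by
  rw [inner_eq]
  revert h
  fin_cases i <;> fin_cases j <;> simp [tet]

theorem tet_ne_zero (i : Fin 4) : tet i ≠ 0 := fun h => by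
  have := inner_tet_self i
  rw [h] at this
  simp at this

theorem sum_inner_tet (x : E3) : ∑ i, (inner ℝ (tet i) x : ℝ) = 0 := by
  simp only [Fin.sum_univ_four, inner_tet_zero, inner_tet_one, inner_tet_two, inner_tet_three]
  ring

theorem tetrahedron_eq_convexHull : tetrahedron = convexHull ℝ (range tet) := by
  rw [tetrahedron]
  congr 1
  ext x
  simp only [mem_range, Fin.exists_fin_succ, tet]
  simp [eq_comm]

theorem mem_tetrahedron_iff {x : E3} : x ∈ tetrahedron ↔ ∀ i, -1 ≤ (inner ℝ (tet i) x : ℝ) := by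
  rw [tetrahedron_eq_convexHull]
  constructor
  · intro hx i
    have hsub : convexHull ℝ (range tet) ⊆ {x | -1 ≤ (inner ℝ (tet i) x : ℝ)} := by
      refine convexHull_min ?_ ?_
      · rintro _ ⟨j, rfl⟩
        by_cases h : i = j
        · rw [h, mem_ofPred_eq, inner_tet_self]; norm_num
        · rw [mem_ofPred_eq, inner_tet_of_ne h]
      · intro x hx y hy a b ha hb hab
        simp only [mem_ofPred_eq, inner_add_right, inner_smul_right] at hx hy ⊢
        nlinarith
    exact hsub hx
  · intro h
    have h1 : x = ∑ i, ((1 + (inner ℝ (tet i) x : ℝ)) / 4) • tet i := by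
      simp only [Fin.sum_univ_four, inner_tet_zero, inner_tet_one, inner_tet_two, inner_tet_three]
      apply ext_coord <;> simp [tet] <;> ring
    rw [h1]
    refine (convex_convexHull ℝ _).sum_mem (fun i _ => by linarith [h i]) ?_
      (fun i _ => subset_convexHull ℝ _ (mem_range_self i))
    rw [← Finset.sum_div, Finset.sum_add_distrib, sum_inner_tet]
    simp

theorem isClosed_tetrahedron : IsClosed tetrahedron := by
  rw [tetrahedron_eq_convexHull]
  exact (finite_range tet).isClosed_convexHull ℝ

theorem mem_frontier_tetrahedron_iff {x : E3} (hx : x ∈ tetrahedron) :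
    x ∈ frontier tetrahedron ↔ ∃ i, (inner ℝ (tet i) x : ℝ) = -1 := by
  rw [isClosed_tetrahedron.frontier_eq]
  constructor
  · rintro ⟨-, hx'⟩
    by_contra h
    push Not at h
    apply hx'
    have ho : IsOpen {y : E3 | ∀ i, -1 < (inner ℝ (tet i) y : ℝ)} := by
      rw [show {y : E3 | ∀ i, -1 < (inner ℝ (tet i) y : ℝ)} =
        ⋂ i, {y | -1 < (inner ℝ (tet i) y : ℝ)} by ext; simp]
      exact isOpen_iInter_of_finite fun i => isOpen_lt continuous_const (by fun_prop)
    refine mem_interior.2 ⟨_, fun y hy => mem_tetrahedron_iff.2 fun i => (hy i).le, ho, ?_⟩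
    exact fun i => lt_of_le_of_ne (mem_tetrahedron_iff.1 hx i) (Ne.symm (h i))
  · rintro ⟨i, hi⟩
    refine ⟨hx, fun hint => ?_⟩
    have hcont : Filter.Tendsto (fun s : ℝ => x + s • tet i) (nhds 0) (nhds x) := by
      have : Continuous fun s : ℝ => x + s • tet i := by fun_prop
      simpa using this.tendsto 0
    obtain ⟨ε, hε, hball⟩ := Metric.eventually_nhds_iff.1
      (hcont.eventually (isOpen_interior.mem_nhds hint))
    have h2 := mem_tetrahedron_iff.1 (interior_subset (hball (y := -(ε / 2)) (by
      rw [Real.dist_eq, sub_zero, abs_neg, abs_of_pos (by linarith)]; linarith))) i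
    rw [inner_add_right, inner_smul_right, inner_tet_self, hi] at h2
    linarith

/-- The rotations about the vertices of the tetrahedron act transitively on the vertices. -/
theorem exists_trot_inner_tet (i j : Fin 4) (h : i ≠ j) :
    ∃ k, ∃ ε : ℝ, (ε = 1 ∨ ε = -1) ∧
      ∀ w, (inner ℝ (tet j) (trot ε (tet k) w) : ℝ) = inner ℝ (tet i) w := by
  have key : ∀ k j i : Fin 4, ∀ ε : ℝ, (ε = 1 ∨ ε = -1) → trot (-ε) (tet k) (tet j) = tet i →
      ∃ k, ∃ ε : ℝ, (ε = 1 ∨ ε = -1) ∧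
      ∀ w, (inner ℝ (tet j) (trot ε (tet k) w) : ℝ) = inner ℝ (tet i) w := by
    intro k j i ε hε hk
    refine ⟨k, ε, hε, fun w => ?_⟩
    rw [← hk]
    simp only [inner_eq, trot_apply, cross_zero, cross_one, cross_two]
    ring
  have p : (1 : ℝ) = 1 ∨ (1 : ℝ) = -1 := Or.inl rfl
  have m : (-1 : ℝ) = 1 ∨ (-1 : ℝ) = -1 := Or.inr rfl
  fin_cases i <;> fin_cases j <;> first | exact absurd rfl h | skip
  · exact key 2 1 0 1 p (by apply ext_coord <;> simp [trot_apply, tet] <;> norm_num)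
  · exact key 3 2 0 1 p (by apply ext_coord <;> simp [trot_apply, tet] <;> norm_num)
  · exact key 1 3 0 1 p (by apply ext_coord <;> simp [trot_apply, tet] <;> norm_num)
  · exact key 3 0 1 1 p (by apply ext_coord <;> simp [trot_apply, tet] <;> norm_num)
  · exact key 0 2 1 1 p (by apply ext_coord <;> simp [trot_apply, tet] <;> norm_num)
  · exact key 2 3 1 1 p (by apply ext_coord <;> simp [trot_apply, tet] <;> norm_num)
  · exact key 1 0 2 1 p (by apply ext_coord <;> simp [trot_apply, tet] <;> norm_num)
  · exact key 3 1 2 1 p (by apply ext_coord <;> simp [trot_apply, tet] <;> norm_num)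
  · exact key 0 3 2 1 p (by apply ext_coord <;> simp [trot_apply, tet] <;> norm_num)
  · exact key 2 0 3 1 p (by apply ext_coord <;> simp [trot_apply, tet] <;> norm_num)
  · exact key 0 1 3 1 p (by apply ext_coord <;> simp [trot_apply, tet] <;> norm_num)
  · exact key 1 2 3 1 p (by apply ext_coord <;> simp [trot_apply, tet] <;> norm_num)

theorem trot_smul (ε : ℝ) (v : E3) (μ : ℝ) (y : E3) : trot ε v (μ • y) = μ • trot ε v y := by
  apply ext_coord <;> simp [trot_apply] <;> ring

theorem inner_trot_axis {t : E3} (ht : (inner ℝ t t : ℝ) = 3) (ε : ℝ) (a : E3) :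
    (inner ℝ t (trot ε t a) : ℝ) = inner ℝ t a := by
  rw [inner_trot, ht, inner_cross_self_left]; ring

/-- Suppose that a finite set is invariant under the rotations of the tetrahedron and has no point
on an axis of order three. Then its convex hull, scaled so that it touches the tetrahedron, does so
in four faces, one in each face of the tetrahedron. -/
theorem admitsFaceEmbedding_of_tetrahedral {W : Set E3} (hfin : W.Finite) (hne : W.Nonempty)
    (hrot : ∀ w ∈ W, ∀ i, ∀ ε : ℝ, (ε = 1 ∨ ε = -1) → trot ε (tet i) w ∈ W)
    (haxis : ∀ w ∈ W, ∀ i, cross (tet i) w ≠ 0) :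
    AdmitsFaceEmbedding 4 (convexHull ℝ W) tetrahedron := by
  -- All four functions `inner ℝ (tet i)` take the same values on `W`, hence have the same minimum
  -- `m`.
  have htrans : ∀ i j, ∀ w ∈ W, ∃ w' ∈ W, (inner ℝ (tet j) w' : ℝ) = inner ℝ (tet i) w := by
    intro i j w hw
    by_cases h : i = j
    · exact ⟨w, hw, by rw [h]⟩
    · obtain ⟨k, ε, hε, hk⟩ := exists_trot_inner_tet i j h
      exact ⟨_, hrot w hw k ε hε, hk w⟩
  obtain ⟨w₀, hw₀, hmin⟩ := exists_min_image W (fun w => (inner ℝ (tet 0) w : ℝ)) hfin hne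
  set m : ℝ := inner ℝ (tet 0) w₀ with hm
  have hmin' : ∀ i, ∀ w ∈ W, m ≤ (inner ℝ (tet i) w : ℝ) := by
    intro i w hw
    obtain ⟨w', hw', h⟩ := htrans i 0 w hw
    rw [← h]
    exact hmin w' hw'
  have hatt : ∀ i, ∃ w ∈ W, (inner ℝ (tet i) w : ℝ) = m := fun i => htrans 0 i w₀ hw₀
  -- The minimum is negative: otherwise all four functions would vanish at `w₀`, as their sum is
  -- zero, and `w₀ = 0` is on every axis.
  have hm0 : m < 0 := by
    by_contra hcon
    have h0 : ∀ i, 0 ≤ (inner ℝ (tet i) w₀ : ℝ) := fun i => le_trans (not_lt.1 hcon) (hmin' i w₀ hw₀)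
    have hs := sum_inner_tet w₀
    have a0 := h0 0
    have a1 := h0 1
    have a2 := h0 2
    have a3 := h0 3
    rw [Fin.sum_univ_four] at hs
    rw [inner_tet_zero] at hs a0
    rw [inner_tet_one] at hs a1
    rw [inner_tet_two] at hs a2
    rw [inner_tet_three] at hs a3
    refine haxis w₀ hw₀ 0 ?_
    apply ext_coord <;> simp [tet] <;> linarith
  -- This factor moves the minimum to `-1`, which is the value on the faces of the tetrahedron.
  set μ : ℝ := -m⁻¹ with hμ
  have hμ0 : 0 < μ := by rw [hμ, neg_pos]; exact inv_lt_zero.2 hm0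
  have hμm : μ * m = -1 := by rw [hμ, neg_mul, inv_mul_cancel₀ hm0.ne]
  set W' : Set E3 := (fun x => μ • x) '' W with hW'
  set K := convexHull ℝ W' with hK
  have hW'fin : W'.Finite := hfin.image _
  have hW'T : ∀ i, ∀ w ∈ W', -1 ≤ (inner ℝ (tet i) w : ℝ) := by
    rintro i _ ⟨w, hw, rfl⟩
    simp only [inner_smul_right]
    rw [← hμm]
    exact mul_le_mul_of_nonneg_left (hmin' i w hw) hμ0.le
  have hKT : K ⊆ tetrahedron := by
    refine convexHull_min (fun w hw => mem_tetrahedron_iff.2 fun i => hW'T i w hw) ?_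
    rw [tetrahedron_eq_convexHull]
    exact convex_convexHull ℝ _
  have hKclosed : IsClosed K := hW'fin.isClosed_convexHull ℝ
  set F : Fin 4 → Set E3 := fun i => {x ∈ K | (inner ℝ (tet i) x : ℝ) = -1} with hF
  -- A point where the minimum is attained and its images under the rotations about the normal of
  -- the face of the tetrahedron form a triangle in this face.
  have htri : ∀ i, ∃ a ∈ F i, ∃ b ∈ F i, ∃ d ∈ F i, cross (b - a) (d - a) ≠ 0 := by
    intro i
    obtain ⟨w, hw, hwm⟩ := hatt i
    have mem : ∀ v ∈ W, (inner ℝ (tet i) v : ℝ) = m → μ • v ∈ F i := fun v hv hvm =>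
      ⟨subset_convexHull ℝ _ ⟨v, hv, rfl⟩, by rw [inner_smul_right, hvm, hμm]⟩
    refine ⟨μ • w, mem w hw hwm, μ • trot 1 (tet i) w, mem _ (hrot w hw i 1 (Or.inl rfl)) ?_,
      μ • trot (-1) (tet i) w, mem _ (hrot w hw i (-1) (Or.inr rfl)) ?_, ?_⟩
    · rw [inner_trot_axis (inner_tet_self i), hwm]
    · rw [inner_trot_axis (inner_tet_self i), hwm]
    · rw [← smul_sub, ← smul_sub, cross_smul_left, cross_smul_right]
      exact smul_ne_zero hμ0.ne' (smul_ne_zero hμ0.ne'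
        (cross_trot_sub_ne_zero (inner_tet_self i) (haxis w hw i)))
  have hface : ∀ i, IsFace K (F i) := by
    intro i
    obtain ⟨a, ha, b, hb, d, hd, habd⟩ := htri i
    refine ⟨fun _ => ⟨-(innerSL ℝ (tet i)), ?_⟩,
      finrank_vectorSpan_eq_two (tet_ne_zero i) (fun x hx => hx.2) ha hb hd habd⟩
    ext x
    constructor
    · rintro ⟨hx, hxi⟩
      refine ⟨hx, fun y hy => ?_⟩
      simp only [neg_apply, innerSL_apply_apply, hxi]
      linarith [mem_tetrahedron_iff.1 (hKT hy) i]
    · rintro ⟨hx, hxi⟩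
      refine ⟨hx, le_antisymm ?_ (mem_tetrahedron_iff.1 (hKT hx) i)⟩
      have := hxi a ha.1
      simp only [neg_apply, innerSL_apply_apply, ha.2] at this
      linarith
  -- Different faces of the tetrahedron contain different faces of the solid.
  have hinj : Function.Injective F := by
    intro i j hij
    by_contra hne
    obtain ⟨a, ha, b, hb, d, hd, habd⟩ := htri i
    have o : ∀ k, F i = F k → (inner ℝ (tet k) (b - a) : ℝ) = 0 ∧
        (inner ℝ (tet k) (d - a) : ℝ) = 0 := by
      intro k hk
      rw [hk] at ha hb hd
      rw [inner_sub_right, inner_sub_right, ha.2, hb.2, hd.2]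
      simp
    have := inner_sq_eq_of_orthogonal habd (o i rfl).1 (o i rfl).2 (o j hij).1 (o j hij).2
    rw [inner_tet_of_ne hne, inner_tet_self, inner_tet_self] at this
    norm_num at this
  -- The solid does not contain the vertices of the tetrahedron, since they are on axes.
  have hproper : K ≠ tetrahedron := by
    intro h
    have h0 : tet 0 ∈ K := by
      rw [h, tetrahedron_eq_convexHull]
      exact subset_convexHull ℝ _ (mem_range_self 0)
    have hsub : K ⊆ {x | (inner ℝ (tet 0) x : ℝ) < 3} := by
      refine convexHull_min (fun w hw => ?_) ?_
      · have a1 := hW'T 1 w hw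
        have a2 := hW'T 2 w hw
        have a3 := hW'T 3 w hw
        rw [inner_tet_one] at a1
        rw [inner_tet_two] at a2
        rw [inner_tet_three] at a3
        by_contra hcon
        rw [mem_ofPred_eq, inner_tet_zero, not_lt] at hcon
        obtain ⟨v, hv, hvw⟩ := hw
        apply haxis v hv 0
        have hc : cross (tet 0) w = 0 := by
          apply ext_coord <;> simp [tet] <;> linarith
        rw [← hvw] at hc
        simp only [cross_smul_right] at hc
        exact (smul_eq_zero.1 hc).resolve_left hμ0.ne'
      · exact convex_halfSpace_lt (f := fun x => (inner ℝ (tet 0) x : ℝ))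
          ⟨fun x y => inner_add_right _ _ _, fun c x => inner_smul_right _ _ _⟩ 3
    have := hsub h0
    rw [mem_ofPred_eq, inner_tet_self] at this
    exact lt_irrefl _ this
  classical
  refine ⟨K, (isSimilar_smul W hμ0.ne').symm, hKT.ssubset_of_ne hproper,
    Finset.univ.image F, ?_, ?_, ?_⟩
  · rw [Finset.card_image_of_injective _ hinj]; simp
  · intro f hf
    obtain ⟨i, -, rfl⟩ := Finset.mem_image.1 hf
    exact hface i
  · ext x
    simp only [mem_inter_iff, mem_iUnion, Finset.mem_image, Finset.mem_univ, true_and,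
      exists_prop]
    constructor
    · rintro ⟨h1, h2⟩
      have hxK : x ∈ K := hKclosed.frontier_subset h1
      obtain ⟨i, hi⟩ := (mem_frontier_tetrahedron_iff (hKT hxK)).1 h2
      exact ⟨F i, ⟨i, rfl⟩, hxK, hi⟩
    · rintro ⟨_, ⟨i, rfl⟩, hxK, hi⟩
      have h2 := (mem_frontier_tetrahedron_iff (hKT hxK)).2 ⟨i, hi⟩
      refine ⟨?_, h2⟩
      rw [hKclosed.frontier_eq]
      rw [isClosed_tetrahedron.frontier_eq] at h2
      exact ⟨hxK, fun h => h2.2 (interior_mono hKT h)⟩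

/-! ### Solids with several axes of order three -/

/-- The rotations of the tetrahedron permute the coordinates cyclically, up to signs. -/
theorem abs_trot_tet (i : Fin 4) {ε : ℝ} (hε : ε = 1 ∨ ε = -1) (y : E3) :
    (∀ j : Fin 3, |trot ε (tet i) y j| = |y (j + 1)|) ∨
      ∀ j : Fin 3, |trot ε (tet i) y j| = |y (j + 2)| := by
  have key : ∀ a b : ℝ, (a = b ∨ a = -b) → |a| = |b| := by
    rintro a b (rfl | rfl)
    · rfl
    · exact abs_neg b
  rcases hε with rfl | rfl
  · right
    intro j
    fin_cases i <;> fin_cases j <;> apply key <;> simp [trot_apply, tet] <;>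
      first | (left; ring1) | (right; ring1)
  · left
    intro j
    fin_cases i <;> fin_cases j <;> apply key <;> simp [trot_apply, tet] <;>
      first | (left; ring1) | (right; ring1)

/-- The coordinates of a point on an axis of order three of the tetrahedron are equal up to signs.
-/
theorem abs_eq_of_cross_tet {i : Fin 4} {w : E3} (h : cross (tet i) w = 0) :
    |w 0| = |w 1| ∧ |w 1| = |w 2| := by
  have h1 := congrArg (fun v : E3 => v 0) h
  have h2 := congrArg (fun v : E3 => v 2) h
  have key : ∀ a b : ℝ, (a = b ∨ a = -b) → |a| = |b| := by
    rintro a b (rfl | rfl)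
    · rfl
    · exact abs_neg b
  fin_cases i <;> simp [tet] at h1 h2 <;> constructor <;> apply key <;>
      first | (left; linarith) | (right; linarith)

theorem finite_of_coord_mem {s : Set ℝ} (hs : s.Finite) : {x : E3 | ∀ i, x i ∈ s}.Finite := by
  refine Set.Finite.of_injOn (f := fun x : E3 => (x : Fin 3 → ℝ)) (t := {f | ∀ i, f i ∈ s})
    (fun x hx => hx) ?_ (Set.Finite.pi' fun _ => hs)
  intro x _ y _ h
  exact PiLp.ext fun i => congrFun h i

/-- The vertices of the octahedron. -/
def octahedronVertices : Set E3 :=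
  {x : E3 | ∃ i : Fin 3, |x i| = 1 ∧ x (i + 1) = 0 ∧ x (i + 2) = 0}

/-- The vertices of the icosahedron. -/
def icosahedronVertices : Set E3 :=
  {x : E3 | ∃ i : Fin 3, x i = 0 ∧ |x (i + 1)| = 1 ∧ |x (i + 2)| = goldenRatio}

theorem admitsFaceEmbedding_octahedron : AdmitsFaceEmbedding 4 octahedron tetrahedron := by
  refine admitsFaceEmbedding_of_tetrahedral (W := octahedronVertices) ?_ ?_ ?_ ?_
  · refine (finite_of_coord_mem (s := {0, 1, -1}) (by simp)).subset ?_
    rintro x ⟨i, h0, h1, h2⟩ j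
    rw [eq_comm] at h0
    have : ∀ c : ℝ, 1 = |c| → c ∈ ({0, 1, -1} : Set ℝ) := fun c hc => by
      rcases eq_or_eq_neg_of_abs_eq hc.symm with h | h <;> simp [h]
    fin_cases i <;> fin_cases j <;> simp at h0 h1 h2 ⊢ <;>
      first | simp [h1] | simp [h2] | simpa using this _ h0
  · exact ⟨!₂[1, 0, 0], 0, by simp⟩
  · rintro w ⟨i, h0, h1, h2⟩ k ε hε
    rw [← abs_eq_zero] at h1 h2
    rcases abs_trot_tet k hε w with h | h
    · refine ⟨i + 2, ?_⟩
      rw [← abs_eq_zero, ← abs_eq_zero (a := trot ε (tet k) w (i + 2 + 2)), h, h, h]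
      fin_cases i <;> exact ⟨h0, h1, h2⟩
    · refine ⟨i + 1, ?_⟩
      rw [← abs_eq_zero, ← abs_eq_zero (a := trot ε (tet k) w (i + 1 + 2)), h, h, h]
      fin_cases i <;> exact ⟨h0, h1, h2⟩
  · rintro w ⟨i, h0, h1, h2⟩ k hk
    obtain ⟨e1, e2⟩ := abs_eq_of_cross_tet hk
    rw [← abs_eq_zero] at h1 h2
    fin_cases i <;> simp only [Fin.isValue, Fin.zero_eta, Fin.mk_one, Fin.reduceFinMk,
      Fin.reduceAdd] at h0 h1 h2 <;> linarith

theorem admitsFaceEmbedding_icosahedron : AdmitsFaceEmbedding 4 icosahedron tetrahedron := by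
  have hg := one_lt_goldenRatio
  refine admitsFaceEmbedding_of_tetrahedral (W := icosahedronVertices) ?_ ?_ ?_ ?_
  · refine (finite_of_coord_mem (s := {0, 1, -1, goldenRatio, -goldenRatio}) (by simp)).subset ?_
    rintro x ⟨i, h0, h1, h2⟩ j
    have a0 : x i ∈ ({0, 1, -1, goldenRatio, -goldenRatio} : Set ℝ) := by rw [h0]; simp
    have a1 : x (i + 1) ∈ ({0, 1, -1, goldenRatio, -goldenRatio} : Set ℝ) := by
      rcases eq_or_eq_neg_of_abs_eq h1 with h | h <;> rw [h] <;> simp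
    have a2 : x (i + 2) ∈ ({0, 1, -1, goldenRatio, -goldenRatio} : Set ℝ) := by
      rcases eq_or_eq_neg_of_abs_eq h2 with h | h <;> rw [h] <;> simp
    fin_cases i <;> fin_cases j <;> assumption
  · exact ⟨!₂[0, 1, goldenRatio], 0, by simp [abs_of_pos goldenRatio_pos]⟩
  · rintro w ⟨i, h0, h1, h2⟩ k ε hε
    rw [← abs_eq_zero] at h0
    rcases abs_trot_tet k hε w with h | h
    · refine ⟨i + 2, ?_⟩
      rw [← abs_eq_zero, h, h, h]
      fin_cases i <;> exact ⟨h0, h1, h2⟩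
    · refine ⟨i + 1, ?_⟩
      rw [← abs_eq_zero, h, h, h]
      fin_cases i <;> exact ⟨h0, h1, h2⟩
  · rintro w ⟨i, h0, h1, h2⟩ k hk
    obtain ⟨e1, e2⟩ := abs_eq_of_cross_tet hk
    rw [← abs_eq_zero] at h0
    fin_cases i <;> simp only [Fin.isValue, Fin.zero_eta, Fin.mk_one, Fin.reduceFinMk,
      Fin.reduceAdd] at h0 h1 h2 <;> linarith

/-- The vertices of the cube are those of two opposite tetrahedra. -/
theorem cubeVertices_eq (x : E3) (hx : x ∈ cubeVertices) :
    ∃ s : ℝ, (s = 1 ∨ s = -1) ∧ ∃ i, x = s • tet i := by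
  have e : x = !₂[x 0, x 1, x 2] := by apply ext_coord <;> simp
  rw [e]
  have p : (1 : ℝ) = 1 ∨ (1 : ℝ) = -1 := Or.inl rfl
  have m : (-1 : ℝ) = 1 ∨ (-1 : ℝ) = -1 := Or.inr rfl
  rcases eq_or_eq_neg_of_abs_eq (hx 0) with a | a <;>
  rcases eq_or_eq_neg_of_abs_eq (hx 1) with b | b <;>
  rcases eq_or_eq_neg_of_abs_eq (hx 2) with c | c <;> rw [a, b, c]
  · exact ⟨1, p, 0, by apply ext_coord <;> simp [tet]⟩
  · exact ⟨-1, m, 3, by apply ext_coord <;> simp [tet]⟩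
  · exact ⟨-1, m, 2, by apply ext_coord <;> simp [tet]⟩
  · exact ⟨1, p, 1, by apply ext_coord <;> simp [tet]⟩
  · exact ⟨-1, m, 1, by apply ext_coord <;> simp [tet]⟩
  · exact ⟨1, p, 2, by apply ext_coord <;> simp [tet]⟩
  · exact ⟨1, p, 3, by apply ext_coord <;> simp [tet]⟩
  · exact ⟨-1, m, 0, by apply ext_coord <;> simp [tet]⟩

theorem tet_mem_cubeVertices (i : Fin 4) : tet i ∈ cubeVertices := by
  intro j
  fin_cases i <;> fin_cases j <;> simp [tet]

/-- An orbit of points on the axes of order three is one of a regular tetrahedron, a cube or a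
regular dodecahedron. Here `Q` is the system of all axes and `A` is the orbit. -/
theorem isPlatonic_of_subset_axes {Q A : Set E3}
    (hQ : Q = cubeVertices ∨ Q = dodecahedronVertices) (hAQ : A ⊆ Q)
    (hrot : ∀ v ∈ Q, ∀ ε : ℝ, (ε = 1 ∨ ε = -1) → ∀ w ∈ A, trot ε v w ∈ A)
    {i₀ : Fin 4} (hi₀ : tet i₀ ∈ A) : IsPlatonic (convexHull ℝ A) := by
  have htet : ∀ i, tet i ∈ Q := fun i => by
    rcases hQ with rfl | rfl
    · exact tet_mem_cubeVertices i
    · exact Or.inl (tet_mem_cubeVertices i)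
  have cyc : ∀ {a b c : ℝ}, (!₂[a, b, c] : E3) ∈ A → (!₂[c, a, b] : E3) ∈ A := fun {a b c} h => by
    rw [← trot_diag]; exact hrot _ (htet 0) 1 (Or.inl rfl) _ h
  -- The half-turn about a coordinate axis is a product of rotations of order three.
  have ev : ∀ {a b c : ℝ}, (!₂[a, b, c] : E3) ∈ A → (!₂[-a, b, -c] : E3) ∈ A := fun {a b c} h => by
    have h1 := hrot _ (htet 1) 1 (Or.inl rfl) _ h
    have h2 : trot 1 (tet 1) !₂[a, b, c] = !₂[-c, -a, b] := by
      apply ext_coord <;> simp [trot_apply, tet] <;> ring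
    rw [h2] at h1
    exact cyc (cyc h1)
  -- The orbit contains all vertices of a tetrahedron once it contains one.
  have orbit : ∀ (s : ℝ) (i : Fin 4), s • tet i ∈ A → ∀ j, s • tet j ∈ A := by
    intro s i hi
    have e0 : s • tet 0 = !₂[s, s, s] := by apply ext_coord <;> simp [tet]
    have e1 : s • tet 1 = !₂[s, -s, -s] := by apply ext_coord <;> simp [tet]
    have e2 : s • tet 2 = !₂[-s, s, -s] := by apply ext_coord <;> simp [tet]
    have e3 : s • tet 3 = !₂[-s, -s, s] := by apply ext_coord <;> simp [tet]
    have h0 : (!₂[s, s, s] : E3) ∈ A := by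
      have of2 : (!₂[-s, s, -s] : E3) ∈ A → (!₂[s, s, s] : E3) ∈ A := fun h => by
        simpa only [neg_neg] using ev h
      fin_cases i
      · exact e0 ▸ hi
      · exact of2 (cyc (e1 ▸ hi))
      · exact of2 (e2 ▸ hi)
      · exact of2 (cyc (cyc (e3 ▸ hi)))
    have h2 := ev h0
    intro j
    fin_cases j
    · exact e0.symm ▸ h0
    · exact e1.symm ▸ cyc (cyc h2)
    · exact e2.symm ▸ h2
    · exact e3.symm ▸ cyc h2
  have htA : ∀ i, tet i ∈ A := fun i => by
    simpa using orbit 1 i₀ (by simpa using hi₀) i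
  have hcube : ∀ i, -tet i ∈ A → cubeVertices ⊆ A := by
    intro i hi x hx
    obtain ⟨s, hs, j, rfl⟩ := cubeVertices_eq x hx
    rcases hs with rfl | rfl
    · simpa using htA j
    · exact orbit (-1) i (by simpa using hi) j
  rcases hQ with rfl | rfl
  -- If the axes form a cube, then the orbit is one tetrahedron or it is the entire cube.
  · by_cases hneg : ∃ i, -tet i ∈ A
    · obtain ⟨i, hi⟩ := hneg
      have hA : A = cubeVertices := Subset.antisymm hAQ (hcube i hi)
      refine Or.inr (Or.inl ?_)
      rw [hA]
      exact ⟨DilationEquiv.refl E3, image_id _⟩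
    · have hA : A = range tet := by
        refine Subset.antisymm (fun x hx => ?_) ?_
        · obtain ⟨s, hs, j, rfl⟩ := cubeVertices_eq x (hAQ hx)
          rcases hs with rfl | rfl
          · exact ⟨j, by simp⟩
          · exact absurd ⟨j, by simpa using hx⟩ hneg
        · rintro _ ⟨j, rfl⟩
          exact htA j
      left
      rw [hA, tetrahedron_eq_convexHull]
      exact ⟨DilationEquiv.refl E3, image_id _⟩
  -- If they form a dodecahedron, then the two rotations about `(0, φ⁻¹, φ)` map `(1, 1, 1)` to a
  -- vertex of the opposite tetrahedron and to `(0, -φ⁻¹, φ)`, which generate all others.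
  · have hg := goldenRatio_sq
    have hgp := goldenRatio_pos
    have hgi : 0 < goldenRatio - 1 := by linarith [one_lt_goldenRatio]
    have hq : (!₂[0, goldenRatio - 1, goldenRatio] : E3) ∈ dodecahedronVertices :=
      Or.inr ⟨0, by simp, by rw [goldenRatio_inv_eq]; simp [abs_of_pos hgi],
        by simp [abs_of_pos hgp]⟩
    have h3 : -tet 1 ∈ A := by
      have := hrot _ hq 1 (Or.inl rfl) _ (htA 0)
      convert this using 1
      apply ext_coord <;> simp [trot_apply, tet]
      · ring
      · linear_combination -hg
      · linear_combination -hg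
    have h4 : (!₂[0, -(goldenRatio - 1), goldenRatio] : E3) ∈ A := by
      have := hrot _ hq (-1) (Or.inr rfl) _ (htA 0)
      convert this using 1
      apply ext_coord <;> simp [trot_apply, tet]
      · linear_combination -hg
      · linear_combination -hg
    have c1 := cyc h4
    have c2 := cyc c1
    have d1 := ev c1
    have d2 := ev c2
    have d0 := cyc d2
    have e0 := ev h4
    have e1 := cyc e0
    have e2 := cyc e1
    have f0 := ev d0
    have f1 := cyc f0
    have f2 := cyc f1
    have d1' := cyc d0
    have d2' := cyc d1'
    have hA : A = dodecahedronVertices := by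
      refine Subset.antisymm hAQ ?_
      rintro x (hx | ⟨i, hx⟩)
      · exact hcube 1 h3 hx
      have e : x = !₂[x 0, x 1, x 2] := by apply ext_coord <;> simp
      rw [e]
      rw [goldenRatio_inv_eq] at hx
      obtain ⟨hx0, hx1, hx2⟩ := hx
      simp only [neg_zero, neg_neg] at *
      fin_cases i <;> simp only [Fin.isValue, Fin.zero_eta, Fin.mk_one, Fin.reduceFinMk, zero_add,
        Fin.reduceAdd] at hx0 hx1 hx2 <;>
      rcases eq_or_eq_neg_of_abs_eq hx1 with b | b <;>
      rcases eq_or_eq_neg_of_abs_eq hx2 with c | c <;> rw [hx0, b, c] <;> assumption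
    refine Or.inr (Or.inr (Or.inr (Or.inl ?_)))
    rw [hA]
    exact ⟨DilationEquiv.refl E3, image_id _⟩

theorem IsPlatonic.congr {A B : Set E3} (h : IsSimilar A B) (hB : IsPlatonic B) :
    IsPlatonic A := by
  rcases hB with h' | h' | h' | h' | h'
  · exact Or.inl (h.trans h')
  · exact Or.inr (Or.inl (h.trans h'))
  · exact Or.inr (Or.inr (Or.inl (h.trans h')))
  · exact Or.inr (Or.inr (Or.inr (Or.inl (h.trans h'))))
  · exact Or.inr (Or.inr (Or.inr (Or.inr (h.trans h'))))

/-- A vertex-transitive solid with several axes of order three is Platonic if one of these axes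
passes through a vertex, and otherwise it admits an embedding in the tetrahedron. -/
theorem admitsFaceEmbedding_or_isPlatonic {W : Set E3} (hfin : W.Finite)
    (hsolid : (interior (convexHull ℝ W)).Nonempty)
    (htrans : ∀ x ∈ W, ∀ y ∈ W, ∃ g ∈ symmetryGroup W, g x = y)
    (hax : ∃ x ∈ axes (symmetryGroup W), ∃ y ∈ axes (symmetryGroup W), y ≠ x ∧ y ≠ -x) :
    AdmitsFaceEmbedding 4 (convexHull ℝ W) tetrahedron ∨ IsPlatonic (convexHull ℝ W) := by
  obtain ⟨φ, hφ⟩ := (isAxisSystem_axes (finite_symmetryGroup hfin hsolid)).exists_image_eq hax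
  set Q := φ '' axes (symmetryGroup W) with hQ
  set W₁ := φ '' W with hW₁
  have hsim : IsSimilar (convexHull ℝ W) (convexHull ℝ W₁) := by
    have := isSimilar_convexHull_image W 0 one_ne_zero φ
    simpa using this
  have htet : ∀ i, tet i ∈ Q := fun i => by
    rcases hφ with h | h <;> rw [h]
    · exact tet_mem_cubeVertices i
    · exact Or.inl (tet_mem_cubeVertices i)
  have hrot : ∀ v ∈ Q, ∀ ε : ℝ, (ε = 1 ∨ ε = -1) → ∀ w ∈ W₁, trot ε v w ∈ W₁ := by
    have h1 : ∀ v ∈ axes (symmetryGroup W), ∀ ε : ℝ, (ε = 1 ∨ ε = -1) → ∀ w ∈ W,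
        trot ε v w ∈ W := by
      rintro v hv ε hε w hw
      rcases hε with rfl | rfl
      · obtain ⟨-, g, hg, h⟩ := hv
        rw [← h]
        exact map_mem_of_symmetry hg hw
      · obtain ⟨-, g, hg, h⟩ := neg_mem_axes hv
        rw [← trot_neg_axis, ← h]
        exact map_mem_of_symmetry hg hw
    rintro _ ⟨v, hv, rfl⟩ ε hε _ ⟨w, hw, rfl⟩
    obtain ⟨δ, hδ, hcr⟩ := exists_map_cross φ
    refine ⟨trot (δ * ε) v w, h1 v hv _ ?_ w hw, ?_⟩
    · rcases hε with rfl | rfl <;> rcases hδ with rfl | rfl <;> norm_num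
    · rw [map_trot φ hcr hδ]
      congr 1
      rcases hδ with rfl | rfl <;> ring
  have hne : W.Nonempty := by
    rw [← convexHull_nonempty_iff (𝕜 := ℝ)]
    exact hsolid.mono interior_subset
  by_cases haxis : ∀ w ∈ W₁, ∀ i, cross (tet i) w ≠ 0
  · left
    exact (admitsFaceEmbedding_of_tetrahedral (hfin.image φ) (hne.image φ)
      (fun w hw i ε hε => hrot _ (htet i) ε hε w hw) haxis).congr hsim
  · right
    push Not at haxis
    obtain ⟨_, ⟨w, hw, rfl⟩, i, hi⟩ := haxis
    -- A vertex on an axis is a multiple of a point of `Q`. By transitivity all vertices are, with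
    -- the same factor, so that the solid is spanned by a scaled orbit in `Q`.
    set μ : ℝ := inner ℝ (tet i) (φ w) / 3 with hμ
    have hwi : φ w = μ • tet i := by
      have h1 := cross_cross (tet i) (tet i) (φ w)
      rw [hi, inner_tet_self, show cross (tet i) 0 = 0 by apply ext_coord <;> simp] at h1
      have h2 : (3 : ℝ) • φ w = (inner ℝ (tet i) (φ w) : ℝ) • tet i := (sub_eq_zero.1 h1.symm).symm
      rw [hμ, div_eq_inv_mul, mul_smul, ← h2, smul_smul]
      norm_num
    have hμ0 : μ ≠ 0 := by
      intro h0
      rw [h0, zero_smul] at hwi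
      have hw0 : w = 0 := φ.injective (by rw [hwi, map_zero])
      obtain ⟨y, hy, hy0⟩ := exists_inner_ne hsolid (u := tet 0) (tet_ne_zero 0) 0
      obtain ⟨g, -, hg⟩ := htrans w hw y hy
      rw [hw0, map_zero] at hg
      rw [← hg, inner_zero_right] at hy0
      exact hy0 rfl
    set A : Set E3 := {v | μ • v ∈ W₁} with hA
    have hW₁A : W₁ = (fun x => μ • x) '' A := by
      ext x
      constructor
      · intro hx
        refine ⟨μ⁻¹ • x, ?_, ?_⟩
        · rw [hA, mem_ofPred_eq, smul_smul, mul_inv_cancel₀ hμ0, one_smul]; exact hx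
        · simp [smul_smul, hμ0]
      · rintro ⟨v, hv, rfl⟩
        exact hv
    have hAQ : A ⊆ Q := by
      intro v hv
      obtain ⟨y, hy, hyv⟩ := hv
      obtain ⟨g, hg, hgy⟩ := htrans w hw y hy
      obtain ⟨a, ha, hai⟩ := htet i
      refine ⟨g a, map_mem_axes ha hg, ?_⟩
      have h1 : w = μ • a := φ.injective (by rw [hwi, map_smul, hai])
      have h2 : μ • φ (g a) = μ • v := by
        rw [← hyv, ← hgy, h1, map_smul, map_smul]
      exact smul_right_injective E3 hμ0 h2
    refine IsPlatonic.congr (hsim.trans ?_) (isPlatonic_of_subset_axes hφ hAQ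
      (fun v hv ε hε w hw => ?_) (i₀ := i) ⟨w, hw, hwi⟩)
    · rw [hW₁A]
      exact isSimilar_smul A hμ0
    · change μ • trot ε v w ∈ W₁
      rw [← trot_smul]
      exact hrot v hv ε hε _ hw

/-! ### Regular polygons as faces -/

/-- The `k`-th vertex of the regular `n`-gon with center `c` that is spanned by `u` and `w`. -/
def ngon (n : ℕ) (c u w : E3) (k : ℕ) : E3 :=
  c + cos (2 * π * k / n) • u + sin (2 * π * k / n) • w

/-- `X` is the set of the vertices of a regular polygon. -/
def IsNgon (X : Set E3) : Prop :=
  ∃ n : ℕ, 3 ≤ n ∧ ∃ c u w : E3, u ≠ 0 ∧ ‖u‖ = ‖w‖ ∧ inner ℝ u w = (0 : ℝ) ∧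
    X = range fun k : Fin n => ngon n c u w k

/-- The square of the distance of two points. -/
def sqDist (x y : E3) : ℝ := inner ℝ (x - y) (x - y)

theorem sqDist_comm (x y : E3) : sqDist x y = sqDist y x := by
  simp only [sqDist, inner_eq, PiLp.sub_apply]; ring

theorem sqDist_pos {x y : E3} (h : x ≠ y) : 0 < sqDist x y :=
  real_inner_self_pos.2 (sub_ne_zero.2 h)

theorem sqDist_ngon {c u w : E3} (hn : ‖u‖ = ‖w‖) (ho : inner ℝ u w = (0 : ℝ)) (n i j : ℕ) :
    sqDist (ngon n c u w i) (ngon n c u w j) =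
      2 * inner ℝ u u * (1 - cos (2 * π * i / n - 2 * π * j / n)) := by
  have hw : (inner ℝ w w : ℝ) = inner ℝ u u := by
    rw [real_inner_self_eq_norm_sq, real_inner_self_eq_norm_sq, hn]
  have hwu : (inner ℝ w u : ℝ) = 0 := by rw [real_inner_comm]; exact ho
  rw [cos_sub]
  set a := 2 * π * i / n
  set b := 2 * π * j / n
  have : ngon n c u w i - ngon n c u w j = (cos a - cos b) • u + (sin a - sin b) • w := by
    simp only [ngon]; module
  rw [sqDist, this]
  simp only [inner_add_left, inner_add_right, inner_smul_left, inner_smul_right,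
    RCLike.conj_to_real, hw, ho, hwu]
  linear_combination inner ℝ u u * (sin_sq_add_cos_sq a + sin_sq_add_cos_sq b)

theorem ngon_injective {c u w : E3} (hu : u ≠ 0) (hn : ‖u‖ = ‖w‖) (ho : inner ℝ u w = (0 : ℝ))
    {n : ℕ} (h0 : 0 < n) : Function.Injective fun k : Fin n => ngon n c u w k := by
  intro i j hij
  have h := sqDist_ngon (c := c) hn ho n i j
  simp only at hij
  rw [hij, sqDist, sub_self, inner_zero_left] at h
  have hpos : 0 < (inner ℝ u u : ℝ) := real_inner_self_pos.2 hu
  have h1 : cos (2 * π * i / n - 2 * π * j / n) = 1 := by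
    rcases mul_eq_zero.1 h.symm with h | h <;> linarith
  have hn0 : (0 : ℝ) < n := by exact_mod_cast h0
  have hi : ((i : ℕ) : ℝ) < n := by exact_mod_cast i.2
  have hj : ((j : ℕ) : ℝ) < n := by exact_mod_cast j.2
  have hi0 : (0 : ℝ) ≤ (i : ℕ) := Nat.cast_nonneg _
  have hj0 : (0 : ℝ) ≤ (j : ℕ) := Nat.cast_nonneg _
  have e : 2 * π * i / n - 2 * π * j / n = 2 * π * ((i - j : ℝ) / n) := by ring
  have hp := pi_pos
  have l1 : -1 < (i - j : ℝ) / n := by rw [lt_div_iff₀ hn0]; linarith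
  have l2 : (i - j : ℝ) / n < 1 := by rw [div_lt_iff₀ hn0]; linarith
  rw [e] at h1
  have h2 := (cos_eq_one_iff_of_lt_of_lt (by nlinarith) (by nlinarith)).1 h1
  have h3 : (i - j : ℝ) / n = 0 := by
    rcases mul_eq_zero.1 h2 with h | h
    · linarith
    · exact h
  have h4 : (i : ℝ) = j := by
    rcases div_eq_zero_iff.1 h3 with h | h <;> linarith
  exact Fin.ext (by exact_mod_cast h4)

/-- Points of a sphere are the extreme points of their convex hull. -/
theorem extremePoints_convexHull_of_sphere {A : Set E3} {c : E3} {r : ℝ} (hr : r ≠ 0)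
    (hA : A ⊆ Metric.sphere c r) : (convexHull ℝ A).extremePoints ℝ = A := by
  refine Subset.antisymm extremePoints_convexHull_subset fun x hx => ?_
  have hsub : convexHull ℝ A ⊆ Metric.closedBall c r :=
    convexHull_min (hA.trans Metric.sphere_subset_closedBall) (convex_closedBall c r)
  refine inter_extremePoints_subset_extremePoints_of_subset hsub
    ⟨subset_convexHull ℝ A hx, ?_⟩
  exact StrictConvexSpace.sphere_subset_extremePoints_closedBall c hr (hA hx)

theorem ngon_mem_sphere {c u w : E3} (hn : ‖u‖ = ‖w‖) (ho : inner ℝ u w = (0 : ℝ)) (n k : ℕ) :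
    ngon n c u w k ∈ Metric.sphere c ‖u‖ := by
  rw [mem_sphere_iff_norm, ngon, add_assoc, add_sub_cancel_left]
  set a := 2 * π * k / n
  have hw : (inner ℝ w w : ℝ) = inner ℝ u u := by
    rw [real_inner_self_eq_norm_sq, real_inner_self_eq_norm_sq, hn]
  have hwu : (inner ℝ w u : ℝ) = 0 := by rw [real_inner_comm]; exact ho
  have h : ‖cos a • u + sin a • w‖ ^ 2 = ‖u‖ ^ 2 := by
    rw [← real_inner_self_eq_norm_sq, ← real_inner_self_eq_norm_sq]
    simp only [inner_add_left, inner_add_right, inner_smul_left, inner_smul_right,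
      RCLike.conj_to_real, hw, ho, hwu]
    linear_combination inner ℝ u u * sin_sq_add_cos_sq a
  exact (sq_eq_sq₀ (norm_nonneg _) (norm_nonneg _)).1 h

/-- The points of `W` on a supporting plane of its hull lie on the face of the hull. -/
theorem sep_convexHull_eq {W : Set E3} {u : E3} {k : ℝ} (hk : ∀ w ∈ W, (inner ℝ u w : ℝ) ≤ k) :
    {x ∈ convexHull ℝ W | (inner ℝ u x : ℝ) = k} =
      convexHull ℝ {w ∈ W | (inner ℝ u w : ℝ) = k} := by
  apply Subset.antisymm
  · have hsub : convexHull ℝ W ⊆ {x | (inner ℝ u x : ℝ) ≤ k ∧ ((inner ℝ u x : ℝ) = k →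
        x ∈ convexHull ℝ {w ∈ W | (inner ℝ u w : ℝ) = k})} := by
      refine convexHull_min (fun w hw => ⟨hk w hw, fun h => subset_convexHull ℝ _ ⟨hw, h⟩⟩) ?_
      rintro x ⟨hx, hx'⟩ y ⟨hy, hy'⟩ a b ha hb hab
      rw [mem_ofPred_eq, inner_add_right, inner_smul_right, inner_smul_right]
      have h0 : a * k + b * k = k := by rw [← add_mul, hab, one_mul]
      refine ⟨by linarith [mul_le_mul_of_nonneg_left hx ha, mul_le_mul_of_nonneg_left hy hb],
        fun h => ?_⟩
      rcases ha.eq_or_lt with rfl | ha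
      · obtain rfl : b = 1 := by linarith
        simpa using hy' (by linarith)
      rcases hb.eq_or_lt with rfl | hb
      · obtain rfl : a = 1 := by linarith
        simpa using hx' (by linarith)
      refine convex_convexHull ℝ _ (hx' ?_) (hy' ?_) ha.le hb.le hab
      · refine le_antisymm hx ?_
        by_contra hlt
        have h1 := mul_lt_mul_of_pos_left (not_le.1 hlt) ha
        have h2 := mul_le_mul_of_nonneg_left hy hb.le
        linarith
      · refine le_antisymm hy ?_
        by_contra hlt
        have h1 := mul_lt_mul_of_pos_left (not_le.1 hlt) hb
        have h2 := mul_le_mul_of_nonneg_left hx ha.le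
        linarith
    rintro x ⟨hx, hxk⟩
    exact (hsub hx).2 hxk
  · refine convexHull_min (fun w hw => ⟨subset_convexHull ℝ W hw.1, hw.2⟩) ?_
    intro x hx y hy a b ha hb hab
    refine ⟨convex_convexHull ℝ W hx.1 hy.1 ha hb hab, ?_⟩
    rw [inner_add_right, inner_smul_right, inner_smul_right, hx.2, hy.2, ← add_mul, hab, one_mul]

/-- In a solid with regular faces, inscribed in a sphere, the vertices on a supporting plane form a
regular polygon as soon as three of them are not collinear. -/
theorem isNgon_of_regular_faces {c : E3} {W : Set E3} {R : ℝ}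
    (hreg : ∀ F, IsFace (convexHull ℝ ((fun x => c + x) '' W)) F → IsRegularPolygon F)
    (hR : ∀ w ∈ W, ‖w‖ = R) {u : E3} (hu : u ≠ 0) {k : ℝ}
    (hk : ∀ w ∈ W, (inner ℝ u w : ℝ) ≤ k) {a b d : E3} (ha : a ∈ W) (hb : b ∈ W) (hd : d ∈ W)
    (hak : (inner ℝ u a : ℝ) = k) (hbk : (inner ℝ u b : ℝ) = k) (hdk : (inner ℝ u d : ℝ) = k)
    (hcross : cross (b - a) (d - a) ≠ 0) : IsNgon {w ∈ W | (inner ℝ u w : ℝ) = k} := by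
  have hR0 : R ≠ 0 := by
    rintro rfl
    rw [norm_eq_zero.1 (hR a ha), norm_eq_zero.1 (hR b hb), sub_self] at hcross
    exact hcross (by apply ext_coord <;> simp)
  set S := convexHull ℝ ((fun x => c + x) '' W) with hS
  set k' : ℝ := inner ℝ u c + k with hk'
  set X : Set E3 := {w ∈ W | (inner ℝ u w : ℝ) = k} with hX
  have hle : ∀ y ∈ (fun x => c + x) '' W, (inner ℝ u y : ℝ) ≤ k' := by
    rintro _ ⟨w, hw, rfl⟩
    rw [inner_add_right]
    linarith [hk w hw]
  have hleS : ∀ y ∈ S, (inner ℝ u y : ℝ) ≤ k' := by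
    have : S ⊆ {y | (inner ℝ u y : ℝ) ≤ k'} := convexHull_min hle
      (convex_halfSpace_le (f := fun y => (inner ℝ u y : ℝ))
        ⟨fun x y => inner_add_right _ _ _, fun s x => inner_smul_right _ _ _⟩ k')
    exact this
  set F : Set E3 := {x ∈ S | (inner ℝ u x : ℝ) = k'} with hF
  have mem : ∀ w ∈ W, (inner ℝ u w : ℝ) = k → c + w ∈ F := fun w hw h =>
    ⟨subset_convexHull ℝ _ ⟨w, hw, rfl⟩, by rw [inner_add_right, h]⟩
  have hface : IsFace S F := by
    refine ⟨fun _ => ⟨innerSL ℝ u, ?_⟩, finrank_vectorSpan_eq_two hu (fun x hx => hx.2)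
      (mem a ha hak) (mem b hb hbk) (mem d hd hdk) (by simpa using hcross)⟩
    ext x
    constructor
    · rintro ⟨hx, hxk⟩
      refine ⟨hx, fun y hy => ?_⟩
      simp only [innerSL_apply_apply, hxk]
      exact hleS y hy
    · rintro ⟨hx, hxk⟩
      refine ⟨hx, le_antisymm (hleS x hx) ?_⟩
      have := hxk _ (mem a ha hak).1
      simp only [innerSL_apply_apply] at this
      rwa [(mem a ha hak).2] at this
  have hF2 : F = convexHull ℝ ((fun x => c + x) '' X) := by
    rw [hF, hS, sep_convexHull_eq hle]
    congr 1
    ext y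
    constructor
    · rintro ⟨⟨w, hw, rfl⟩, h⟩
      rw [inner_add_right] at h
      exact ⟨w, ⟨hw, by linarith⟩, rfl⟩
    · rintro ⟨w, ⟨hw, h⟩, rfl⟩
      exact ⟨⟨w, hw, rfl⟩, by rw [inner_add_right, h]⟩
  obtain ⟨n, hn, c', u', w', hu', hnorm, horth, hFn⟩ := hreg F hface
  -- The vertices of the regular polygon and those of the face are both the extreme points of the
  -- same set, as both lie on spheres.
  have e1 : F.extremePoints ℝ = (fun x => c + x) '' X := by
    rw [hF2]
    refine extremePoints_convexHull_of_sphere (c := c) (r := R) hR0 ?_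
    rintro _ ⟨w, hw, rfl⟩
    rw [mem_sphere_iff_norm, add_sub_cancel_left, hR w hw.1]
  have e2 : F.extremePoints ℝ = range fun k : Fin n => ngon n c' u' w' k := by
    rw [hFn]
    refine extremePoints_convexHull_of_sphere (c := c') (norm_ne_zero_iff.2 hu') ?_
    rintro _ ⟨k, rfl⟩
    exact ngon_mem_sphere hnorm horth n k
  refine ⟨n, hn, c' - c, u', w', hu', hnorm, horth, ?_⟩
  have e3 : X = (fun x => x - c) '' ((fun x => c + x) '' X) := by
    rw [← image_comp]; simp
  rw [e3, ← e1, e2, ← range_comp]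
  congr 1
  ext k : 1
  simp only [Function.comp_apply, ngon]
  abel

theorem cos_two_pi_div_three : cos (2 * π / 3) = -1 / 2 := by
  rw [show 2 * π / 3 = π - π / 3 by ring, cos_pi_sub, cos_pi_div_three]; ring

theorem IsNgon.equilateral {a b d : E3} (h : IsNgon {a, b, d}) (hab : a ≠ b) (had : a ≠ d)
    (hbd : b ≠ d) : sqDist a b = sqDist a d ∧ sqDist a b = sqDist b d := by
  obtain ⟨n, hn, c, u, w, hu, hnorm, horth, hX⟩ := h
  have hcard : n = 3 := by
    have h1 : ({a, b, d} : Set E3).ncard = 3 := ncard_eq_three.2 ⟨a, b, d, hab, had, hbd, rfl⟩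
    rw [hX, ← image_univ, ncard_image_of_injective _ (ngon_injective hu hnorm horth (by omega)),
      ncard_univ, Nat.card_eq_fintype_card, Fintype.card_fin] at h1
    exact h1
  subst hcard
  have key : ∀ x ∈ ({a, b, d} : Set E3), ∀ y ∈ ({a, b, d} : Set E3), x ≠ y →
      sqDist x y = 3 * inner ℝ u u := by
    rw [hX]
    rintro _ ⟨i, rfl⟩ _ ⟨j, rfl⟩ hij
    have hne : i ≠ j := fun h => hij (by rw [h])
    have h1 := cos_two_pi_div_three
    have h2 : cos (2 * π * 2 / 3) = -1 / 2 := by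
      rw [show 2 * π * 2 / 3 = 2 * π - 2 * π / 3 by ring, cos_two_pi_sub, h1]
    rw [sqDist_ngon hnorm horth]
    revert hne
    clear hij
    have h3 : cos (2 * π / 3 - 2 * π * 2 / 3) = -1 / 2 := by
      rw [show 2 * π / 3 - 2 * π * 2 / 3 = -(2 * π / 3) by ring, cos_neg, h1]
    have h4 : cos (2 * π * 2 / 3 - 2 * π / 3) = -1 / 2 := by
      rw [show 2 * π * 2 / 3 - 2 * π / 3 = 2 * π / 3 by ring, h1]
    fin_cases i <;> fin_cases j <;> intro hne <;> first | exact absurd rfl hne | skip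
    all_goals simp only [Nat.cast_zero, Nat.cast_one, Nat.cast_ofNat, mul_zero, zero_div, mul_one,
        zero_sub, sub_zero, cos_neg, h1, h2, h3, h4]; ring
  rw [key a (by simp) b (by simp) hab, key a (by simp) d (by simp) had,
    key b (by simp) d (by simp) hbd]
  exact ⟨rfl, rfl⟩

/-- Two vertices of a square are the ends of a side or of a diagonal. -/
theorem IsNgon.sqDist_of_four {a b d f : E3} (h : IsNgon {a, b, d, f}) (hab : a ≠ b) (had : a ≠ d)
    (haf : a ≠ f) (hbd : b ≠ d) (hbf : b ≠ f) (hdf : d ≠ f) : ∃ r : ℝ, 0 < r ∧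
    ∀ x ∈ ({a, b, d, f} : Set E3), ∀ y ∈ ({a, b, d, f} : Set E3), x ≠ y →
      sqDist x y = r ∨ sqDist x y = 2 * r := by
  obtain ⟨n, hn, c, u, w, hu, hnorm, horth, hX⟩ := h
  have hcard : n = 4 := by
    have h1 : ({a, b, d, f} : Set E3).ncard = 4 := by
      rw [ncard_insert_of_notMem (by simp [hab, had, haf]),
        ncard_eq_three.2 ⟨b, d, f, hbd, hbf, hdf, rfl⟩]
    rw [hX, ← image_univ, ncard_image_of_injective _ (ngon_injective hu hnorm horth (by omega)),
      ncard_univ, Nat.card_eq_fintype_card, Fintype.card_fin] at h1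
    exact h1
  subst hcard
  refine ⟨2 * inner ℝ u u, mul_pos two_pos (real_inner_self_pos.2 hu), ?_⟩
  rw [hX]
  rintro _ ⟨i, rfl⟩ _ ⟨j, rfl⟩ hij
  have hne : i ≠ j := fun h => hij (by rw [h])
  have h1 : cos (π / 2) = 0 := cos_pi_div_two
  have h2 : cos π = -1 := cos_pi
  have h3 : cos (3 * π / 2) = 0 := by
    rw [show 3 * π / 2 = π + π / 2 by ring, cos_add]; simp
  rw [sqDist_ngon hnorm horth]
  have key : ∀ m : ℝ, cos (m * (π / 2)) = 0 ∨ cos (m * (π / 2)) = -1 →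
      2 * inner ℝ u u * (1 - cos (m * (π / 2))) = 2 * inner ℝ u u ∨
      2 * inner ℝ u u * (1 - cos (m * (π / 2))) = 2 * (2 * inner ℝ u u) := by
    rintro m (h | h) <;> rw [h]
    · left; ring
    · right; ring
  have e : 2 * π * ((i : ℕ) : ℝ) / ((4 : ℕ) : ℝ) - 2 * π * ((j : ℕ) : ℝ) / ((4 : ℕ) : ℝ) =
      (((i : ℕ) : ℝ) - (j : ℕ)) * (π / 2) := by push_cast; ring
  rw [e]
  apply key
  clear hij e
  have k1 : cos (1 * (π / 2)) = 0 := by rw [one_mul, h1]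
  have k2 : cos (2 * (π / 2)) = -1 := by rw [mul_div_cancel₀ _ two_ne_zero, h2]
  have k3 : cos (3 * (π / 2)) = 0 := by rw [← mul_div_assoc, h3]
  have kn : ∀ m : ℝ, cos (-m * (π / 2)) = cos (m * (π / 2)) := fun m => by
    rw [neg_mul, cos_neg]
  revert hne
  fin_cases i <;> fin_cases j <;> intro hne <;> first | exact absurd rfl hne | skip
  all_goals norm_num [kn] <;> norm_num [h1, h2, h3, neg_div, cos_neg, mul_div_assoc] at * <;> simp_all

/-- Three different points of a sphere are not collinear. -/
theorem cross_ne_zero_of_norm_eq {a b d : E3} {R : ℝ} (ha : ‖a‖ = R) (hb : ‖b‖ = R) (hd : ‖d‖ = R)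
    (hab : a ≠ b) (had : a ≠ d) (hbd : b ≠ d) : cross (b - a) (d - a) ≠ 0 := by
  intro h
  set x := b - a with hx
  set y := d - a with hy
  have hx0 : x ≠ 0 := sub_ne_zero.2 hab.symm
  have hxx : 0 < (inner ℝ x x : ℝ) := real_inner_self_pos.2 hx0
  have h1 := cross_cross x x y
  rw [h, show cross x 0 = 0 by apply ext_coord <;> simp] at h1
  have h2 : (inner ℝ x x : ℝ) • y = (inner ℝ x y : ℝ) • x := (sub_eq_zero.1 h1.symm).symm
  obtain ⟨s, hs⟩ : ∃ s : ℝ, y = s • x := by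
    refine ⟨inner ℝ x y / inner ℝ x x, ?_⟩
    rw [div_eq_inv_mul, mul_smul, ← h2, smul_smul, inv_mul_cancel₀ hxx.ne', one_smul]
  have sph : ∀ v : E3, ‖a + v‖ = R → 2 * inner ℝ a v + (inner ℝ v v : ℝ) = 0 := by
    intro v hv
    have h3 : (inner ℝ (a + v) (a + v) : ℝ) = inner ℝ a a := by
      rw [real_inner_self_eq_norm_sq, real_inner_self_eq_norm_sq, hv, ha]
    rw [inner_add_left, inner_add_right, inner_add_right, real_inner_comm a v] at h3
    linarith
  have s1 := sph x (by rw [hx, add_sub_cancel, hb])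
  have s2 := sph y (by rw [hy, add_sub_cancel, hd])
  rw [hs, inner_smul_right, inner_smul_left, inner_smul_right, RCLike.conj_to_real] at s2
  have h3 : inner ℝ x x * (s * (s - 1)) = (0 : ℝ) := by linear_combination s2 - s * s1
  rcases mul_eq_zero.1 h3 with h | h
  · exact hxx.ne' h
  · rcases mul_eq_zero.1 h with h | h
    · rw [h, zero_smul] at hs
      exact had (sub_eq_zero.1 hs).symm
    · rw [show s = 1 by linarith, one_smul] at hs
      exact hbd (sub_left_injective hs).symm

theorem sqDist_map (φ : E3 ≃ₗᵢ[ℝ] E3) (x y : E3) : sqDist (φ x) (φ y) = sqDist x y := by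
  rw [sqDist, sqDist, ← map_sub, LinearIsometryEquiv.inner_map_map]

/-- The vertices on a supporting plane form a regular polygon, for a polyhedron that is given up to
a linear isometry. -/
theorem isNgon_image_of_regular_faces {c : E3} {W : Set E3} {R : ℝ} (φ : E3 ≃ₗᵢ[ℝ] E3)
    (hreg : ∀ F, IsFace (convexHull ℝ ((fun x => c + x) '' (φ '' W))) F → IsRegularPolygon F)
    (hR : ∀ w ∈ W, ‖w‖ = R) {u : E3} (hu : u ≠ 0) {k : ℝ}
    (hk : ∀ w ∈ W, (inner ℝ u w : ℝ) ≤ k) {a b d : E3}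
    (ha : a ∈ {w ∈ W | (inner ℝ u w : ℝ) = k}) (hb : b ∈ {w ∈ W | (inner ℝ u w : ℝ) = k})
    (hd : d ∈ {w ∈ W | (inner ℝ u w : ℝ) = k}) (hab : a ≠ b) (had : a ≠ d) (hbd : b ≠ d) :
    IsNgon (φ '' {w ∈ W | (inner ℝ u w : ℝ) = k}) := by
  have hR' : ∀ w ∈ φ '' W, ‖w‖ = R := by
    rintro _ ⟨w, hw, rfl⟩
    rw [LinearIsometryEquiv.norm_map, hR w hw]
  have hk' : ∀ w ∈ φ '' W, (inner ℝ (φ u) w : ℝ) ≤ k := by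
    rintro _ ⟨w, hw, rfl⟩
    rw [LinearIsometryEquiv.inner_map_map]
    exact hk w hw
  have hi := φ.injective
  have main := isNgon_of_regular_faces hreg hR' ((map_ne_zero_iff φ hi).2 hu) hk'
    (mem_image_of_mem φ ha.1) (mem_image_of_mem φ hb.1) (mem_image_of_mem φ hd.1)
    (by rw [LinearIsometryEquiv.inner_map_map, ha.2])
    (by rw [LinearIsometryEquiv.inner_map_map, hb.2])
    (by rw [LinearIsometryEquiv.inner_map_map, hd.2])
    (cross_ne_zero_of_norm_eq (hR' _ (mem_image_of_mem φ ha.1)) (hR' _ (mem_image_of_mem φ hb.1))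
      (hR' _ (mem_image_of_mem φ hd.1)) (hi.ne hab) (hi.ne had) (hi.ne hbd))
  convert main using 1
  ext y
  constructor
  · rintro ⟨w, hw, rfl⟩
    exact ⟨mem_image_of_mem φ hw.1, by rw [LinearIsometryEquiv.inner_map_map, hw.2]⟩
  · rintro ⟨⟨w, hw, rfl⟩, h⟩
    rw [LinearIsometryEquiv.inner_map_map] at h
    exact ⟨w, ⟨hw, h⟩, rfl⟩

theorem equilateral_of_facet {c : E3} {W : Set E3} {R : ℝ} (φ : E3 ≃ₗᵢ[ℝ] E3)
    (hreg : ∀ F, IsFace (convexHull ℝ ((fun x => c + x) '' (φ '' W))) F → IsRegularPolygon F)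
    (hR : ∀ w ∈ W, ‖w‖ = R) {u : E3} (hu : u ≠ 0) {k : ℝ}
    (hk : ∀ w ∈ W, (inner ℝ u w : ℝ) ≤ k) {a b d : E3}
    (hset : {w ∈ W | (inner ℝ u w : ℝ) = k} = {a, b, d})
    (hab : a ≠ b) (had : a ≠ d) (hbd : b ≠ d) :
    sqDist a b = sqDist a d ∧ sqDist a b = sqDist b d := by
  have h := isNgon_image_of_regular_faces φ hreg hR hu hk (a := a) (b := b) (d := d)
    (by simp [hset]) (by simp [hset]) (by simp [hset]) hab had hbd
  rw [hset, image_insert_eq, image_pair] at h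
  have := h.equilateral (φ.injective.ne hab) (φ.injective.ne had) (φ.injective.ne hbd)
  simpa only [sqDist_map] using this

theorem sqDist_of_facet_of_four {c : E3} {W : Set E3} {R : ℝ} (φ : E3 ≃ₗᵢ[ℝ] E3)
    (hreg : ∀ F, IsFace (convexHull ℝ ((fun x => c + x) '' (φ '' W))) F → IsRegularPolygon F)
    (hR : ∀ w ∈ W, ‖w‖ = R) {u : E3} (hu : u ≠ 0) {k : ℝ}
    (hk : ∀ w ∈ W, (inner ℝ u w : ℝ) ≤ k) {a b d f : E3}
    (hset : {w ∈ W | (inner ℝ u w : ℝ) = k} = {a, b, d, f}) (hab : a ≠ b) (had : a ≠ d)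
    (haf : a ≠ f) (hbd : b ≠ d) (hbf : b ≠ f) (hdf : d ≠ f) : ∃ r : ℝ, 0 < r ∧
    ∀ x ∈ ({a, b, d, f} : Set E3), ∀ y ∈ ({a, b, d, f} : Set E3), x ≠ y →
      sqDist x y = r ∨ sqDist x y = 2 * r := by
  have h := isNgon_image_of_regular_faces φ hreg hR hu hk (a := a) (b := b) (d := d)
    (by simp [hset]) (by simp [hset]) (by simp [hset]) hab had hbd
  rw [hset, image_insert_eq, image_insert_eq, image_pair] at h
  have hi := φ.injective
  obtain ⟨r, hr, key⟩ := h.sqDist_of_four (hi.ne hab) (hi.ne had) (hi.ne haf) (hi.ne hbd)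
    (hi.ne hbf) (hi.ne hdf)
  refine ⟨r, hr, fun x hx y hy hxy => ?_⟩
  have hmem : ∀ x ∈ ({a, b, d, f} : Set E3), φ x ∈ ({φ a, φ b, φ d, φ f} : Set E3) := by
    rintro x (rfl | rfl | rfl | rfl) <;> simp
  have := key _ (hmem x hx) _ (hmem y hy) (hi.ne hxy)
  simpa only [sqDist_map] using this

/-! ### Solids with four vertices -/

theorem exists_ne_zero_orthogonal (x y : E3) :
    ∃ u : E3, u ≠ 0 ∧ (inner ℝ u x : ℝ) = 0 ∧ (inner ℝ u y : ℝ) = 0 := by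
  have key : ∀ r : E3, ∃ u : E3, u ≠ 0 ∧ (inner ℝ u r : ℝ) = 0 := fun r => by
    obtain ⟨u, h1, h2⟩ := exists_unit_orthogonal r
    exact ⟨u, fun h => by simp [h] at h2, by rw [real_inner_comm]; exact h1⟩
  by_cases hc : cross x y = 0
  · by_cases hx : x = 0
    · obtain ⟨u, hu, h⟩ := key y
      exact ⟨u, hu, by rw [hx, inner_zero_right], h⟩
    · obtain ⟨u, hu, h⟩ := key x
      refine ⟨u, hu, h, ?_⟩
      have h1 := cross_cross x x y
      rw [hc, show cross x 0 = 0 by apply ext_coord <;> simp] at h1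
      have h2 := congrArg (fun v => (inner ℝ u v : ℝ)) (sub_eq_zero.1 h1.symm)
      simp only [inner_smul_right, h, mul_zero] at h2
      exact (mul_eq_zero.1 h2.symm).resolve_left (real_inner_self_pos.2 hx).ne'
  · exact ⟨cross x y, hc, by rw [real_inner_comm, inner_cross_self_left],
      by rw [real_inner_comm, inner_cross_self_right]⟩

theorem not_subset_triple_of_solid {W : Set E3} (hW : (interior (convexHull ℝ W)).Nonempty)
    (a b d : E3) : ¬ W ⊆ {a, b, d} := by
  intro hsub
  obtain ⟨u, hu, h1, h2⟩ := exists_ne_zero_orthogonal (b - a) (d - a)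
  rw [inner_sub_right] at h1 h2
  obtain ⟨w, hw, hne⟩ := exists_inner_ne hW hu (inner ℝ u a)
  rcases hsub hw with rfl | rfl | rfl
  · exact hne rfl
  · exact hne (by linarith)
  · exact hne (by linarith)

/-- Each triple of the vertices of a solid with four vertices spans a face. -/
theorem equilateral_of_four_points {c : E3} {W : Set E3} {R : ℝ}
    (hsolid : (interior (convexHull ℝ W)).Nonempty)
    (hreg : ∀ F, IsFace (convexHull ℝ ((fun x => c + x) '' W)) F → IsRegularPolygon F)
    (hR : ∀ w ∈ W, ‖w‖ = R) {a b d f : E3} (hset : W = {a, b, d, f})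
    (hab : a ≠ b) (had : a ≠ d) (hbd : b ≠ d) :
    sqDist a b = sqDist a d ∧ sqDist a b = sqDist b d := by
  have hcross := cross_ne_zero_of_norm_eq (hR a (by simp [hset])) (hR b (by simp [hset]))
    (hR d (by simp [hset])) hab had hbd
  set v := cross (b - a) (d - a) with hv
  have h1 := inner_cross_self_left (b - a) (d - a)
  have h2 := inner_cross_self_right (b - a) (d - a)
  rw [← hv, real_inner_comm] at h1 h2
  -- The normal of the plane of `a`, `b`, `d` that points away from `f`.
  have key : ∀ u : E3, u ≠ 0 → (inner ℝ u (b - a) : ℝ) = 0 → (inner ℝ u (d - a) : ℝ) = 0 →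
      (inner ℝ u f : ℝ) < inner ℝ u a → sqDist a b = sqDist a d ∧ sqDist a b = sqDist b d := by
    intro u hu hb hd hf
    rw [inner_sub_right, sub_eq_zero] at hb hd
    refine equilateral_of_facet (c := c) (W := W) (R := R) (LinearIsometryEquiv.refl ℝ E3)
      (by simpa using hreg) hR hu (k := inner ℝ u a) ?_ ?_ hab had hbd
    · rw [hset]
      rintro w (rfl | rfl | rfl | rfl)
      exacts [le_rfl, hb.le, hd.le, hf.le]
    · ext w
      rw [hset]
      constructor
      · rintro ⟨rfl | rfl | rfl | rfl, hw⟩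
        · simp
        · simp
        · simp
        · exact absurd hw hf.ne
      · rintro (rfl | rfl | rfl)
        · exact ⟨by simp, rfl⟩
        · exact ⟨by simp, hb⟩
        · exact ⟨by simp, hd⟩
  have hne : (inner ℝ v f : ℝ) ≠ inner ℝ v a := by
    intro h
    obtain ⟨w, hw, hwne⟩ := exists_inner_ne hsolid hcross (inner ℝ v a)
    rw [inner_sub_right, sub_eq_zero] at h1 h2
    rw [hset] at hw
    rcases hw with rfl | rfl | rfl | rfl
    exacts [hwne rfl, hwne h1, hwne h2, hwne h]
  rcases lt_or_gt_of_ne hne with h | h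
  · exact key v hcross h1 h2 h
  · refine key (-v) (neg_ne_zero.2 hcross) (by rw [inner_neg_left, h1, neg_zero])
      (by rw [inner_neg_left, h2, neg_zero]) ?_
    rw [inner_neg_left, inner_neg_left]
    linarith

theorem range_fin_four {α : Type*} (p : Fin 4 → α) : range p = {p 0, p 1, p 2, p 3} := by
  ext x
  simp only [mem_range, Fin.exists_fin_succ, mem_insert_iff, mem_singleton_iff]
  simp [eq_comm]

/-- A solid with regular faces and four vertices is a regular tetrahedron: its faces are equilateral
triangles, so that all edges have the same length. -/
theorem isSimilar_tetrahedron_of_four_points {c : E3} {W : Set E3} {R : ℝ}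
    (hsolid : (interior (convexHull ℝ W)).Nonempty)
    (hreg : ∀ F, IsFace (convexHull ℝ ((fun x => c + x) '' W)) F → IsRegularPolygon F)
    (hR : ∀ w ∈ W, ‖w‖ = R) {a b d f : E3} (hset : W = {a, b, d, f}) :
    IsSimilar (convexHull ℝ W) tetrahedron := by
  have hnot := not_subset_triple_of_solid hsolid
  have hab : a ≠ b := by rintro rfl; exact hnot a d f (by rw [hset]; simp)
  have had : a ≠ d := by
    rintro rfl; exact hnot a b f (by rw [hset]; intro x; simp; tauto)
  have haf : a ≠ f := by
    rintro rfl; exact hnot a b d (by rw [hset]; intro x; simp; tauto)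
  have hbd : b ≠ d := by
    rintro rfl; exact hnot a b f (by rw [hset]; intro x; simp)
  have hbf : b ≠ f := by
    rintro rfl; exact hnot a b d (by rw [hset]; intro x; simp; tauto)
  have hdf : d ≠ f := by
    rintro rfl; exact hnot a b d (by rw [hset]; intro x; simp)
  obtain ⟨e1, e2⟩ := equilateral_of_four_points hsolid hreg hR hset hab had hbd
  obtain ⟨e3, e4⟩ := equilateral_of_four_points (a := a) (b := b) (d := f) (f := d) hsolid hreg hR
    (by rw [hset]; ext; simp; tauto) hab haf hbf
  obtain ⟨-, e5⟩ := equilateral_of_four_points (a := a) (b := d) (d := f) (f := b) hsolid hreg hR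
    (by rw [hset]; ext; simp; tauto) had haf hdf
  have hL := sqDist_pos hab
  set L := sqDist a b with hLdef
  set v₁ := b - a with hv₁
  set v₂ := d - a with hv₂
  set v₃ := f - a with hv₃
  have i11 : (inner ℝ v₁ v₁ : ℝ) = L := sqDist_comm b a
  have i22 : (inner ℝ v₂ v₂ : ℝ) = L := (sqDist_comm d a).trans e1.symm
  have i33 : (inner ℝ v₃ v₃ : ℝ) = L := (sqDist_comm f a).trans e3.symm
  have polar : ∀ x y : E3, sqDist x y = inner ℝ (x - a) (x - a) + inner ℝ (y - a) (y - a) -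
      2 * inner ℝ (x - a) (y - a) := by
    intro x y
    simp only [sqDist, inner_eq, PiLp.sub_apply]; ring
  have i12 : (inner ℝ v₁ v₂ : ℝ) = L / 2 := by linarith [polar b d]
  have i13 : (inner ℝ v₁ v₃ : ℝ) = L / 2 := by linarith [polar b f]
  have i23 : (inner ℝ v₂ v₃ : ℝ) = L / 2 := by linarith [polar d f]
  have i21 : (inner ℝ v₂ v₁ : ℝ) = L / 2 := by rw [real_inner_comm, i12]
  have i31 : (inner ℝ v₃ v₁ : ℝ) = L / 2 := by rw [real_inner_comm, i13]
  have i32 : (inner ℝ v₃ v₂ : ℝ) = L / 2 := by rw [real_inner_comm, i23]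
  -- The edges of the circumscribed cube, of length `m`.
  obtain ⟨m, hm, hmm⟩ : ∃ m : ℝ, 0 < m ∧ m * m = L / 2 :=
    ⟨√(L / 2), sqrt_pos.2 (by linarith), mul_self_sqrt (by linarith)⟩
  have hm' : m⁻¹ * (m⁻¹ * (L / 2)) = 1 := by rw [← hmm]; field_simp
  obtain ⟨φ, hφ⟩ := exists_isometry_of_frame (m⁻¹ • ((2⁻¹ : ℝ) • (v₁ - v₂ - v₃)))
    (m⁻¹ • ((2⁻¹ : ℝ) • (v₂ - v₁ - v₃))) (m⁻¹ • ((2⁻¹ : ℝ) • (v₃ - v₁ - v₂)))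
    (by
      simp only [inner_smul_left, inner_smul_right, inner_sub_left, inner_sub_right,
        RCLike.conj_to_real, i11, i12, i13, i21, i22, i23, i31, i32, i33]
      linear_combination hm')
    (by
      simp only [inner_smul_left, inner_smul_right, inner_sub_left, inner_sub_right,
        RCLike.conj_to_real, i11, i12, i13, i21, i22, i23, i31, i32, i33]
      linear_combination hm')
    (by
      simp only [inner_smul_left, inner_smul_right, inner_sub_left, inner_sub_right,
        RCLike.conj_to_real, i11, i12, i13, i21, i22, i23, i31, i32, i33]
      linear_combination hm')
    (by
      simp only [inner_smul_left, inner_smul_right, inner_sub_left, inner_sub_right,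
        RCLike.conj_to_real, i11, i12, i13, i21, i22, i23, i31, i32, i33]
      ring)
    (by
      simp only [inner_smul_left, inner_smul_right, inner_sub_left, inner_sub_right,
        RCLike.conj_to_real, i11, i12, i13, i21, i22, i23, i31, i32, i33]
      ring)
    (by
      simp only [inner_smul_left, inner_smul_right, inner_sub_left, inner_sub_right,
        RCLike.conj_to_real, i11, i12, i13, i21, i22, i23, i31, i32, i33]
      ring)
  -- The similarity maps the center of the circumscribed cube of the standard tetrahedron to the
  -- centroid of the four points.
  have main := (isSimilar_convexHull_image (range tet) (a + (4⁻¹ : ℝ) • (v₁ + v₂ + v₃))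
    (div_pos hm two_pos).ne' φ).symm
  rw [← tetrahedron_eq_convexHull] at main
  convert main using 2
  have hh : ∀ x : E3, (m / 2) • φ x = (4⁻¹ : ℝ) •
      (x 0 • (v₁ - v₂ - v₃) + x 1 • (v₂ - v₁ - v₃) + x 2 • (v₃ - v₁ - v₂)) := by
    intro x
    have h4 : ∀ s : ℝ, m / 2 * (s * (m⁻¹ * 2⁻¹)) = 4⁻¹ * s := fun s => by
      field_simp; ring
    simp only [hφ, smul_add, smul_smul, h4]
  rw [hset, ← range_comp]
  have q0 : ((fun x => a + (4⁻¹ : ℝ) • (v₁ + v₂ + v₃) + (m / 2) • φ x) ∘ tet) 0 = a := by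
    simp only [Function.comp_apply, hh]; simp [tet]; module
  have q1 : ((fun x => a + (4⁻¹ : ℝ) • (v₁ + v₂ + v₃) + (m / 2) • φ x) ∘ tet) 1 = b := by
    simp only [Function.comp_apply, hh]; simp [tet]; module
  have q2 : ((fun x => a + (4⁻¹ : ℝ) • (v₁ + v₂ + v₃) + (m / 2) • φ x) ∘ tet) 2 = d := by
    simp only [Function.comp_apply, hh]; simp [tet]; module
  have q3 : ((fun x => a + (4⁻¹ : ℝ) • (v₁ + v₂ + v₃) + (m / 2) • φ x) ∘ tet) 3 = f := by
    simp only [Function.comp_apply, hh]; simp [tet]; module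
  rw [range_fin_four, q0, q1, q2, q3]

/-! ### Two parallel regular polygons -/

/-- The point at the angle `θ` of the circle of radius `ρ` about the vertical axis, at height
`z`. -/
def circlePoint (ρ z θ : ℝ) : E3 := !₂[ρ * cos θ, ρ * sin θ, z]

@[simp] theorem circlePoint_zero (ρ z θ : ℝ) : circlePoint ρ z θ 0 = ρ * cos θ := rfl
@[simp] theorem circlePoint_one (ρ z θ : ℝ) : circlePoint ρ z θ 1 = ρ * sin θ := rfl
@[simp] theorem circlePoint_two (ρ z θ : ℝ) : circlePoint ρ z θ 2 = z := rfl

/-- The vertices of two regular `n`-gons of circumradius `ρ` at the heights `±h`, the lower one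
being turned by the angle `δ`. -/
def twoPolygons (n : ℕ) (ρ h δ : ℝ) : Set E3 :=
  {x | ∃ r : ℕ, r < n ∧ (x = circlePoint ρ h (2 * π * r / n) ∨
    x = circlePoint ρ (-h) (δ + 2 * π * r / n))}

theorem sqDist_circlePoint (ρ z z' θ θ' : ℝ) :
    sqDist (circlePoint ρ z θ) (circlePoint ρ z' θ') =
      2 * ρ ^ 2 * (1 - cos (θ - θ')) + (z - z') ^ 2 := by
  rw [cos_sub]
  simp only [sqDist, inner_eq, PiLp.sub_apply, circlePoint_zero, circlePoint_one, circlePoint_two]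
  linear_combination ρ ^ 2 * (sin_sq_add_cos_sq θ + sin_sq_add_cos_sq θ')

theorem inner_circlePoint (α ζ ρ z θ : ℝ) :
    inner ℝ (circlePoint 1 ζ α) (circlePoint ρ z θ) = ρ * cos (θ - α) + ζ * z := by
  rw [cos_sub, inner_eq]
  simp only [circlePoint_zero, circlePoint_one, circlePoint_two]
  ring

/-- The vertices of a polygon are indexed modulo `n`. -/
theorem circlePoint_congr {n : ℕ} (hn : 0 < n) {k r q : ℤ} (h : k = n * q + r) (ρ z δ : ℝ) :
    circlePoint ρ z (δ + 2 * π * k / n) = circlePoint ρ z (δ + 2 * π * r / n) := by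
  have hn' : (n : ℝ) ≠ 0 := by exact_mod_cast hn.ne'
  have e : δ + 2 * π * k / n = δ + 2 * π * r / n + q * (2 * π) := by
    rw [h]; push_cast; field_simp; ring
  rw [circlePoint, circlePoint, e, cos_add_int_mul_two_pi, sin_add_int_mul_two_pi]

theorem exists_lt_eq_mul_add {n : ℕ} (hn : 0 < n) (k : ℤ) :
    ∃ r : ℕ, r < n ∧ ∃ q : ℤ, k = n * q + (r : ℤ) := by
  have hn' : (n : ℤ) ≠ 0 := by exact_mod_cast hn.ne'
  have h0 := Int.emod_nonneg k hn'
  have h1 := Int.emod_lt_of_pos k (by exact_mod_cast hn : (0 : ℤ) < n)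
  refine ⟨(k % n).toNat, by omega, k / n, ?_⟩
  rw [Int.toNat_of_nonneg h0]
  exact (Int.mul_ediv_add_emod k n).symm

theorem exists_angle {x y r : ℝ} (hr : 0 ≤ r) (h : x * x + y * y = r ^ 2) :
    ∃ θ : ℝ, x = r * cos θ ∧ y = r * sin θ := by
  have hz : ‖(⟨x, y⟩ : ℂ)‖ = r := by
    rw [Complex.norm_def, Complex.normSq_mk, sqrt_eq_iff_eq_sq
      (add_nonneg (mul_self_nonneg _) (mul_self_nonneg _)) hr, h]
  refine ⟨Complex.arg ⟨x, y⟩, ?_, ?_⟩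
  · rw [← hz, Complex.norm_mul_cos_arg]
  · rw [← hz, Complex.norm_mul_sin_arg]

/-- On the circle, the points outside an arc centered at `0` are further left than its ends. -/
theorem cos_lt_cos_of_mem_arc {a β : ℝ} (ha : 0 ≤ a) (h1 : a < β) (h2 : β < 2 * π - a) :
    cos β < cos a := by
  rcases le_total β π with h | h
  · exact cos_lt_cos_of_nonneg_of_le_pi ha h h1
  · rw [← cos_two_pi_sub]
    exact cos_lt_cos_of_nonneg_of_le_pi ha (by linarith) (by linarith)

theorem two_pi_mul_div (n r : ℕ) : 2 * π * r / n = 2 * r * (π / n) := by ring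

theorem pi_div_pos {n : ℕ} (hn : 3 ≤ n) : 0 < π / n :=
  div_pos pi_pos (by exact_mod_cast (by omega : 0 < n))

theorem natCast_mul_pi_div {n : ℕ} (hn : 3 ≤ n) : n * (π / n) = π := by
  have : (n : ℝ) ≠ 0 := by exact_mod_cast (by omega : n ≠ 0)
  field_simp

theorem three_mul_pi_div_le {n : ℕ} (hn : 3 ≤ n) : 3 * (π / n) ≤ π := by
  have h : (3 : ℝ) ≤ n := by exact_mod_cast hn
  have := mul_le_mul_of_nonneg_right h (pi_div_pos hn).le
  rwa [natCast_mul_pi_div hn] at this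

/-- All vertices of a regular polygon but the two of a side lie strictly behind that side. -/
theorem cos_side_lt {n : ℕ} (hn : 3 ≤ n) {r : ℕ} (h2 : 2 ≤ r) (hr : r < n) :
    cos (2 * π * r / n - π / n) < cos (π / n) := by
  have hα := pi_div_pos hn
  have hnα := natCast_mul_pi_div hn
  rw [two_pi_mul_div]
  have h2' : (2 : ℝ) ≤ r := by exact_mod_cast h2
  have hr' : (r : ℝ) + 1 ≤ n := by exact_mod_cast hr
  have l1 := mul_le_mul_of_nonneg_right h2' hα.le
  have l2 := mul_le_mul_of_nonneg_right hr' hα.le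
  rw [hnα] at l2
  exact cos_lt_cos_of_mem_arc hα.le (by linarith) (by linarith)

theorem cos_side_zero (n : ℕ) : cos (2 * π * (0 : ℕ) / n - π / n) = cos (π / n) := by
  rw [Nat.cast_zero, mul_zero, zero_div, zero_sub, cos_neg]

theorem cos_side_one (n : ℕ) : cos (2 * π * (1 : ℕ) / n - π / n) = cos (π / n) := by
  congr 1; push_cast; ring

theorem circlePoint_ne {n : ℕ} (hn : 3 ≤ n) {ρ : ℝ} (hρ : 0 < ρ) (z z' : ℝ) (δ : ℝ) :
    circlePoint ρ z (δ + 2 * π * (0 : ℕ) / n) ≠ circlePoint ρ z' (δ + 2 * π * (1 : ℕ) / n) := by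
  intro h
  have h1 := sqDist_circlePoint ρ z z' (δ + 2 * π * (0 : ℕ) / n) (δ + 2 * π * (1 : ℕ) / n)
  rw [h, sqDist, sub_self, inner_zero_left] at h1
  have hα := pi_div_pos hn
  have h3 := three_mul_pi_div_le hn
  have h4 : cos (δ + 2 * π * (0 : ℕ) / n - (δ + 2 * π * (1 : ℕ) / n)) < 1 := by
    rw [← cos_neg, ← cos_zero]
    apply cos_lt_cos_of_nonneg_of_le_pi le_rfl <;> push_cast <;>
      rw [show -(δ + 2 * π * 0 / n - (δ + 2 * π * 1 / n)) = 2 * (π / n) by ring] <;> linarith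
  nlinarith [mul_pos (mul_pos two_pos (pow_pos hρ 2)) (sub_pos.2 h4), sq_nonneg (z - z')]

theorem circlePoint_one_ne_zero (ζ α : ℝ) : circlePoint 1 ζ α ≠ 0 := by
  intro h
  have h0 := congrArg (fun x : E3 => x 0) h
  have h1 := congrArg (fun x : E3 => x 1) h
  simp at h0 h1
  have := sin_sq_add_cos_sq α
  rw [h0, h1] at this
  norm_num at this

theorem norm_of_mem_twoPolygons {n : ℕ} {ρ h δ : ℝ} {w : E3} (hw : w ∈ twoPolygons n ρ h δ) :
    ‖w‖ = √(ρ ^ 2 + h ^ 2) := by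
  have key : ∀ z θ, z ^ 2 = h ^ 2 → ‖circlePoint ρ z θ‖ = √(ρ ^ 2 + h ^ 2) := by
    intro z θ hz
    rw [eq_comm, sqrt_eq_iff_eq_sq (by positivity) (norm_nonneg _), ← real_inner_self_eq_norm_sq,
      inner_eq]
    simp only [circlePoint_zero, circlePoint_one, circlePoint_two]
    linear_combination -ρ ^ 2 * sin_sq_add_cos_sq θ - hz
  obtain ⟨r, -, rfl | rfl⟩ := hw
  · exact key _ _ rfl
  · exact key _ _ (neg_sq h)

/-- If the two polygons are not turned against each other, the lateral faces are rectangles with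
four vertices, so they are squares. -/
theorem height_eq_of_regular_faces_of_zero {c : E3} {n : ℕ} (hn : 3 ≤ n) {ρ h : ℝ} (hρ : 0 < ρ)
    (hh : 0 < h) (φ : E3 ≃ₗᵢ[ℝ] E3)
    (hreg : ∀ F, IsFace (convexHull ℝ ((fun x => c + x) '' (φ '' twoPolygons n ρ h 0))) F →
      IsRegularPolygon F) : h = ρ * sin (π / n) := by
  set v : ℝ → ℕ → E3 := fun z r => circlePoint ρ z (0 + 2 * π * r / n) with hv
  have hval : ∀ z r, inner ℝ (circlePoint 1 0 (π / n)) (v z r) =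
      ρ * cos (2 * π * r / n - π / n) := fun z r => by rw [hv, inner_circlePoint, zero_add]; ring
  have hmem : ∀ x, x ∈ twoPolygons n ρ h 0 ↔ ∃ r : ℕ, r < n ∧ (x = v h r ∨ x = v (-h) r) := by
    intro x
    simp only [twoPolygons, hv, zero_add]
    rfl
  have c0 := cos_side_zero n
  have c1 := cos_side_one n
  -- The plane with normal `circlePoint 1 0 (π / n)` contains a side of each polygon.
  have hset : {w ∈ twoPolygons n ρ h 0 | (inner ℝ (circlePoint 1 0 (π / n)) w : ℝ) =
      ρ * cos (π / n)} = {v h 0, v h 1, v (-h) 0, v (-h) 1} := by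
    ext x
    constructor
    · rintro ⟨hx, hx'⟩
      obtain ⟨r, hr, hx⟩ := (hmem x).1 hx
      have hr2 : ¬ 2 ≤ r := by
        intro h2
        have := mul_lt_mul_of_pos_left (cos_side_lt hn h2 hr) hρ
        rcases hx with rfl | rfl <;> rw [hval] at hx' <;> linarith
      obtain rfl | rfl : r = 0 ∨ r = 1 := by omega
      · rcases hx with rfl | rfl <;> simp
      · rcases hx with rfl | rfl <;> simp
    · rintro (rfl | rfl | rfl | rfl)
      · exact ⟨(hmem _).2 ⟨0, by omega, .inl rfl⟩, by rw [hval, c0]⟩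
      · exact ⟨(hmem _).2 ⟨1, by omega, .inl rfl⟩, by rw [hval, c1]⟩
      · exact ⟨(hmem _).2 ⟨0, by omega, .inr rfl⟩, by rw [hval, c0]⟩
      · exact ⟨(hmem _).2 ⟨1, by omega, .inr rfl⟩, by rw [hval, c1]⟩
  have hle : ∀ w ∈ twoPolygons n ρ h 0,
      (inner ℝ (circlePoint 1 0 (π / n)) w : ℝ) ≤ ρ * cos (π / n) := by
    intro x hx
    obtain ⟨r, hr, hx⟩ := (hmem x).1 hx
    have : cos (2 * π * r / n - π / n) ≤ cos (π / n) := by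
      by_cases h2 : 2 ≤ r
      · exact (cos_side_lt hn h2 hr).le
      · obtain rfl | rfl : r = 0 ∨ r = 1 := by omega
        exacts [c0.le, c1.le]
    rcases hx with rfl | rfl <;> rw [hval] <;> exact mul_le_mul_of_nonneg_left this hρ.le
  have hz : ∀ r s, v h r ≠ v (-h) s := fun r s e => by
    have := congrArg (fun x : E3 => x 2) e
    simp only [hv, circlePoint_two] at this
    linarith
  have h01 : ∀ z z', v z 0 ≠ v z' 1 := fun z z' => circlePoint_ne hn hρ z z' 0
  obtain ⟨r, hr, key⟩ := sqDist_of_facet_of_four φ hreg (fun w => norm_of_mem_twoPolygons)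
    (circlePoint_one_ne_zero 0 (π / n)) hle hset (h01 _ _) (hz _ _) (hz _ _) (hz _ _) (hz _ _)
    (h01 _ _)
  have k1 := key (v h 0) (by simp) (v h 1) (by simp) (h01 _ _)
  have k2 := key (v h 0) (by simp) (v (-h) 0) (by simp) (hz _ _)
  have k3 := key (v h 0) (by simp) (v (-h) 1) (by simp) (hz _ _)
  have e0 : (0 : ℝ) + 2 * π * (0 : ℕ) / n - (0 + 2 * π * (1 : ℕ) / n) = -(2 * (π / n)) := by
    push_cast; ring
  simp only [hv, sqDist_circlePoint, e0, cos_neg, sub_self, cos_zero] at k1 k2 k3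
  have hD : 2 * ρ ^ 2 * (1 - cos (2 * (π / n))) = 4 * (ρ * sin (π / n)) ^ 2 := by
    rw [cos_two_mul, cos_sq']; ring
  have hs : 0 < ρ * sin (π / n) := mul_pos hρ
    (sin_pos_of_pos_of_lt_pi (pi_div_pos hn) (by
      linarith [three_mul_pi_div_le hn, pi_div_pos hn]))
  rw [hD] at k1 k3
  set s := ρ * sin (π / n)
  -- The squares of the horizontal edge, the vertical edge and the diagonal are `4 * s ^ 2`, `4 * h
  -- ^ 2` and their sum; each of them is `r` or `2 * r`.
  have hsq : h ^ 2 = s ^ 2 := by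
    have := pow_pos hs 2
    have := pow_pos hh 2
    rcases k1 with k1 | k1 <;> rcases k2 with k2 | k2 <;> rcases k3 with k3 | k3 <;> nlinarith
  exact (sq_eq_sq₀ hh.le hs.le).1 hsq

/-- If the two polygons are turned against each other, the lateral faces are triangles. These are
equilateral, which determines the angle and the height. -/
theorem eq_of_regular_faces_of_pos {c : E3} {n : ℕ} (hn : 3 ≤ n) {ρ h δ : ℝ} (hρ : 0 < ρ)
    (hh : 0 < h) (hδ : 0 < δ) (hδ' : δ < 2 * (π / n)) (φ : E3 ≃ₗᵢ[ℝ] E3)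
    (hreg : ∀ F, IsFace (convexHull ℝ ((fun x => c + x) '' (φ '' twoPolygons n ρ h δ))) F →
      IsRegularPolygon F) :
    δ = π / n ∧ h ^ 2 = ρ ^ 2 * (sin (π / n) ^ 2 - sin (π / (2 * n)) ^ 2) := by
  have hα := pi_div_pos hn
  have h3α := three_mul_pi_div_le hn
  have hnα := natCast_mul_pi_div hn
  set α := π / n with hαdef
  -- The slope `ζ` makes the plane through a side of the upper polygon touch the lower polygon.
  set ζ := ρ * (cos (δ - α) - cos α) / (2 * h) with hζ
  have hζ' : 2 * (ζ * h) = ρ * (cos (δ - α) - cos α) := by rw [hζ]; field_simp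
  set a : ℕ → E3 := fun r => circlePoint ρ h (0 + 2 * π * r / n) with ha
  set b : ℕ → E3 := fun r => circlePoint ρ (-h) (δ + 2 * π * r / n) with hb
  have hvala : ∀ r, inner ℝ (circlePoint 1 ζ α) (a r) =
      ρ * cos (2 * π * r / n - α) + ζ * h := fun r => by rw [ha, inner_circlePoint, zero_add]
  have hvalb : ∀ r, inner ℝ (circlePoint 1 ζ α) (b r) =
      ρ * cos (δ + 2 * π * r / n - α) + ζ * -h := fun r => by rw [hb, inner_circlePoint]
  have hmem : ∀ x, x ∈ twoPolygons n ρ h δ ↔ ∃ r : ℕ, r < n ∧ (x = a r ∨ x = b r) := by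
    intro x
    simp only [twoPolygons, ha, hb, zero_add]
    rfl
  have c0 : cos (2 * π * (0 : ℕ) / n - α) = cos α := cos_side_zero n
  have c1 : cos (2 * π * (1 : ℕ) / n - α) = cos α := cos_side_one n
  have d0 : cos (δ + 2 * π * (0 : ℕ) / n - α) = cos (δ - α) := by congr 1; push_cast; ring
  have hcos : cos α < cos (δ - α) := by
    rw [← cos_abs (δ - α)]
    have : |δ - α| < α := abs_lt.2 ⟨by linarith, by linarith⟩
    exact cos_lt_cos_of_nonneg_of_le_pi (abs_nonneg _) (by linarith) this
  have d1 : ∀ r : ℕ, 1 ≤ r → r < n → cos (δ + 2 * π * r / n - α) < cos (δ - α) := by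
    intro r h1 h2
    refine lt_trans ?_ hcos
    have h1' : (1 : ℝ) ≤ r := by exact_mod_cast h1
    have hr' : (r : ℝ) + 1 ≤ n := by exact_mod_cast h2
    have l1 := mul_le_mul_of_nonneg_right h1' hα.le
    have l2 := mul_le_mul_of_nonneg_right hr' hα.le
    rw [hnα] at l2
    rw [two_pi_mul_div, ← hαdef]
    exact cos_lt_cos_of_mem_arc hα.le (by linarith) (by linarith)
  have hset : {w ∈ twoPolygons n ρ h δ | (inner ℝ (circlePoint 1 ζ α) w : ℝ) =
      ρ * cos α + ζ * h} = {a 0, a 1, b 0} := by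
    ext x
    constructor
    · rintro ⟨hx, hx'⟩
      obtain ⟨r, hr, rfl | rfl⟩ := (hmem x).1 hx
      · have hr2 : ¬ 2 ≤ r := by
          intro h2
          have := mul_lt_mul_of_pos_left (cos_side_lt hn h2 hr) hρ
          rw [hvala] at hx'
          linarith
        obtain rfl | rfl : r = 0 ∨ r = 1 := by omega
        · simp
        · simp
      · have hr1 : ¬ 1 ≤ r := by
          intro h1
          have := mul_lt_mul_of_pos_left (d1 r h1 hr) hρ
          rw [hvalb] at hx'
          linarith
        obtain rfl : r = 0 := by omega
        simp
    · rintro (rfl | rfl | rfl)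
      · exact ⟨(hmem _).2 ⟨0, by omega, .inl rfl⟩, by rw [hvala, c0]⟩
      · exact ⟨(hmem _).2 ⟨1, by omega, .inl rfl⟩, by rw [hvala, c1]⟩
      · exact ⟨(hmem _).2 ⟨0, by omega, .inr rfl⟩, by rw [hvalb, d0]; linarith⟩
  have hle : ∀ w ∈ twoPolygons n ρ h δ,
      (inner ℝ (circlePoint 1 ζ α) w : ℝ) ≤ ρ * cos α + ζ * h := by
    intro x hx
    obtain ⟨r, hr, rfl | rfl⟩ := (hmem x).1 hx
    · have : cos (2 * π * r / n - α) ≤ cos α := by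
        by_cases h2 : 2 ≤ r
        · exact (cos_side_lt hn h2 hr).le
        · obtain rfl | rfl : r = 0 ∨ r = 1 := by omega
          exacts [c0.le, c1.le]
      rw [hvala]
      linarith [mul_le_mul_of_nonneg_left this hρ.le]
    · have : cos (δ + 2 * π * r / n - α) ≤ cos (δ - α) := by
        by_cases h1 : 1 ≤ r
        · exact (d1 r h1 hr).le
        · obtain rfl : r = 0 := by omega
          exact d0.le
      rw [hvalb]
      linarith [mul_le_mul_of_nonneg_left this hρ.le]
  have hz : ∀ r s, a r ≠ b s := fun r s e => by
    have := congrArg (fun x : E3 => x 2) e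
    simp only [ha, hb, circlePoint_two] at this
    linarith
  have h01 : a 0 ≠ a 1 := circlePoint_ne hn hρ h h 0
  obtain ⟨k1, k2⟩ := equilateral_of_facet φ hreg (fun w => norm_of_mem_twoPolygons)
    (circlePoint_one_ne_zero ζ α) hle hset h01 (hz _ _) (hz _ _)
  have e0 : (0 : ℝ) + 2 * π * (0 : ℕ) / n - (0 + 2 * π * (1 : ℕ) / n) = -(2 * α) := by
    push_cast; ring
  have e1 : (0 : ℝ) + 2 * π * (0 : ℕ) / n - (δ + 2 * π * (0 : ℕ) / n) = -δ := by
    push_cast; ring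
  have e2 : (0 : ℝ) + 2 * π * (1 : ℕ) / n - (δ + 2 * π * (0 : ℕ) / n) = 2 * α - δ := by
    push_cast; ring
  simp only [ha, hb, sqDist_circlePoint, e0, e1, e2, cos_neg, sub_self] at k1 k2
  -- The two lateral edges of the triangle have the same length.
  have hδα : δ = 2 * α - δ := by
    refine injOn_cos ⟨hδ.le, by linarith⟩ ⟨by linarith, by linarith⟩ ?_
    have h2 : ρ ^ 2 * (cos δ - cos (2 * α - δ)) = 0 := by linarith
    linarith [(mul_eq_zero.1 h2).resolve_left (pow_pos hρ 2).ne']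
  have hδα' : δ = α := by linarith
  refine ⟨hδα', ?_⟩
  have h4 : cos (2 * α) = 1 - 2 * sin α ^ 2 := by rw [cos_two_mul, cos_sq']; ring
  have h5 : cos α = 1 - 2 * sin (π / (2 * n)) ^ 2 := by
    rw [show α = 2 * (π / (2 * n)) by rw [hαdef]; ring, cos_two_mul, cos_sq']; ring
  rw [hδα', h4, h5] at k1
  linarith

/-! ### Solids whose symmetries preserve a line -/

/-- A trigonometric polynomial of degree one that is constant on three vertices of a regular
polygon is constant. -/
theorem eq_zero_of_const_on_polygon {n : ℕ} (hn : 3 ≤ n) {A B C D : ℝ}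
    (h : ∀ k : ℕ, k < n → A + cos (2 * π * k / n) * B + sin (2 * π * k / n) * C = D) :
    B = 0 ∧ C = 0 := by
  have hα := pi_div_pos hn
  have h3α := three_mul_pi_div_le hn
  have hn0 : (n : ℝ) ≠ 0 := by exact_mod_cast (by omega : n ≠ 0)
  -- The vertex with index `0` and its two neighbors.
  have h0 := h 0 (by omega)
  have h1 := h 1 (by omega)
  have h2 := h (n - 1) (by omega)
  have e1 : 2 * π * (1 : ℕ) / n = 2 * (π / n) := by push_cast; ring
  have e2 : 2 * π * (n - 1 : ℕ) / n = 2 * π - 2 * (π / n) := by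
    rw [Nat.cast_sub (by omega)]; push_cast; field_simp
  rw [Nat.cast_zero, mul_zero, zero_div, cos_zero, sin_zero] at h0
  rw [e1] at h1
  rw [e2, cos_two_pi_sub, sin_two_pi_sub] at h2
  have hs : 0 < sin (2 * (π / n)) := sin_pos_of_pos_of_lt_pi (by linarith) (by linarith)
  have hc : cos (2 * (π / n)) < 1 := by
    rw [← cos_zero]
    exact cos_lt_cos_of_nonneg_of_le_pi le_rfl (by linarith) (by linarith)
  have hB : (cos (2 * (π / n)) - 1) * B = 0 := by linarith
  have hC : sin (2 * (π / n)) * C = 0 := by linarith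
  exact ⟨(mul_eq_zero.1 hB).resolve_left (by linarith), (mul_eq_zero.1 hC).resolve_left hs.ne'⟩

/-- A regular polygon in a plane orthogonal to `e` that is inscribed in a sphere about the origin
is centered on the line of `e`. -/
theorem ngon_center_eq {n : ℕ} (hn : 3 ≤ n) {c u w e : E3} {h R : ℝ} (hu : u ≠ 0) (hnorm : ‖u‖ = ‖w‖)
    (horth : inner ℝ u w = (0 : ℝ)) (hee : inner ℝ e e = (1 : ℝ))
    (hplane : ∀ k : ℕ, k < n → (inner ℝ e (ngon n c u w k) : ℝ) = h)
    (hR : ∀ k : ℕ, k < n → ‖ngon n c u w k‖ = R) :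
    c = h • e ∧ inner ℝ e u = (0 : ℝ) ∧ inner ℝ e w = (0 : ℝ) := by
  have hww : (inner ℝ w w : ℝ) = inner ℝ u u := by
    rw [real_inner_self_eq_norm_sq, real_inner_self_eq_norm_sq, hnorm]
  have hwu : (inner ℝ w u : ℝ) = 0 := by rw [real_inner_comm]; exact horth
  have huu : 0 < (inner ℝ u u : ℝ) := real_inner_self_pos.2 hu
  obtain ⟨heu, hew⟩ := eq_zero_of_const_on_polygon hn (A := inner ℝ e c) (B := inner ℝ e u)
    (C := inner ℝ e w) (D := h) (fun k hk => by
      rw [← hplane k hk]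
      simp only [ngon, inner_add_right, inner_smul_right])
  -- The squared norm of the vertices is a trigonometric polynomial as well, and it is constant.
  obtain ⟨hcu, hcw⟩ := eq_zero_of_const_on_polygon hn (A := 0) (B := 2 * inner ℝ c u)
    (C := 2 * inner ℝ c w) (D := R ^ 2 - inner ℝ c c - inner ℝ u u) (fun k hk => by
      rw [← hR k hk, ← real_inner_self_eq_norm_sq]
      simp only [ngon, inner_add_left, inner_add_right, inner_smul_left, inner_smul_right,
        RCLike.conj_to_real, hww, hwu, horth, real_inner_comm c u, real_inner_comm c w]
      linear_combination -(inner ℝ u u : ℝ) * sin_sq_add_cos_sq (2 * π * k / n))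
  have hec : (inner ℝ e c : ℝ) = h := by
    rw [← hplane 0 (by omega)]
    simp only [ngon, inner_add_right, inner_smul_right, heu, hew]
    ring
  refine ⟨?_, heu, hew⟩
  have hcross : cross u w ≠ 0 := by
    intro h0
    have := inner_cross_cross u w u w
    rw [h0, inner_zero_left, hww, horth] at this
    nlinarith
  rw [← sub_eq_zero]
  have hu0 : (inner ℝ (c - h • e) u : ℝ) = 0 := by
    rw [inner_sub_left, inner_smul_left, heu]; simp; linarith
  have hw0 : (inner ℝ (c - h • e) w : ℝ) = 0 := by
    rw [inner_sub_left, inner_smul_left, hew]; simp; linarith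
  have he0 : (inner ℝ (c - h • e) e : ℝ) = 0 := by
    rw [inner_sub_left, inner_smul_left, hee, real_inner_comm, hec]; simp
  obtain ⟨s, hs⟩ := eq_smul_cross_of_orthogonal hcross heu hew
  obtain ⟨t, ht⟩ := eq_smul_cross_of_orthogonal hcross hu0 hw0
  have hs0 : s ≠ 0 := by
    rintro rfl
    rw [hs] at hee
    simp at hee
  have hte : c - h • e = (t / s) • e := by
    rw [ht, hs, smul_smul, div_mul_cancel₀ _ hs0]
  rw [hte, inner_smul_left, hee] at he0
  have : t / s = 0 := by simpa using he0
  rw [hte, this, zero_smul]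

theorem isSimilar_prism_of_height {n : ℕ} {ρ : ℝ} (hρ : 0 < ρ) (φ : E3 ≃ₗᵢ[ℝ] E3) :
    IsSimilar (convexHull ℝ (φ '' twoPolygons n ρ (ρ * sin (π / n)) 0)) (prism n) := by
  refine IsSimilar.symm ?_
  have main := isSimilar_convexHull_image {x : E3 | ∃ k : Fin n,
    x 0 = cos (2 * π * (k : ℕ) / n) ∧ x 1 = sin (2 * π * (k : ℕ) / n) ∧ |x 2| = sin (π / n)}
    0 hρ.ne' φ
  rw [prism]
  convert main using 2
  ext y
  constructor
  · have key : ∀ r : ℕ, r < n → ∀ z, |z| = sin (π / n) →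
        φ (circlePoint ρ (ρ * z) (2 * π * r / n)) ∈ (fun x => (0 : E3) + ρ • φ x) ''
          {x : E3 | ∃ k : Fin n, x 0 = cos (2 * π * (k : ℕ) / n) ∧
            x 1 = sin (2 * π * (k : ℕ) / n) ∧ |x 2| = sin (π / n)} := by
      intro r hr z hz
      refine ⟨circlePoint 1 z (2 * π * r / n), ⟨⟨r, hr⟩, by simp, by simp, hz⟩, ?_⟩
      simp only [zero_add, ← map_smul]
      congr 1
      apply ext_coord <;> simp
    have hs : 0 < n → |sin (π / n)| = sin (π / n) := fun hn => by
      have h1 : (1 : ℝ) ≤ n := by exact_mod_cast hn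
      exact abs_of_nonneg (sin_nonneg_of_nonneg_of_le_pi (by positivity)
        (div_le_self pi_pos.le h1))
    rintro ⟨_, ⟨r, hr, rfl | rfl⟩, rfl⟩
    · exact key r hr _ (hs (by omega))
    · rw [zero_add, ← mul_neg]
      exact key r hr _ (by rw [abs_neg, hs (by omega)])
  · rintro ⟨x, ⟨k, h0, h1, h2⟩, rfl⟩
    refine ⟨ρ • x, ⟨k, k.2, ?_⟩, by simp⟩
    rw [zero_add]
    rcases abs_eq_abs.1 (h2.trans (abs_of_nonneg (h2 ▸ abs_nonneg _)).symm) with h | h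
    · left
      apply ext_coord <;> simp [h0, h1, h]
    · right
      apply ext_coord <;> simp [h0, h1, h]

theorem isSimilar_antiprism_of_height {n : ℕ} {ρ h : ℝ} (hρ : 0 < ρ) (hh : 0 < h)
    (hheight : h ^ 2 = ρ ^ 2 * (sin (π / n) ^ 2 - sin (π / (2 * n)) ^ 2)) (φ : E3 ≃ₗᵢ[ℝ] E3) :
    IsSimilar (convexHull ℝ (φ '' twoPolygons n ρ h (π / n))) (antiprism n) := by
  refine IsSimilar.symm ?_
  set H := √(sin (π / n) ^ 2 - sin (π / (2 * n)) ^ 2) with hH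
  have hhH : h = ρ * H := by
    have h1 : H = h / ρ := by
      rw [hH, sqrt_eq_iff_eq_sq _ (by positivity), div_pow, hheight]
      · field_simp
      · have : sin (π / n) ^ 2 - sin (π / (2 * n)) ^ 2 = h ^ 2 / ρ ^ 2 := by
          rw [hheight]; field_simp
        rw [this]; positivity
    rw [h1]; field_simp
  have main := isSimilar_convexHull_image (range fun k : Fin (2 * n) =>
    (!₂[cos (π * (k : ℕ) / n), sin (π * (k : ℕ) / n), (-1) ^ (k : ℕ) * H] : E3)) 0 hρ.ne' φ
  rw [antiprism]
  convert main using 2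
  have even : ∀ r : ℕ, circlePoint ρ h (2 * π * r / n) = ρ • (!₂[cos (π * (2 * r : ℕ) / n),
      sin (π * (2 * r : ℕ) / n), (-1) ^ (2 * r) * H] : E3) := by
    intro r
    have e : π * (2 * r : ℕ) / n = 2 * π * r / n := by push_cast; ring
    rw [e]
    apply ext_coord <;> simp [pow_mul, hhH]
  have odd : ∀ r : ℕ, circlePoint ρ (-h) (π / n + 2 * π * r / n) =
      ρ • (!₂[cos (π * (2 * r + 1 : ℕ) / n), sin (π * (2 * r + 1 : ℕ) / n),
        (-1) ^ (2 * r + 1) * H] : E3) := by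
    intro r
    have e : π * (2 * r + 1 : ℕ) / n = π / n + 2 * π * r / n := by push_cast; ring
    rw [e]
    apply ext_coord <;> simp [pow_mul, pow_succ, hhH]
  ext y
  constructor
  · rintro ⟨_, ⟨r, hr, rfl | rfl⟩, rfl⟩
    · rw [even]
      exact ⟨_, ⟨⟨2 * r, by omega⟩, rfl⟩, by simp⟩
    · rw [odd]
      exact ⟨_, ⟨⟨2 * r + 1, by omega⟩, rfl⟩, by simp⟩
  · rintro ⟨_, ⟨k, rfl⟩, rfl⟩
    simp only [zero_add, ← map_smul]
    apply mem_image_of_mem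
    have hk := k.2
    obtain ⟨r, h | h⟩ := Nat.even_or_odd' (k : ℕ)
    · exact ⟨r, by omega, .inl (by rw [h, ← even])⟩
    · exact ⟨r, by omega, .inr (by rw [h, ← odd])⟩

/-- Two congruent regular polygons in the planes `⟨e, ·⟩ = ±h`, centered on the line of `e`, are
up to a linear isometry those of `twoPolygons`. -/
theorem exists_image_twoPolygons_eq {n : ℕ} (hn : 3 ≤ n) {e u w u' w' : E3} (h : ℝ) {ρ : ℝ}
    (hρ : 0 < ρ) (hee : inner ℝ e e = (1 : ℝ)) (huu : inner ℝ u u = ρ ^ 2)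
    (hww : inner ℝ w w = ρ ^ 2) (huw : inner ℝ u w = (0 : ℝ)) (heu : inner ℝ e u = (0 : ℝ))
    (hew : inner ℝ e w = (0 : ℝ)) (huu' : inner ℝ u' u' = ρ ^ 2)
    (hww' : inner ℝ w' w' = ρ ^ 2) (huw' : inner ℝ u' w' = (0 : ℝ))
    (heu' : inner ℝ e u' = (0 : ℝ)) (hew' : inner ℝ e w' = (0 : ℝ)) :
    ∃ (φ : E3 ≃ₗᵢ[ℝ] E3) (δ : ℝ), 0 ≤ δ ∧ δ < 2 * (π / n) ∧
      {x | ∃ k : ℕ, k < n ∧ (x = ngon n (h • e) u w k ∨ x = ngon n (-h • e) u' w' k)} =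
        φ '' twoPolygons n ρ h δ := by
  have hρ0 : ρ ≠ 0 := hρ.ne'
  have hwu : (inner ℝ w u : ℝ) = 0 := by rw [real_inner_comm]; exact huw
  have hue : (inner ℝ u e : ℝ) = 0 := by rw [real_inner_comm]; exact heu
  have hwe : (inner ℝ w e : ℝ) = 0 := by rw [real_inner_comm]; exact hew
  obtain ⟨φ, hφ⟩ := exists_isometry_of_frame (ρ⁻¹ • u) (ρ⁻¹ • w) e
    (by rw [inner_smul_left, inner_smul_right, huu, RCLike.conj_to_real]; field_simp)
    (by rw [inner_smul_left, inner_smul_right, hww, RCLike.conj_to_real]; field_simp) hee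
    (by rw [inner_smul_left, inner_smul_right, huw]; simp)
    (by rw [inner_smul_left, hue]; simp) (by rw [inner_smul_left, hwe]; simp)
  have hexp : ∀ v : E3, (inner ℝ e v : ℝ) = 0 → ∃ x : E3, x 2 = 0 ∧ φ x = v := by
    intro v hv
    refine ⟨φ.symm v, ?_, by simp⟩
    have h1 : (inner ℝ (φ !₂[0, 0, 1]) (φ (φ.symm v)) : ℝ) = 0 := by
      rw [LinearIsometryEquiv.apply_symm_apply, hφ]
      simpa using hv
    rw [LinearIsometryEquiv.inner_map_map, inner_eq] at h1
    simpa using h1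
  obtain ⟨p, hp2, rfl⟩ := hexp u' heu'
  obtain ⟨q, hq2, rfl⟩ := hexp w' hew'
  rw [LinearIsometryEquiv.inner_map_map, inner_eq, hp2] at huu'
  rw [LinearIsometryEquiv.inner_map_map, inner_eq, hq2] at hww'
  rw [LinearIsometryEquiv.inner_map_map, inner_eq, hp2] at huw'
  -- The direction of the first vertex of the second polygon.
  obtain ⟨δ₀, hc, hs⟩ := exists_angle hρ.le (x := p 0) (y := p 1) (by linarith)
  -- The second polygon runs around the axis in the same sense as the first or in the opposite one.
  obtain ⟨ε, hε, hq0, hq1⟩ : ∃ ε : ℤ, ε * ε = 1 ∧ q 0 = -ε * (ρ * sin δ₀) ∧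
      q 1 = ε * (ρ * cos δ₀) := by
    set E := (p 0 * q 1 - p 1 * q 0) / ρ ^ 2 with hE
    have k0 : q 0 = -E * p 1 := by
      rw [hE]; field_simp
      linear_combination -q 0 * huu' + p 0 * huw'
    have k1 : q 1 = E * p 0 := by
      rw [hE]; field_simp
      linear_combination -q 1 * huu' + p 1 * huw'
    have hEE : (E - 1) * (E + 1) = 0 := by
      have : ρ ^ 2 * ((E - 1) * (E + 1)) = 0 := by
        rw [k0, k1] at hww'
        linear_combination hww' - E ^ 2 * huu'
      exact (mul_eq_zero.1 this).resolve_left (pow_ne_zero 2 hρ0)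
    rcases mul_eq_zero.1 hEE with h1 | h1
    · refine ⟨1, by norm_num, ?_, ?_⟩
      · rw [k0, hs, sub_eq_zero.1 h1]; simp
      · rw [k1, hc, sub_eq_zero.1 h1]; simp
    · refine ⟨-1, by norm_num, ?_, ?_⟩
      · rw [k0, hs, eq_neg_of_add_eq_zero_left h1]; simp
      · rw [k1, hc, eq_neg_of_add_eq_zero_left h1]; simp
  have hn0 : (n : ℝ) ≠ 0 := by exact_mod_cast (by omega : n ≠ 0)
  have hα := pi_div_pos hn
  set t := 2 * (π / n) with ht
  have ht0 : 0 < t := by linarith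
  -- Rotating the indices of the second polygon by `j` moves the angle to the interval `[0, t)`.
  set j := ⌊δ₀ / t⌋ with hj
  have hεε : (ε : ℝ) * ε = 1 := by exact_mod_cast hε
  refine ⟨φ, δ₀ - j * t, ?_, ?_, ?_⟩
  · have := Int.floor_le (δ₀ / t)
    rw [le_div_iff₀ ht0] at this
    linarith
  · have := Int.lt_floor_add_one (δ₀ / t)
    rw [div_lt_iff₀ ht0] at this
    linarith
  have top : ∀ k : ℕ, ngon n (h • e) u w k = φ (circlePoint ρ h (2 * π * k / n)) := by
    intro k
    rw [hφ]
    simp only [circlePoint_zero, circlePoint_one, circlePoint_two, smul_smul, ngon]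
    rw [show ∀ s : ℝ, ρ * s * ρ⁻¹ = s from fun s => by field_simp,
      show ∀ s : ℝ, ρ * s * ρ⁻¹ = s from fun s => by field_simp]
    abel
  have bot : ∀ k : ℕ, ngon n (-h • e) (φ p) (φ q) k =
      φ (circlePoint ρ (-h) (δ₀ + 2 * π * (ε * k : ℤ) / n)) := by
    intro k
    have he : e = φ !₂[0, 0, 1] := by rw [hφ]; simp
    rw [ngon, he, ← map_smul, ← map_smul, ← map_smul, ← map_add, ← map_add]
    congr 1
    have e1 : 2 * π * ((ε * k : ℤ) : ℝ) / n = ε * (2 * π * k / n) := by push_cast; ring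
    rw [e1]
    set a := 2 * π * k / n
    have hca : cos (ε * a) = cos a ∧ sin (ε * a) = ε * sin a := by
      have : (ε - 1) * (ε + 1) = 0 := by linarith
      rcases mul_eq_zero.1 this with h1 | h1
      · rw [sub_eq_zero.1 h1]; simp
      · rw [eq_neg_of_add_eq_zero_left h1]; simp
    apply ext_coord
    · simp [cos_add, hca.1, hca.2, hc, hq0]; ring
    · simp [sin_add, hca.1, hca.2, hs, hq1]; ring
    · simp [hp2, hq2]
  ext x
  constructor
  · rintro ⟨k, hk, rfl | rfl⟩
    · rw [top]
      exact mem_image_of_mem φ ⟨k, hk, .inl rfl⟩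
    · rw [bot]
      obtain ⟨r, hr, m, hm⟩ := exists_lt_eq_mul_add (by omega : 0 < n) (j + ε * k)
      refine mem_image_of_mem φ ⟨r, hr, .inr ?_⟩
      rw [← Int.cast_natCast r, ← circlePoint_congr (by omega : 0 < n) hm]
      congr 1
      rw [ht]; push_cast; ring
  · rintro ⟨_, ⟨r, hr, rfl | rfl⟩, rfl⟩
    · exact ⟨r, hr, .inl (top r).symm⟩
    · obtain ⟨k, hk, m, hm⟩ := exists_lt_eq_mul_add (by omega : 0 < n) (ε * (r - j))
      refine ⟨k, hk, .inr ?_⟩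
      have hm' : (r : ℤ) - j = n * (ε * m) + ε * k := by
        linear_combination ε * hm - (r - j) * hε
      rw [bot, ← circlePoint_congr (by omega : 0 < n) hm']
      congr 2
      rw [ht]; push_cast; ring

/-- A vertex-transitive solid with regular faces whose symmetries preserve a line is a prism, an
antiprism, or a tetrahedron. The vertices lie in two planes orthogonal to the line; if these are
faces, then the solid is one of the first two, otherwise it has just four vertices. -/
theorem isSimilar_of_axis {c : E3} {W : Set E3} (hsolid : (interior (convexHull ℝ W)).Nonempty)
    (htrans : ∀ x ∈ W, ∀ y ∈ W, ∃ g ∈ symmetryGroup W, g x = y)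
    (hreg : ∀ F, IsFace (convexHull ℝ ((fun x => c + x) '' W)) F → IsRegularPolygon F)
    {e : E3} (he : e ≠ 0) (hG : ∀ g ∈ symmetryGroup W, g e = e ∨ g e = -e) :
    IsSimilar (convexHull ℝ W) tetrahedron ∨
      ∃ n : ℕ, 3 ≤ n ∧ (IsSimilar (convexHull ℝ W) (prism n) ∨
        IsSimilar (convexHull ℝ W) (antiprism n)) := by
  wlog hee : inner ℝ e e = (1 : ℝ) generalizing e
  · refine this (e := ‖e‖⁻¹ • e) (smul_ne_zero (inv_ne_zero (norm_ne_zero_iff.2 he)) he)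
      (fun g hg => ?_) (inner_normalize he)
    rw [map_smul, ← smul_neg]
    exact (hG g hg).imp (congrArg _) (congrArg _)
  obtain ⟨x₀, hx₀, hne₀⟩ := exists_inner_ne hsolid he 0
  have hR : ∀ w ∈ W, ‖w‖ = ‖x₀‖ := by
    intro w hw
    obtain ⟨g, -, rfl⟩ := htrans x₀ hx₀ w hw
    exact LinearIsometryEquiv.norm_map g x₀
  -- The symmetries preserve the height over the plane orthogonal to `e` up to its sign.
  have hheight : ∀ w ∈ W, |(inner ℝ e w : ℝ)| = |(inner ℝ e x₀ : ℝ)| := by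
    intro w hw
    obtain ⟨g, hg, rfl⟩ := htrans x₀ hx₀ w hw
    rw [← LinearIsometryEquiv.inner_map_map g e x₀]
    rcases hG g hg with h | h <;> rw [h]
    rw [inner_neg_left, abs_neg]
  set h := |(inner ℝ e x₀ : ℝ)| with hdef
  have hh : 0 < h := abs_pos.2 hne₀
  have hcases : ∀ w ∈ W, (inner ℝ e w : ℝ) = h ∨ (inner ℝ e w : ℝ) = -h := fun w hw =>
    (abs_eq hh.le).1 (hheight w hw)
  obtain ⟨p, hp, hph⟩ : ∃ p ∈ W, (inner ℝ e p : ℝ) = h := by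
    obtain ⟨w, hw, hne⟩ := exists_inner_ne hsolid he (-h)
    exact ⟨w, hw, (hcases w hw).resolve_right hne⟩
  obtain ⟨q, hq, hqh⟩ : ∃ q ∈ W, (inner ℝ e q : ℝ) = -h := by
    obtain ⟨w, hw, hne⟩ := exists_inner_ne hsolid he h
    exact ⟨w, hw, (hcases w hw).resolve_left hne⟩
  -- A symmetry that interchanges the two planes; it maps the vertices in the upper one onto those
  -- in the lower one.
  obtain ⟨g, hg, hgp⟩ := htrans p hp q hq
  have hge : g e = -e := by
    refine (hG g hg).resolve_left fun hge => ?_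
    have := LinearIsometryEquiv.inner_map_map g e p
    rw [hge, hgp, hph, hqh] at this
    linarith
  have hginner : ∀ x, (inner ℝ e (g x) : ℝ) = -inner ℝ e x := by
    intro x
    rw [← LinearIsometryEquiv.inner_map_map g e x, hge, inner_neg_left, neg_neg]
  have hbot : ∀ w ∈ W, (inner ℝ e w : ℝ) = -h → ∃ w' ∈ W, (inner ℝ e w' : ℝ) = h ∧ g w' = w := by
    intro w hw hwh
    have himg : g '' W = W := hg
    rw [← himg] at hw
    obtain ⟨w', hw', rfl⟩ := hw
    rw [hginner] at hwh
    exact ⟨w', hw', by linarith, rfl⟩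
  -- Three vertices in the upper plane are not collinear, so that this plane then carries a face.
  by_cases h3 : ∃ b ∈ W, (inner ℝ e b : ℝ) = h ∧ ∃ d ∈ W, (inner ℝ e d : ℝ) = h ∧ p ≠ b ∧ p ≠ d ∧
      b ≠ d
  · right
    obtain ⟨b, hb, hbh, d, hd, hdh, hpb, hpd, hbd⟩ := h3
    have hle : ∀ w ∈ W, (inner ℝ e w : ℝ) ≤ h := fun w hw => by
      rcases hcases w hw with hw | hw <;> linarith
    obtain ⟨n, hn, c', u, w, hu, hnorm, horth, hX⟩ := isNgon_of_regular_faces hreg hR he hle hp hb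
      hd hph hbh hdh (cross_ne_zero_of_norm_eq (hR p hp) (hR b hb) (hR d hd) hpb hpd hbd)
    have hmem : ∀ k : ℕ, k < n → ngon n c' u w k ∈ W ∧
        (inner ℝ e (ngon n c' u w k) : ℝ) = h := by
      intro k hk
      have : ngon n c' u w k ∈ {w ∈ W | (inner ℝ e w : ℝ) = h} := by
        rw [hX]
        exact ⟨⟨k, hk⟩, rfl⟩
      exact this
    obtain ⟨rfl, heu, hew⟩ := ngon_center_eq hn hu hnorm horth hee (fun k hk => (hmem k hk).2)
      (fun k hk => hR _ (hmem k hk).1)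
    have hgn : ∀ k, g (ngon n (h • e) u w k) = ngon n (-h • e) (g u) (g w) k := by
      intro k
      simp only [ngon, map_add, map_smul, hge, smul_neg, neg_smul]
    have huu : (inner ℝ u u : ℝ) = ‖u‖ ^ 2 := real_inner_self_eq_norm_sq u
    have hww : (inner ℝ w w : ℝ) = ‖u‖ ^ 2 := by rw [hnorm, real_inner_self_eq_norm_sq]
    have hρ : 0 < ‖u‖ := norm_pos_iff.2 hu
    obtain ⟨φ, δ, hδ, hδ', hW⟩ := exists_image_twoPolygons_eq hn h hρ hee huu hww horth heu hew
      (u' := g u) (w' := g w) (by rw [LinearIsometryEquiv.inner_map_map, huu])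
      (by rw [LinearIsometryEquiv.inner_map_map, hww])
      (by rw [LinearIsometryEquiv.inner_map_map, horth])
      (by rw [hginner, heu, neg_zero]) (by rw [hginner, hew, neg_zero])
    have hWW : W = φ '' twoPolygons n ‖u‖ h δ := by
      rw [← hW]
      ext x
      constructor
      · intro hx
        have key : ∀ y ∈ W, (inner ℝ e y : ℝ) = h → ∃ k : ℕ, k < n ∧ y = ngon n (h • e) u w k := by
          intro y hy hyh
          have : y ∈ {w ∈ W | (inner ℝ e w : ℝ) = h} := ⟨hy, hyh⟩
          rw [hX] at this
          obtain ⟨k, rfl⟩ := this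
          exact ⟨k, k.2, rfl⟩
        rcases hcases x hx with hxh | hxh
        · obtain ⟨k, hk, rfl⟩ := key x hx hxh
          exact ⟨k, hk, .inl rfl⟩
        · obtain ⟨y, hy, hyh, rfl⟩ := hbot x hx hxh
          obtain ⟨k, hk, rfl⟩ := key y hy hyh
          exact ⟨k, hk, .inr (hgn k)⟩
      · rintro ⟨k, hk, rfl | rfl⟩
        · exact (hmem k hk).1
        · rw [← hgn]
          exact map_mem_of_symmetry hg (hmem k hk).1
    rw [hWW] at hreg
    refine ⟨n, hn, ?_⟩
    rw [hWW]
    rcases hδ.eq_or_lt with rfl | hδ0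
    · left
      have := height_eq_of_regular_faces_of_zero hn hρ hh φ hreg
      rw [this]
      exact isSimilar_prism_of_height hρ φ
    · right
      obtain ⟨rfl, hheq⟩ := eq_of_regular_faces_of_pos hn hρ hh hδ0 hδ' φ hreg
      exact isSimilar_antiprism_of_height hρ hh hheq φ
  · left
    -- There are at most two vertices in each plane; for a solid, these are four in total. With `b =
    -- p` the points `p`, `b`, `g p`, `g b` are not different, which
    -- `isSimilar_tetrahedron_of_four_points` excludes.
    obtain ⟨b, hb, hbh, hpb⟩ : ∃ b ∈ W, (inner ℝ e b : ℝ) = h ∧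
        ∀ w ∈ W, (inner ℝ e w : ℝ) = h → w = p ∨ w = b := by
      by_cases h2 : ∃ b ∈ W, (inner ℝ e b : ℝ) = h ∧ p ≠ b
      · obtain ⟨b, hb, hbh, hne⟩ := h2
        refine ⟨b, hb, hbh, fun w hw hwh => ?_⟩
        by_contra! hcon
        exact h3 ⟨b, hb, hbh, w, hw, hwh, hne, hcon.1.symm, hcon.2.symm⟩
      · refine ⟨p, hp, hph, fun w hw hwh => ?_⟩
        by_contra! hcon
        exact h2 ⟨w, hw, hwh, hcon.1.symm⟩
    refine isSimilar_tetrahedron_of_four_points (a := p) (b := b) (d := g p) (f := g b) hsolid hreg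
      hR ?_
    ext x
    constructor
    · intro hx
      rcases hcases x hx with hxh | hxh
      · rcases hpb x hx hxh with rfl | rfl <;> simp
      · obtain ⟨y, hy, hyh, rfl⟩ := hbot x hx hxh
        rcases hpb y hy hyh with rfl | rfl <;> simp
    · rintro (rfl | rfl | rfl | rfl)
      exacts [hp, hb, map_mem_of_symmetry hg hp, map_mem_of_symmetry hg hb]

/-! ### Normals of the faces that lie in the faces of the tetrahedron -/

/-- The plane `⟨m, ·⟩ = h` supports `W` and touches it in a set that spans the plane, so that it
carries a face of the convex hull of `W` with outward normal `m`. -/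
def IsFacet (W : Set E3) (m : E3) (h : ℝ) : Prop :=
  (∀ x ∈ W, (inner ℝ m x : ℝ) ≤ h) ∧
    ∀ w : E3, (∃ k : ℝ, ∀ x ∈ W, (inner ℝ m x : ℝ) = h → (inner ℝ w x : ℝ) = k) →
      ∃ s : ℝ, w = s • m

/-- A similarity of space is composed of a translation, a positive factor and a linear isometry. -/
theorem exists_dilationEquiv_eq (f : E3 ≃ᵈ E3) :
    ∃ (c : E3) (μ : ℝ) (φ : E3 ≃ₗᵢ[ℝ] E3), 0 < μ ∧ ∀ x, f x = c + μ • φ x := by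
  set r : ℝ := (Dilation.ratio f : ℝ) with hr
  have hr0 : 0 < r := by
    have := Dilation.ratio_pos f
    exact_mod_cast this
  have hdist : ∀ x y, dist (f x) (f y) = r * dist x y := fun x y => Dilation.dist_eq f x y
  let G : E3 ≃ᵢ E3 := IsometryEquiv.mk
    (f.toEquiv.trans (LinearEquiv.smulOfNeZero ℝ E3 r⁻¹ (inv_ne_zero hr0.ne')).toEquiv)
    (Isometry.of_dist_eq fun x y => by
      change dist (r⁻¹ • f x) (r⁻¹ • f y) = dist x y
      rw [dist_smul₀, hdist, Real.norm_eq_abs, abs_of_pos (inv_pos.2 hr0)]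
      field_simp)
  have hG : ∀ x, G x = r⁻¹ • f x := fun x => rfl
  set A := G.toRealAffineIsometryEquiv with hA
  have hAg : ∀ x, A x = G x := fun x => by rw [hA, IsometryEquiv.coeFn_toRealAffineIsometryEquiv]
  refine ⟨f 0, r, A.linearIsometryEquiv, hr0, fun x => ?_⟩
  have h1 : A.linearIsometryEquiv (x - 0) = A x - A 0 := A.map_vsub x 0
  rw [sub_zero, hAg, hAg, hG, hG] at h1
  rw [h1, ← smul_sub, smul_smul, mul_inv_cancel₀ hr0.ne', one_smul]
  abel

/-- The normal of a two-dimensional set is determined up to a factor. -/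
theorem exists_eq_smul_of_finrank {F : Set E3} (hF : Module.finrank ℝ (vectorSpan ℝ F) = 2)
    {t w : E3} (ht : t ≠ 0) {k k' : ℝ} (htF : ∀ x ∈ F, (inner ℝ t x : ℝ) = k)
    (hwF : ∀ x ∈ F, (inner ℝ w x : ℝ) = k') : ∃ s : ℝ, w = s • t := by
  have orth : ∀ (v : E3) (k : ℝ), (∀ x ∈ F, (inner ℝ v x : ℝ) = k) →
      vectorSpan ℝ F ≤ (Submodule.span ℝ {v})ᗮ := by
    intro v k hv
    rw [vectorSpan_def, Submodule.span_le]
    rintro _ ⟨x, hx, y, hy, rfl⟩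
    change x - y ∈ (Submodule.span ℝ {v})ᗮ
    rw [Submodule.mem_orthogonal_singleton_iff_inner_right, inner_sub_right, hv x hx, hv y hy,
      sub_self]
  have hdim : Module.finrank ℝ (Submodule.span ℝ {t})ᗮ = 2 := by
    have := Submodule.finrank_add_finrank_orthogonal (Submodule.span ℝ {t})
    rw [finrank_span_singleton ht, finrank_euclideanSpace_fin] at this
    omega
  -- The directions of `F` are all those orthogonal to `t`.
  have heq := Submodule.eq_of_le_of_finrank_eq (orth t k htF) (hF.trans hdim.symm)
  have h1 : w ∈ (vectorSpan ℝ F)ᗮ := by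
    rw [Submodule.mem_orthogonal]
    intro v hv
    rw [real_inner_comm]
    exact Submodule.mem_orthogonal_singleton_iff_inner_right.1 (orth w k' hwF hv)
  rw [heq, Submodule.orthogonal_orthogonal, Submodule.mem_span_singleton] at h1
  obtain ⟨s, hs⟩ := h1
  exact ⟨s, hs.symm⟩

/-- A convex subset of the boundary of the tetrahedron lies in one of its faces. -/
theorem exists_face_of_convex {F : Set E3} (hconv : Convex ℝ F) (hT : F ⊆ tetrahedron)
    (hfr : F ⊆ frontier tetrahedron) : ∃ i, ∀ x ∈ F, (inner ℝ (tet i) x : ℝ) = -1 := by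
  by_contra hcon
  push Not at hcon
  choose p hp hne using hcon
  -- The average of points that avoid the individual faces is an interior point.
  have hmem : (∑ i : Fin 4, (4⁻¹ : ℝ) • p i) ∈ F :=
    hconv.sum_mem (fun _ _ => by norm_num) (by simp) (fun i _ => hp i)
  obtain ⟨i, hi⟩ := (mem_frontier_tetrahedron_iff (hT hmem)).1 (hfr hmem)
  have hlt : -1 < (inner ℝ (tet i) (p i) : ℝ) :=
    lt_of_le_of_ne (mem_tetrahedron_iff.1 (hT (hp i)) i) (hne i).symm
  rw [inner_sum] at hi
  simp only [inner_smul_right] at hi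
  have h1 : ∑ j : Fin 4, (4⁻¹ : ℝ) * -1 < ∑ j, 4⁻¹ * (inner ℝ (tet i) (p j) : ℝ) := by
    refine Finset.sum_lt_sum (fun j _ => ?_) ⟨i, Finset.mem_univ _, by linarith⟩
    have := mem_tetrahedron_iff.1 (hT (hp j)) i
    linarith
  rw [hi] at h1
  norm_num at h1

/-- If four faces of a solid in the tetrahedron make up the part of its boundary that lies on the
boundary of the tetrahedron, then these are the intersections of the solid with the four faces of
the tetrahedron. -/
theorem finrank_face_of_isFaceEmbedded {S : Set E3} (hS : Convex ℝ S)
    (h : IsFaceEmbedded 4 S tetrahedron) (i : Fin 4) :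
    Module.finrank ℝ (vectorSpan ℝ {x ∈ S | (inner ℝ (tet i) x : ℝ) = -1}) = 2 := by
  obtain ⟨hsub, 𝓕, hcard, hface, hfr⟩ := h
  -- Each of the four faces lies in one face of the tetrahedron, which defines a map `ι`. A face is
  -- determined by its plane, so that `ι` is injective, and hence it is surjective.
  have hpl : ∀ F : 𝓕, ∃ i, ∀ x ∈ (F : Set E3), (inner ℝ (tet i) x : ℝ) = -1 := by
    rintro ⟨F, hF⟩
    refine exists_face_of_convex ((hface F hF).1.convex hS)
      ((hface F hF).1.subset.trans hsub.1) fun x hx => ?_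
    have : x ∈ frontier S ∩ frontier tetrahedron := by
      rw [hfr]
      exact mem_biUnion hF hx
    exact this.2
  choose ι hι using hpl
  have heq : ∀ F : 𝓕, (F : Set E3) = {x ∈ S | (inner ℝ (tet (ι F)) x : ℝ) = -1} := by
    rintro ⟨F, hF⟩
    obtain ⟨hexp, hdim⟩ := hface F hF
    have hι' := hι ⟨F, hF⟩
    change F = {x ∈ S | (inner ℝ (tet (ι ⟨F, hF⟩)) x : ℝ) = -1}
    set j := ι ⟨F, hF⟩
    apply Subset.antisymm
    · exact fun x hx => ⟨hexp.subset hx, hι' x hx⟩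
    · rintro x ⟨hxS, hx⟩
      have hne : F.Nonempty := by
        by_contra hemp
        rw [not_nonempty_iff_eq_empty.1 hemp, vectorSpan_empty, finrank_bot] at hdim
        omega
      obtain ⟨l, hl⟩ := hexp hne
      obtain ⟨z, hz⟩ := hne
      have hv : ∀ y, (inner ℝ ((InnerProductSpace.toDual ℝ E3).symm l) y : ℝ) = l y :=
        fun y => InnerProductSpace.toDual_symm_apply
      have hlF : ∀ y ∈ F, l y = l z := by
        intro y hy
        have hy' := hy
        have hz' := hz
        rw [hl] at hy' hz'
        exact le_antisymm (hz'.2 y hy'.1) (hy'.2 z hz'.1)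
      obtain ⟨s, hs⟩ := exists_eq_smul_of_finrank hdim (tet_ne_zero j) hι'
        (fun y hy => (hv y).trans (hlF y hy))
      have hlx : l x = l z := by
        rw [← hv, ← hv, hs, inner_smul_left, inner_smul_left, hx, hι' z hz]
      rw [hl] at hz ⊢
      exact ⟨hxS, fun y hy => hlx ▸ hz.2 y hy⟩
  have hinj : Function.Injective ι := fun F F' hFF' => Subtype.ext (by
    rw [heq F, heq F', hFF'])
  obtain ⟨F, rfl⟩ := ((Fintype.bijective_iff_injective_and_card ι).2
    ⟨hinj, by simp [hcard]⟩).2 i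
  rw [← heq]
  exact (hface F F.2).2

/-- An embedding with four faces yields four faces of the solid with the normals of a regular
tetrahedron. -/
theorem exists_isFacet_of_admitsFaceEmbedding {S W : Set E3} (hSW : IsSimilar S (convexHull ℝ W))
    (h : AdmitsFaceEmbedding 4 S tetrahedron) :
    ∃ (c : E3) (μ : ℝ) (φ : E3 ≃ₗᵢ[ℝ] E3), 0 < μ ∧
      convexHull ℝ ((fun x => c + μ • φ x) '' W) ⊂ tetrahedron ∧
      ∀ i, IsFacet W (-φ.symm (tet i)) ((1 + inner ℝ (tet i) c) / μ) := by
  obtain ⟨S', hS', hemb⟩ := h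
  obtain ⟨f, hf⟩ := hSW.symm.trans hS'
  obtain ⟨c, μ, φ, hμ, hfx⟩ := exists_dilationEquiv_eq f
  let A : E3 →ᵃ[ℝ] E3 := (AffineMap.const ℝ E3 c) + (μ • φ.toLinearEquiv.toLinearMap).toAffineMap
  have hA : (A : E3 → E3) = fun x => c + μ • φ x := rfl
  have hS'' : S' = convexHull ℝ ((fun x => c + μ • φ x) '' W) := by
    rw [← hf, ← hA, ← AffineMap.image_convexHull, hA]
    exact image_congr fun x _ => hfx x
  -- The outward normal `-tet i` and the height `1` of a face of the tetrahedron, pulled back along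
  -- the similarity `x ↦ c + μ • φ x`.
  refine ⟨c, μ, φ, hμ, hS'' ▸ hemb.1, fun i => ?_⟩
  have hval : ∀ x, (inner ℝ (tet i) (c + μ • φ x) : ℝ) =
      inner ℝ (tet i) c + μ * inner ℝ (φ.symm (tet i)) x := by
    intro x
    rw [inner_add_right, inner_smul_right, ← LinearIsometryEquiv.inner_map_map φ (φ.symm (tet i)),
      LinearIsometryEquiv.apply_symm_apply]
  have hge : ∀ x ∈ W, -1 ≤ (inner ℝ (tet i) c : ℝ) + μ * inner ℝ (φ.symm (tet i)) x := by
    intro x hx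
    rw [← hval]
    refine mem_tetrahedron_iff.1 (hemb.1.1 ?_) i
    rw [hS'']
    exact subset_convexHull ℝ _ ⟨x, hx, rfl⟩
  have hiff : ∀ x, (inner ℝ (-φ.symm (tet i)) x : ℝ) = (1 + inner ℝ (tet i) c) / μ ↔
      (inner ℝ (tet i) (c + μ • φ x) : ℝ) = -1 := by
    intro x
    rw [hval, inner_neg_left, eq_div_iff hμ.ne']
    constructor <;> intro h <;> linarith
  refine ⟨fun x hx => ?_, ?_⟩
  · rw [inner_neg_left, le_div_iff₀ hμ]
    linarith [hge x hx]
  rintro w ⟨k, hk⟩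
  have hconv : Convex ℝ S' := by rw [hS'']; exact convex_convexHull ℝ _
  have hdim := finrank_face_of_isFaceEmbedded hconv hemb i
  have hset : {x ∈ S' | (inner ℝ (tet i) x : ℝ) = -1} =
      convexHull ℝ {y ∈ (fun x => c + μ • φ x) '' W | (inner ℝ (-tet i) y : ℝ) = 1} := by
    rw [hS'', ← sep_convexHull_eq]
    · ext y
      simp only [mem_ofPred_eq, inner_neg_left, neg_eq_iff_eq_neg]
    · rintro _ ⟨x, hx, rfl⟩
      rw [inner_neg_left, hval]
      linarith [hge x hx]
  obtain ⟨s, hs⟩ := exists_eq_smul_of_finrank (w := φ w) (k' := inner ℝ (φ w) c + μ * k) hdim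
    (tet_ne_zero i) (fun x hx => hx.2) (by
      rw [hset]
      refine inner_eq_of_mem_convexHull ?_
      rintro _ ⟨⟨x, hx, rfl⟩, hx'⟩
      rw [inner_neg_left, neg_eq_iff_eq_neg] at hx'
      rw [inner_add_right, inner_smul_right, LinearIsometryEquiv.inner_map_map,
        hk x hx ((hiff x).2 hx')])
  refine ⟨-s, ?_⟩
  rw [smul_neg, neg_smul, neg_neg, ← map_smul, ← hs, LinearIsometryEquiv.symm_apply_apply]

theorem sum_inner_tet_sq (x : E3) : ∑ i, (inner ℝ (tet i) x : ℝ) ^ 2 = 4 * inner ℝ x x := by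
  rw [Fin.sum_univ_four, inner_tet_zero, inner_tet_one, inner_tet_two, inner_tet_three, inner_eq]
  ring

/-- The outward normals `m i` of four faces of a solid with a 4-face embedding are those of a regular
tetrahedron, here normalized to squared length `3`. -/
theorem exists_normals_of_admitsFaceEmbedding {S W : Set E3}
    (hSW : IsSimilar S (convexHull ℝ W)) (h : AdmitsFaceEmbedding 4 S tetrahedron) :
    ∃ m : Fin 4 → E3, (∀ i, ∃ k, IsFacet W (m i) k) ∧ (∀ i, inner ℝ (m i) (m i) = (3 : ℝ)) ∧
      (∀ i j, i ≠ j → inner ℝ (m i) (m j) = (-1 : ℝ)) ∧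
      ∀ x, ∑ i, (inner ℝ (m i) x : ℝ) ^ 2 = 4 * inner ℝ x x := by
  obtain ⟨c, μ, φ, -, -, hfac⟩ := exists_isFacet_of_admitsFaceEmbedding hSW h
  refine ⟨fun i => -φ.symm (tet i), fun i => ⟨_, hfac i⟩, fun i => ?_, fun i j hij => ?_,
    fun x => ?_⟩
  · rw [inner_neg_neg, LinearIsometryEquiv.inner_map_map, inner_tet_self]
  · rw [inner_neg_neg, LinearIsometryEquiv.inner_map_map, inner_tet_of_ne hij]
  · rw [← LinearIsometryEquiv.inner_map_map φ x x, ← sum_inner_tet_sq]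
    refine Finset.sum_congr rfl fun i _ => ?_
    rw [inner_neg_left, neg_sq, ← LinearIsometryEquiv.inner_map_map φ (φ.symm (tet i)),
      LinearIsometryEquiv.apply_symm_apply]

/-! ### Solids without a 4-face embedding -/

/-- A face is not contained in a line. -/
theorem IsFacet.exists_ne {W : Set E3} {m : E3} {h : ℝ} (hf : IsFacet W m h) (hm : m ≠ 0)
    (a b : E3) : ∃ x ∈ W, (inner ℝ m x : ℝ) = h ∧ x ≠ a ∧ x ≠ b := by
  by_contra hcon
  push Not at hcon
  -- A direction other than `m` that does not separate `a` from `b`.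
  obtain ⟨w, hw, h1, h2⟩ := exists_ne_zero_orthogonal m (a - b)
  rw [inner_sub_right, sub_eq_zero] at h2
  obtain ⟨s, rfl⟩ := hf.2 w ⟨inner ℝ w a, fun x hx hxh => by
    by_cases hxa : x = a
    · rw [hxa]
    · rw [hcon x hx hxh hxa, h2]⟩
  rw [inner_smul_left, RCLike.conj_to_real] at h1
  rcases mul_eq_zero.1 h1 with h1 | h1
  · exact hw (by rw [h1, zero_smul])
  · exact hm (inner_self_eq_zero.1 h1)

theorem ne_zero_of_inner_self {m : E3} (h : inner ℝ m m = (3 : ℝ)) : m ≠ 0 := by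
  rintro rfl
  simp at h

/-- The normals of the faces of the tetrahedron are the opposites of the vertices. -/
theorem IsFacet.of_tet {m : E3} {h : ℝ} (hf : IsFacet (range tet) m h)
    (hm : inner ℝ m m = (3 : ℝ)) : h = 1 ∧ ∃ j, m = -tet j := by
  set a : Fin 4 → ℝ := fun j => inner ℝ m (tet j) with ha
  have hle : ∀ j, a j ≤ h := fun j => hf.1 _ ⟨j, rfl⟩
  have hsum : ∑ j, a j = 0 := by
    rw [← sum_inner_tet m]
    exact Finset.sum_congr rfl fun j _ => real_inner_comm _ _
  have hsq : ∑ j, a j ^ 2 = 12 := by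
    rw [show (12 : ℝ) = 4 * inner ℝ m m by rw [hm]; norm_num, ← sum_inner_tet_sq m]
    exact Finset.sum_congr rfl fun j _ => by rw [ha, real_inner_comm]
  -- The values `a j` of the normal at the vertices have the sum `0` and the sum of squares `12`.
  -- All but one of them are equal to `h`, since a face has at least three vertices.
  obtain ⟨j, hj⟩ : ∃ j, a j ≠ h := by
    by_contra! hcon
    simp only [hcon, Fin.sum_univ_four] at hsum hsq
    have : h = 0 := by linarith
    rw [this] at hsq
    norm_num at hsq
  have huniq : ∀ k, k ≠ j → a k = h := by
    intro k hkj
    by_contra hk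
    obtain ⟨p, q, hpq⟩ : ∃ p q : Fin 4, ∀ l, l = k ∨ l = j ∨ l = p ∨ l = q := by
      have : ∀ k j : Fin 4, k ≠ j → ∃ p q : Fin 4, ∀ l, l = k ∨ l = j ∨ l = p ∨ l = q := by
        decide
      exact this k j hkj
    obtain ⟨_, ⟨l, rfl⟩, hl, hp, hq⟩ := hf.exists_ne (ne_zero_of_inner_self hm) (tet p) (tet q)
    rcases hpq l with rfl | rfl | rfl | rfl
    exacts [hk hl, hj hl, hp rfl, hq rfl]
  have e1 : ∑ k, (a k - h) = a j - h :=
    Finset.sum_eq_single j (fun k _ hk => by rw [huniq k hk, sub_self]) (by simp)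
  have e2 : ∑ k, (a k ^ 2 - h ^ 2) = a j ^ 2 - h ^ 2 :=
    Finset.sum_eq_single j (fun k _ hk => by rw [huniq k hk, sub_self]) (by simp)
  rw [Finset.sum_sub_distrib, hsum] at e1
  rw [Finset.sum_sub_distrib, hsq] at e2
  simp only [Finset.sum_const, Finset.card_univ, Fintype.card_fin, nsmul_eq_mul] at e1 e2
  push_cast at e1 e2
  have haj : a j = -3 * h := by linarith
  have h0 : 0 ≤ h := by linarith [hle j]
  have h1 : h = 1 := by
    rw [haj] at e2
    have : (h - 1) * (h + 1) = 0 := by linarith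
    rcases mul_eq_zero.1 this with h' | h' <;> linarith
  refine ⟨h1, j, ?_⟩
  rw [← sub_eq_zero, ← inner_self_eq_zero (𝕜 := ℝ), sub_neg_eq_add, inner_add_left,
    inner_add_right, inner_add_right, hm, inner_tet_self, real_inner_comm m (tet j)]
  have : (inner ℝ m (tet j) : ℝ) = -3 := by
    change a j = -3
    rw [haj, h1]; norm_num
  rw [this]; norm_num

/-- A smaller tetrahedron inside the tetrahedron cannot touch all four of its faces in a face. -/
theorem not_admitsFaceEmbedding_tetrahedron {S : Set E3} (hS : IsSimilar S tetrahedron) :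
    ¬ AdmitsFaceEmbedding 4 S tetrahedron := by
  intro h
  rw [tetrahedron_eq_convexHull] at hS
  obtain ⟨c, μ, φ, hμ, hsub, hfac⟩ := exists_isFacet_of_admitsFaceEmbedding hS h
  have key := fun i => (hfac i).of_tet (by
    rw [inner_neg_neg, LinearIsometryEquiv.inner_map_map, inner_tet_self])
  -- The planes of the four faces have the same distances from the origin as those of the
  -- tetrahedron, so that the similarity maps the tetrahedron onto itself.
  have hμi : ∀ i, 1 + (inner ℝ (tet i) c : ℝ) = μ := fun i => by
    have := (key i).1
    rwa [div_eq_iff hμ.ne', one_mul] at this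
  have hsum := sum_inner_tet c
  rw [Fin.sum_univ_four] at hsum
  have hμ1 : μ = 1 := by linarith [hμi 0, hμi 1, hμi 2, hμi 3]
  have hc : c = 0 := by
    have h1 := sum_inner_tet_sq c
    have h2 : ∀ i, (inner ℝ (tet i) c : ℝ) = 0 := fun i => by linarith [hμi i]
    simp only [h2] at h1
    norm_num at h1
    exact h1
  refine hsub.2 ?_
  rw [tetrahedron_eq_convexHull]
  refine convexHull_mono ?_
  rintro _ ⟨i, rfl⟩
  obtain ⟨j, hj⟩ := (key i).2
  refine ⟨tet j, mem_range_self j, ?_⟩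
  beta_reduce
  rw [← neg_inj.1 hj, hc, hμ1, LinearIsometryEquiv.apply_symm_apply, zero_add, one_smul]

/-- The normals of the faces of the cube are parallel to the coordinate axes. -/
theorem IsFacet.of_cube {m : E3} {h : ℝ} (hf : IsFacet cubeVertices m h) {i j : Fin 3}
    (hi : m i ≠ 0) (hij : j ≠ i) : m j = 0 := by
  have hcoord : ∀ x : E3, (inner ℝ (EuclideanSpace.single i (1 : ℝ)) x : ℝ) = x i := fun x => by
    rw [EuclideanSpace.inner_single_left]; simp
  -- If a vertex is on the face, its reflection in the `i`-th coordinate is not beyond the face; so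
  -- the `i`-th coordinates of the vertices on the face are all equal.
  have hsign : ∀ x ∈ cubeVertices, (inner ℝ m x : ℝ) = h → 0 ≤ m i * x i := by
    intro x hx hxh
    have hmem : x - (2 * x i) • EuclideanSpace.single i (1 : ℝ) ∈ cubeVertices := by
      intro k
      by_cases hk : k = i
      · subst hk
        have : x k - 2 * x k = -x k := by ring
        simp [this, hx k]
      · simp [hk, hx k]
    have := hf.1 _ hmem
    rw [inner_sub_right, hxh, inner_smul_right, real_inner_comm, hcoord] at this
    linarith
  obtain ⟨s, hs⟩ := hf.2 (EuclideanSpace.single i 1) ⟨|m i| / m i, fun x hx hxh => by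
    rw [hcoord, eq_div_iff hi, ← abs_of_nonneg (hsign x hx hxh |>.trans_eq (mul_comm _ _)),
      abs_mul, hx i, one_mul]⟩
  have h1 := congrArg (fun v : E3 => v i) hs
  have h2 := congrArg (fun v : E3 => v j) hs
  simp [hij] at h1 h2
  rcases h2 with h2 | h2
  · rw [h2, zero_mul] at h1
    exact absurd h1 one_ne_zero
  · exact h2

/-- The inner products of normals of a cube of squared length `3` are `0` or `±3`, never `-1`. -/
theorem not_admitsFaceEmbedding_cube {S : Set E3} (hS : IsSimilar S cube) :
    ¬ AdmitsFaceEmbedding 4 S tetrahedron := by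
  intro h
  obtain ⟨m, hfac, hself, hne, -⟩ := exists_normals_of_admitsFaceEmbedding (W := cubeVertices) hS h
  have axis : ∀ a, ∃ i : Fin 3, m a i ^ 2 = 3 ∧ ∀ j, j ≠ i → m a j = 0 := by
    intro a
    obtain ⟨k, hk⟩ := hfac a
    obtain ⟨i, hi⟩ : ∃ i, m a i ≠ 0 := by
      by_contra! hcon
      exact ne_zero_of_inner_self (hself a) (by ext i; exact hcon i)
    have h0 : ∀ j, j ≠ i → m a j = 0 := fun j hj => hk.of_cube hi hj
    refine ⟨i, ?_, h0⟩
    rw [← hself a, PiLp.inner_apply, Finset.sum_eq_single i (fun j _ hj => by simp [h0 j hj])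
      (by simp)]
    simp [sq]
  obtain ⟨i, hi, hi0⟩ := axis 0
  obtain ⟨j, hj, hj0⟩ := axis 1
  have h01 := hne 0 1 (by decide)
  rw [PiLp.inner_apply, Finset.sum_eq_single i (fun k _ hk => by simp [hi0 k hk]) (by simp)] at h01
  simp only [RCLike.inner_apply, conj_trivial] at h01
  by_cases hij : i = j
  · subst hij
    have : (m 1 i * m 0 i) ^ 2 = 9 := by rw [mul_pow, hi, hj]; norm_num
    rw [h01] at this
    norm_num at this
  · rw [hj0 i hij, zero_mul] at h01
    norm_num at h01

/-- A face of the hull of two parallel polygons is one of the two polygons or meets both. -/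
theorem IsFacet.of_twoPolygons {n : ℕ} {ρ h δ : ℝ} {m : E3} {k : ℝ}
    (hf : IsFacet (twoPolygons n ρ h δ) m k) : (m 0 = 0 ∧ m 1 = 0) ∨
      (∃ r : ℕ, r < n ∧ (inner ℝ m (circlePoint ρ h (2 * π * r / n)) : ℝ) = k) ∧
      ∃ r : ℕ, r < n ∧ (inner ℝ m (circlePoint ρ (-h) (δ + 2 * π * r / n)) : ℝ) = k := by
  have key : (∃ z, ∀ x ∈ twoPolygons n ρ h δ, (inner ℝ m x : ℝ) = k → x 2 = z) →
      m 0 = 0 ∧ m 1 = 0 := by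
    rintro ⟨z, hz⟩
    obtain ⟨s, hs⟩ := hf.2 !₂[0, 0, 1] ⟨z, fun x hx hxk => by
      rw [inner_eq]
      simpa using hz x hx hxk⟩
    have h0 := congrArg (fun v : E3 => v 0) hs
    have h1 := congrArg (fun v : E3 => v 1) hs
    have h2 := congrArg (fun v : E3 => v 2) hs
    simp at h0 h1 h2
    have hs0 : s ≠ 0 := by
      rintro rfl
      simp at h2
    exact ⟨h0.resolve_left hs0, h1.resolve_left hs0⟩
  by_cases htop : ∃ r : ℕ, r < n ∧ (inner ℝ m (circlePoint ρ h (2 * π * r / n)) : ℝ) = k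
  · by_cases hbot : ∃ r : ℕ, r < n ∧
        (inner ℝ m (circlePoint ρ (-h) (δ + 2 * π * r / n)) : ℝ) = k
    · exact .inr ⟨htop, hbot⟩
    · refine .inl (key ⟨h, ?_⟩)
      rintro x ⟨r, hr, rfl | rfl⟩ hx
      · rfl
      · exact absurd ⟨r, hr, hx⟩ hbot
  · refine .inl (key ⟨-h, ?_⟩)
    rintro x ⟨r, hr, rfl | rfl⟩ hx
    · exact absurd ⟨r, hr, hx⟩ htop
    · rfl

/-- The normals of a prism are horizontal or vertical, whereas the squares of the vertical
coordinates of four tetrahedral normals of squared length `3` have the sum `4`. -/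
theorem not_admitsFaceEmbedding_prism {S : Set E3} {n : ℕ} (hn : 3 ≤ n)
    (hS : IsSimilar S (prism n)) : ¬ AdmitsFaceEmbedding 4 S tetrahedron := by
  intro h
  have hs : 0 < sin (π / n) := sin_pos_of_pos_of_lt_pi (pi_div_pos hn)
    (by linarith [three_mul_pi_div_le hn, pi_div_pos hn])
  have hW := isSimilar_prism_of_height (n := n) one_pos (LinearIsometryEquiv.refl ℝ E3)
  rw [LinearIsometryEquiv.coe_refl, image_id, one_mul] at hW
  obtain ⟨m, hfac, hself, -, hsum⟩ := exists_normals_of_admitsFaceEmbedding (hS.trans hW.symm) h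
  -- The lateral faces are vertical, the others horizontal.
  have hz : ∀ i, m i 2 ^ 2 = 0 ∨ m i 2 ^ 2 = 3 := by
    intro i
    obtain ⟨k, hk⟩ := hfac i
    rcases hk.of_twoPolygons with ⟨h0, h1⟩ | ⟨⟨r, hr, hrk⟩, r', hr', hrk'⟩
    · right
      have := hself i
      rw [inner_eq, h0, h1] at this
      linarith
    · left
      have l1 := hk.1 _ ⟨r, hr, .inr rfl⟩
      have l2 := hk.1 _ ⟨r', hr', .inl rfl⟩
      simp only [inner_eq, circlePoint_zero, circlePoint_one, circlePoint_two, zero_add]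
        at l1 l2 hrk hrk'
      have l3 : 0 ≤ m i 2 * sin (π / n) := by linarith
      have l4 : m i 2 * sin (π / n) ≤ 0 := by linarith
      rw [pow_eq_zero_iff two_ne_zero]
      exact (mul_eq_zero.1 (le_antisymm l4 l3)).resolve_right hs.ne'
  have h4 := hsum !₂[0, 0, 1]
  simp only [Fin.sum_univ_four, inner_eq] at h4
  simp at h4
  rcases hz 0 with e0 | e0 <;> rcases hz 1 with e1 | e1 <;> rcases hz 2 with e2 | e2 <;>
    rcases hz 3 with e3 | e3 <;> rw [e0, e1, e2, e3] at h4 <;> norm_num at h4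

/-- In the direction of the angle `β`, a regular polygon reaches at least as far as the midpoints of
its sides. -/
theorem exists_cos_le {n : ℕ} (hn : 3 ≤ n) (β : ℝ) :
    ∃ r : ℕ, r < n ∧ cos (π / n) ≤ cos (2 * π * r / n - β) := by
  have hα := pi_div_pos hn
  have h3α := three_mul_pi_div_le hn
  set α := π / n with hαdef
  set j := round (β / (2 * α)) with hj
  obtain ⟨r, hr, q, hq⟩ := exists_lt_eq_mul_add (by omega : 0 < n) j
  refine ⟨r, hr, ?_⟩
  have hround := abs_sub_round (β / (2 * α))
  rw [← hj] at hround
  have habs : |β - j * (2 * α)| ≤ α := by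
    have e : β - j * (2 * α) = (β / (2 * α) - j) * (2 * α) := by field_simp
    rw [e, abs_mul, abs_of_pos (by linarith : 0 < 2 * α)]
    have := mul_le_mul_of_nonneg_right hround (by linarith : 0 ≤ 2 * α)
    linarith
  have hn0 : (n : ℝ) ≠ 0 := by exact_mod_cast (by omega : n ≠ 0)
  have e : 2 * π * r / n - β = -(β - j * (2 * α)) - q * (2 * π) := by
    rw [hq, hαdef]; push_cast; field_simp; ring
  rw [e, cos_sub_int_mul_two_pi, cos_neg, ← cos_abs (β - j * (2 * α))]
  exact cos_le_cos_of_nonneg_of_le_pi (abs_nonneg _) (by linarith) habs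

/-- The lateral faces of an antiprism are so steep that they do not form the angle of the
tetrahedron with the bases. -/
theorem IsFacet.of_antiprism {n : ℕ} (hn : 4 ≤ n) {H : ℝ}
    (hHH : H ^ 2 = sin (π / n) ^ 2 - sin (π / (2 * n)) ^ 2) {m : E3} {k : ℝ}
    (hf : IsFacet (twoPolygons n 1 H (π / n)) m k) (hm : inner ℝ m m = (3 : ℝ)) :
    (m 0 = 0 ∧ m 1 = 0) ∨ m 2 ^ 2 < 1 / 3 := by
  rcases hf.of_twoPolygons with h | ⟨⟨r, hr, hrk⟩, r', hr', hrk'⟩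
  · exact .inl h
  right
  -- The length and the angle `β` of the horizontal part of the normal.
  set P := √(m 0 * m 0 + m 1 * m 1) with hP
  have hP0 : 0 ≤ P := sqrt_nonneg _
  have hPP : m 0 * m 0 + m 1 * m 1 = P ^ 2 :=
    (sq_sqrt (add_nonneg (mul_self_nonneg _) (mul_self_nonneg _))).symm
  obtain ⟨β, hβ0, hβ1⟩ := exists_angle hP0 hPP
  have hval : ∀ z θ, (inner ℝ m (circlePoint 1 z θ) : ℝ) = P * cos (θ - β) + m 2 * z := by
    intro z θ
    rw [inner_eq, circlePoint_zero, circlePoint_one, circlePoint_two, hβ0, hβ1, cos_sub]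
    ring
  obtain ⟨s, hs, hsβ⟩ := exists_cos_le (by omega : 3 ≤ n) β
  obtain ⟨s', hs', hsβ'⟩ := exists_cos_le (by omega : 3 ≤ n) (β - π / n)
  have l1 := hf.1 _ ⟨s, hs, .inl rfl⟩
  have l2 := hf.1 _ ⟨s', hs', .inr rfl⟩
  rw [hval] at l1 l2 hrk hrk'
  rw [show 2 * π * s' / n - (β - π / n) = π / n + 2 * π * s' / n - β by ring] at hsβ'
  set y := cos (π / n) with hy
  have k1 := mul_le_mul_of_nonneg_left hsβ hP0
  have k2 := mul_le_mul_of_nonneg_left hsβ' hP0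
  have k3 := mul_le_mul_of_nonneg_left (cos_le_one (2 * π * r / n - β)) hP0
  have k4 := mul_le_mul_of_nonneg_left (cos_le_one (π / n + 2 * π * r' / n - β)) hP0
  have hα := pi_div_pos (by omega : 3 ≤ n)
  have hn4 : (4 : ℝ) ≤ n := by exact_mod_cast hn
  have hα4 : 4 * (π / n) ≤ π := by
    have := mul_le_mul_of_nonneg_right hn4 hα.le
    rwa [natCast_mul_pi_div (by omega : 3 ≤ n)] at this
  have hy2 : 1 / 2 < y := by
    rw [hy, ← cos_pi_div_three]
    exact cos_lt_cos_of_nonneg_of_le_pi hα.le (by linarith [pi_pos]) (by linarith [pi_pos])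
  have hy1 : y < 1 := by
    rw [hy, ← cos_zero]
    exact cos_lt_cos_of_nonneg_of_le_pi le_rfl (by linarith) (by linarith)
  -- With `y = cos (π / n)`, the height of the antiprism is given by `2 * H ^ 2 = (1 - y) * (1 + 2 *
  -- y)`, and `y > 1 / 2` since `n ≥ 4`.
  have hH' : 2 * H ^ 2 = (1 - y) * (1 + 2 * y) := by
    have : y = 1 - 2 * sin (π / (2 * n)) ^ 2 := by
      rw [hy, show π / n = 2 * (π / (2 * n)) by ring, cos_two_mul, cos_sq']; ring
    have h2 := sin_sq_add_cos_sq (π / n)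
    rw [← hy] at h2
    linear_combination 2 * hHH + 2 * h2 - this
  -- Compare the two polygons in the direction of the normal.
  have habs : |2 * (m 2 * H)| ≤ P * (1 - y) := abs_le.2 ⟨by linarith, by linarith⟩
  have hsq : 4 * (m 2 ^ 2 * H ^ 2) ≤ P ^ 2 * (1 - y) ^ 2 := by
    have := pow_le_pow_left₀ (abs_nonneg _) habs 2
    rw [sq_abs] at this
    linarith
  have hz : 2 * m 2 ^ 2 * (1 + 2 * y) ≤ P ^ 2 * (1 - y) := by
    refine le_of_mul_le_mul_right ?_ (by linarith : 0 < 1 - y)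
    have : 2 * m 2 ^ 2 * (1 + 2 * y) * (1 - y) = 4 * (m 2 ^ 2 * H ^ 2) := by
      linear_combination -2 * m 2 ^ 2 * hH'
    rw [this]
    linarith
  rw [inner_eq, hPP] at hm
  have z0 := sq_nonneg (m 2)
  have k5 : 0 ≤ m 2 ^ 2 * (2 * y - 1) := mul_nonneg z0 (by linarith)
  have hP2 : 0 < P ^ 2 := by
    refine lt_of_le_of_ne (sq_nonneg P) fun h0 => ?_
    rw [← h0] at hz hm
    linarith
  have k6 : 0 < P ^ 2 * (2 * y - 1) := mul_pos hP2 (by linarith)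
  linarith

theorem antiprism_height_pos {n : ℕ} (hn : 3 ≤ n) :
    0 < sin (π / n) ^ 2 - sin (π / (2 * n)) ^ 2 := by
  have hα := pi_div_pos hn
  have h3α := three_mul_pi_div_le hn
  have e : π / (2 * n) = π / n / 2 := by ring
  rw [e, sub_pos]
  have h0 : 0 < sin (π / n / 2) := sin_pos_of_pos_of_lt_pi (by linarith) (by linarith)
  exact pow_lt_pow_left₀ (sin_lt_sin_of_lt_of_le_pi_div_two (by linarith) (by linarith)
    (by linarith)) h0.le two_ne_zero

/-- The squares of the vertical coordinates of the four normals have the sum `4`, so that one of the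
normals is vertical. By `IsFacet.of_antiprism`, no other one has the inner product `-1` with it. -/
theorem not_admitsFaceEmbedding_antiprism {S : Set E3} {n : ℕ} (hn : 4 ≤ n)
    (hS : IsSimilar S (antiprism n)) : ¬ AdmitsFaceEmbedding 4 S tetrahedron := by
  intro h
  have hpos := antiprism_height_pos (by omega : 3 ≤ n)
  set H := √(sin (π / n) ^ 2 - sin (π / (2 * n)) ^ 2) with hHdef
  have hH : 0 < H := sqrt_pos.2 hpos
  have hHH : H ^ 2 = sin (π / n) ^ 2 - sin (π / (2 * n)) ^ 2 := sq_sqrt hpos.le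
  have hW := isSimilar_antiprism_of_height (n := n) one_pos hH (by rw [hHH]; ring)
    (LinearIsometryEquiv.refl ℝ E3)
  rw [LinearIsometryEquiv.coe_refl, image_id] at hW
  obtain ⟨m, hfac, hself, hne, hsum⟩ := exists_normals_of_admitsFaceEmbedding (hS.trans hW.symm) h
  have hz : ∀ i, (m i 0 = 0 ∧ m i 1 = 0) ∨ m i 2 ^ 2 < 1 / 3 := fun i => by
    obtain ⟨k, hk⟩ := hfac i
    exact hk.of_antiprism hn hHH (hself i)
  have hvert : ∀ i, m i 0 = 0 ∧ m i 1 = 0 → m i 2 ^ 2 = 3 := fun i hi => by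
    have := hself i
    rw [inner_eq, hi.1, hi.2] at this
    linarith
  obtain ⟨i, hi⟩ : ∃ i, m i 0 = 0 ∧ m i 1 = 0 := by
    by_contra hcon
    have hlt : ∀ i, m i 2 ^ 2 < 1 / 3 := fun i => (hz i).resolve_left fun hi => hcon ⟨i, hi⟩
    have h4 := hsum !₂[0, 0, 1]
    simp only [Fin.sum_univ_four, inner_eq] at h4
    simp at h4
    linarith [hlt 0, hlt 1, hlt 2, hlt 3]
  obtain ⟨j, hj⟩ := exists_ne i
  have hij := hne i j hj.symm
  rw [inner_eq, hi.1, hi.2] at hij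
  have h1 : m i 2 ^ 2 * m j 2 ^ 2 = 1 := by
    rw [← mul_pow, show m i 2 * m j 2 = -1 by linarith]; norm_num
  rw [hvert i hi] at h1
  rcases hz j with h2 | h2
  · rw [hvert j h2] at h1
    norm_num at h1
  · linarith

/-- The uniform triangular antiprism is a regular octahedron. -/
theorem isSimilar_antiprism_three : IsSimilar (antiprism 3) octahedron := by
  have hpos := antiprism_height_pos (le_refl 3)
  have e6 : π / (2 * (3 : ℕ)) = π / 6 := by push_cast; ring
  have hs3 : sin (π / (3 : ℕ)) ^ 2 - sin (π / (2 * (3 : ℕ))) ^ 2 = 1 / 2 := by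
    rw [e6, sin_pi_div_six, Nat.cast_ofNat, sin_pi_div_three, div_pow, sq_sqrt (by norm_num)]
    norm_num
  obtain ⟨H, hH, hHH⟩ : ∃ H : ℝ, 0 < H ∧ H * H = 1 / 2 :=
    ⟨√(1 / 2), sqrt_pos.2 (by norm_num), mul_self_sqrt (by norm_num)⟩
  have hW := isSimilar_antiprism_of_height (n := 3) one_pos hH
    (by rw [hs3, sq, hHH]; norm_num) (LinearIsometryEquiv.refl ℝ E3)
  rw [LinearIsometryEquiv.coe_refl, image_id] at hW
  obtain ⟨q, hq, hqq⟩ : ∃ q : ℝ, 0 < q ∧ q * q = 3 :=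
    ⟨√3, sqrt_pos.2 (by norm_num), mul_self_sqrt (by norm_num)⟩
  obtain ⟨μ, hμ, hμμ⟩ : ∃ μ : ℝ, 0 < μ ∧ μ * μ = 3 / 2 :=
    ⟨√(3 / 2), sqrt_pos.2 (by norm_num), mul_self_sqrt (by norm_num)⟩
  have hs : sin (π / 3) = q / 2 := by
    rw [sin_pi_div_three, ← hqq, sqrt_mul_self hq.le]
  have hc := cos_pi_div_three
  have hμ0 : μ ≠ 0 := hμ.ne'
  have hinv : μ⁻¹ * μ⁻¹ * (3 / 2) = 1 := by rw [← hμμ]; field_simp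
  -- Opposite vertices span three orthogonal lines.
  set a : E3 := !₂[1, 0, H] with ha
  set b : E3 := !₂[-1 / 2, q / 2, H] with hb
  set d : E3 := !₂[-1 / 2, -q / 2, H] with hd
  obtain ⟨φ, hφ⟩ := exists_isometry_of_frame (μ⁻¹ • a) (μ⁻¹ • b) (μ⁻¹ • d)
    (by rw [inner_smul_left, inner_smul_right, inner_eq]; simp [ha];
        linear_combination hinv + μ⁻¹ * μ⁻¹ * hHH)
    (by rw [inner_smul_left, inner_smul_right, inner_eq]; simp [hb];
        linear_combination hinv + μ⁻¹ * μ⁻¹ * (hHH + hqq / 4))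
    (by rw [inner_smul_left, inner_smul_right, inner_eq]; simp [hd];
        linear_combination hinv + μ⁻¹ * μ⁻¹ * (hHH + hqq / 4))
    (by rw [inner_smul_left, inner_smul_right, inner_eq]; simp [ha, hb]; right;
        linear_combination hHH)
    (by rw [inner_smul_left, inner_smul_right, inner_eq]; simp [ha, hd]; right;
        linear_combination hHH)
    (by rw [inner_smul_left, inner_smul_right, inner_eq]; simp [hb, hd]; right
        linear_combination hHH - hqq / 4)
  have hφ' : ∀ x : E3, (0 : E3) + μ • φ x = x 0 • a + x 1 • b + x 2 • d := by
    intro x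
    rw [hφ, zero_add]
    simp only [smul_add, smul_smul]
    rw [show ∀ s : ℝ, μ * (s * μ⁻¹) = s from fun s => by field_simp,
      show ∀ s : ℝ, μ * (s * μ⁻¹) = s from fun s => by field_simp,
      show ∀ s : ℝ, μ * (s * μ⁻¹) = s from fun s => by field_simp]
  have top0 : circlePoint 1 H (2 * π * (0 : ℕ) / (3 : ℕ)) = a := by
    apply ext_coord <;> simp [ha]
  have top1 : circlePoint 1 H (2 * π * (1 : ℕ) / (3 : ℕ)) = b := by
    have e : 2 * π * (1 : ℕ) / (3 : ℕ) = π - π / 3 := by push_cast; ring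
    rw [e]
    apply ext_coord <;> simp [hb, cos_pi_sub, sin_pi_sub, hs, hc]; norm_num
  have top2 : circlePoint 1 H (2 * π * (2 : ℕ) / (3 : ℕ)) = d := by
    have e : 2 * π * (2 : ℕ) / (3 : ℕ) = π / 3 + π := by push_cast; ring
    rw [e]
    apply ext_coord <;> simp [hd, cos_add_pi, sin_add_pi, hs, hc] <;> ring
  have bot0 : circlePoint 1 (-H) (π / (3 : ℕ) + 2 * π * (0 : ℕ) / (3 : ℕ)) = -d := by
    have e : π / (3 : ℕ) + 2 * π * (0 : ℕ) / (3 : ℕ) = π / 3 := by push_cast; ring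
    rw [e]
    apply ext_coord <;> simp [hd, hs, hc] <;> ring
  have bot1 : circlePoint 1 (-H) (π / (3 : ℕ) + 2 * π * (1 : ℕ) / (3 : ℕ)) = -a := by
    have e : π / (3 : ℕ) + 2 * π * (1 : ℕ) / (3 : ℕ) = π := by push_cast; ring
    rw [e]
    apply ext_coord <;> simp [ha]
  have bot2 : circlePoint 1 (-H) (π / (3 : ℕ) + 2 * π * (2 : ℕ) / (3 : ℕ)) = -b := by
    have e : π / (3 : ℕ) + 2 * π * (2 : ℕ) / (3 : ℕ) = 2 * π - π / 3 := by push_cast; ring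
    rw [e]
    apply ext_coord <;> simp [hb, cos_two_pi_sub, sin_two_pi_sub, hs, hc]; ring
  refine hW.symm.trans (IsSimilar.symm ?_)
  change IsSimilar (convexHull ℝ octahedronVertices) _
  have main := isSimilar_convexHull_image octahedronVertices 0 hμ0 φ
  convert main using 2
  ext y
  simp only [hφ']
  constructor
  · have vert : ∀ i : Fin 3, ∀ s : ℝ, |s| = 1 →
        EuclideanSpace.single i s ∈ octahedronVertices := by
      intro i s hs
      refine ⟨i, ?_, ?_, ?_⟩ <;> fin_cases i <;> simp [hs]
    rintro ⟨r, hr, rfl | rfl⟩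
    · interval_cases r
      · exact ⟨_, vert 0 1 (by simp), by rw [top0]; simp⟩
      · exact ⟨_, vert 1 1 (by simp), by rw [top1]; simp⟩
      · exact ⟨_, vert 2 1 (by simp), by rw [top2]; simp⟩
    · interval_cases r
      · exact ⟨_, vert 2 (-1) (by simp), by rw [bot0]; simp⟩
      · exact ⟨_, vert 0 (-1) (by simp), by rw [bot1]; simp⟩
      · exact ⟨_, vert 1 (-1) (by simp), by rw [bot2]; simp⟩
  · rintro ⟨x, ⟨i, h1, h2, h3⟩, rfl⟩
    fin_cases i <;> simp at h1 h2 h3 <;> beta_reduce <;> rw [h2, h3] <;>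
      rcases (abs_eq one_pos.le).1 h1 with h | h <;> rw [h]
    · exact ⟨0, by norm_num, .inl (by rw [top0]; simp)⟩
    · exact ⟨1, by norm_num, .inr (by rw [bot1]; simp)⟩
    · exact ⟨1, by norm_num, .inl (by rw [top1]; simp)⟩
    · exact ⟨2, by norm_num, .inr (by rw [bot2]; simp)⟩
    · exact ⟨2, by norm_num, .inl (by rw [top2]; simp)⟩
    · exact ⟨0, by norm_num, .inr (by rw [bot0]; simp)⟩

/-! ### The dodecahedron -/

theorem IsFacet.map {W : Set E3} {m : E3} {h : ℝ} (hf : IsFacet W m h) (ψ : E3 ≃ₗᵢ[ℝ] E3)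
    (hψ : ∀ x, x ∈ W ↔ ψ x ∈ W) : IsFacet W (ψ m) h := by
  have hinner : ∀ v x, (inner ℝ (ψ v) x : ℝ) = inner ℝ v (ψ.symm x) := fun v x => by
    rw [← LinearIsometryEquiv.inner_map_map ψ v, LinearIsometryEquiv.apply_symm_apply]
  refine ⟨fun x hx => ?_, fun w => ?_⟩
  · rw [hinner]
    exact hf.1 _ ((hψ _).2 (by rwa [LinearIsometryEquiv.apply_symm_apply]))
  · rintro ⟨k, hk⟩
    obtain ⟨s, hs⟩ := hf.2 (ψ.symm w) ⟨k, fun x hx hxh => by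
      rw [← hk (ψ x) ((hψ x).1 hx) (by rw [LinearIsometryEquiv.inner_map_map, hxh]),
        ← LinearIsometryEquiv.inner_map_map ψ, LinearIsometryEquiv.apply_symm_apply]⟩
    exact ⟨s, by rw [← map_smul, ← hs, LinearIsometryEquiv.apply_symm_apply]⟩

theorem eq_of_mul_le_mul {a x p : ℝ} (ha : 0 < a) (hx : x ≤ p) (h : a * p ≤ a * x) : x = p :=
  le_antisymm hx (le_of_mul_le_mul_left h ha)

theorem mem_dodecahedronVertices_iff {x : E3} : x ∈ dodecahedronVertices ↔
    (|x 0| = 1 ∧ |x 1| = 1 ∧ |x 2| = 1) ∨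
      (x 0 = 0 ∧ |x 1| = goldenRatio - 1 ∧ |x 2| = goldenRatio) ∨
      (x 1 = 0 ∧ |x 2| = goldenRatio - 1 ∧ |x 0| = goldenRatio) ∨
      (x 2 = 0 ∧ |x 0| = goldenRatio - 1 ∧ |x 1| = goldenRatio) := by
  simp only [dodecahedronVertices, goldenRatio_inv_eq]
  simp [Fin.forall_fin_succ, Fin.exists_fin_succ]

/-- The supporting inequalities at the four vertices in the closed positive octant. -/
theorem inner_le_of_isFacet_dodecahedron {m : E3} {h : ℝ}
    (hf : IsFacet dodecahedronVertices m h) :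
    m 0 + m 1 + m 2 ≤ h ∧ (goldenRatio - 1) * m 1 + goldenRatio * m 2 ≤ h ∧
      (goldenRatio - 1) * m 2 + goldenRatio * m 0 ≤ h ∧
      (goldenRatio - 1) * m 0 + goldenRatio * m 1 ≤ h := by
  have hf0 := goldenRatio_pos
  have hf1 := one_lt_goldenRatio
  have e1 : |goldenRatio - 1| = goldenRatio - 1 := abs_of_pos (by linarith)
  have e2 : |goldenRatio| = goldenRatio := abs_of_pos hf0
  have l0 := hf.1 !₂[1, 1, 1] (mem_dodecahedronVertices_iff.2 (by simp))
  have l1 := hf.1 !₂[0, goldenRatio - 1, goldenRatio]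
    (mem_dodecahedronVertices_iff.2 (by simp [e1, e2]))
  have l2 := hf.1 !₂[goldenRatio, 0, goldenRatio - 1]
    (mem_dodecahedronVertices_iff.2 (by simp [e1, e2]))
  have l3 := hf.1 !₂[goldenRatio - 1, goldenRatio, 0]
    (mem_dodecahedronVertices_iff.2 (by simp [e1, e2]))
  simp [inner_eq] at l0 l1 l2 l3
  exact ⟨by linarith, by linarith, by linarith, by linarith⟩

/-- A face of the dodecahedron whose normal lies in a coordinate plane is one of the twelve
pentagons. -/
theorem eq_of_isFacet_dodecahedron_of_zero {m : E3} {h : ℝ} (hm : m ≠ 0)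
    (hf : IsFacet dodecahedronVertices m h) (h0 : m 0 = 0) (h1 : 0 ≤ m 1) (h2 : 0 ≤ m 2) :
    m 1 = goldenRatio * m 2 := by
  obtain ⟨l0, l1, -, l3⟩ := inner_le_of_isFacet_dodecahedron hf
  have hval : ∀ x : E3, (inner ℝ m x : ℝ) = m 1 * x 1 + m 2 * x 2 := fun x => by
    rw [inner_eq, h0]; ring
  have hpos : 0 < m 1 ∨ 0 < m 2 := by
    by_contra! hcon
    exact hm (ext_coord h0 (le_antisymm hcon.1 h1) (le_antisymm hcon.2 h2))
  rw [h0] at l0 l3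
  have hmem := fun x => mem_dodecahedronVertices_iff (x := x)
  obtain ⟨g, hg⟩ : ∃ g, g = goldenRatio - 1 := ⟨_, rfl⟩
  have hgg : g * g = 1 - g := by rw [hg]; linear_combination goldenRatio_sq
  have hg0 : 0 < g := by linarith [one_lt_goldenRatio]
  have hff : goldenRatio = g + 1 := by linarith
  rw [← hg] at l1 l3
  simp only [← hg] at hmem
  rw [hff] at l1 l3 hmem ⊢
  set b := m 1
  set c := m 2
  by_contra hne
  have gb := mul_nonneg hg0.le h1
  have gc := mul_nonneg hg0.le h2
  -- Any two of the three relevant types of vertices on the face determine its normal.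
  have n01 : ¬(b + c = h ∧ g * b + (g + 1) * c = h) := by
    rintro ⟨e, e'⟩
    refine hne ?_
    linear_combination -(1 + g) ^ 2 * (e' - e) + (b * g + c * (g + 1)) * hgg
  have n03 : ¬(b + c = h ∧ (g + 1) * b = h) := by
    rintro ⟨e, e'⟩
    refine hne ?_
    linear_combination (1 + g) * (e' - e) - b * hgg
  have n13 : ¬(g * b + (g + 1) * c = h ∧ (g + 1) * b = h) := by
    rintro ⟨e, e'⟩
    exact hne (by linarith)
  -- Which vertices can lie on the face, according to their type.
  have hcases : ∀ x ∈ dodecahedronVertices, (inner ℝ m x : ℝ) = h →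
      (b + c = h ∧ |x 0| = 1 ∧ x 1 = 1 ∧ x 2 = 1) ∨
      (g * b + (g + 1) * c = h ∧ x 0 = 0 ∧ |x 1| = g ∧ x 2 = g + 1) ∨
      ((g + 1) * b = h ∧ x 2 = 0 ∧ |x 0| = g ∧ x 1 = g + 1) := by
    intro x hx hxh
    rw [hval] at hxh
    rcases (hmem x).1 hx with ⟨x0, x1, x2⟩ | ⟨x0, x1, x2⟩ | ⟨x1, x2, x0⟩ | ⟨x2, x0, x1⟩
    · left
      have k1 := (le_abs_self (x 1)).trans_eq x1
      have k2 := (le_abs_self (x 2)).trans_eq x2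
      have j1 := mul_le_mul_of_nonneg_left k1 h1
      have j2 := mul_le_mul_of_nonneg_left k2 h2
      have hb : 0 < b := by
        refine lt_of_le_of_ne h1 fun hb => ?_
        rw [← hb] at hpos hxh l1
        have hc := hpos.resolve_left (lt_irrefl _)
        linarith [mul_pos hg0 hc]
      have hc : 0 < c := by
        refine lt_of_le_of_ne h2 fun hc => ?_
        rw [← hc] at hxh
        linarith [mul_pos hg0 hb]
      exact ⟨by linarith, x0, eq_of_mul_le_mul hb k1 (by linarith),
        eq_of_mul_le_mul hc k2 (by linarith)⟩
    · right; left
      have k1 := (le_abs_self (x 1)).trans_eq x1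
      have k2 := (le_abs_self (x 2)).trans_eq x2
      have j1 := mul_le_mul_of_nonneg_left k1 h1
      have j2 := mul_le_mul_of_nonneg_left k2 h2
      have hc : 0 < c := by
        refine lt_of_le_of_ne h2 fun hc => ?_
        rw [← hc] at hpos hxh
        have hb := hpos.resolve_right (lt_irrefl _)
        linarith
      exact ⟨by linarith, x0, x1, eq_of_mul_le_mul hc k2 (by linarith)⟩
    · exfalso
      have k2 := (le_abs_self (x 2)).trans_eq x2
      have j2 := mul_le_mul_of_nonneg_left k2 h2
      rw [x1] at hxh
      rcases hpos with hb | hc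
      · linarith [mul_pos hg0 hb]
      · linarith
    · right; right
      have k1 := (le_abs_self (x 1)).trans_eq x1
      have j1 := mul_le_mul_of_nonneg_left k1 h1
      rw [x2] at hxh
      have hb : 0 < b := by
        refine lt_of_le_of_ne h1 fun hb => ?_
        rw [← hb] at hpos hxh l0
        have hc := hpos.resolve_left (lt_irrefl _)
        linarith
      exact ⟨by linarith, x2, x0, eq_of_mul_le_mul hb k1 (by linarith)⟩
  have habs : ∀ {y z : ℝ}, 0 ≤ z → |y| = z → y = z ∨ y = -z := fun hz hy => (abs_eq hz).1 hy
  -- If only one type occurs, then the face has at most two vertices.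
  by_cases c0 : b + c = h
  · obtain ⟨x, hx, hxh, hx1, hx2⟩ := hf.exists_ne hm !₂[1, 1, 1] !₂[-1, 1, 1]
    rcases hcases x hx hxh with ⟨-, x0, x1, x2⟩ | ⟨e, -⟩ | ⟨e, -⟩
    · rcases habs zero_le_one x0 with x0 | x0
      · exact hx1 (ext_coord x0 x1 x2)
      · exact hx2 (ext_coord x0 x1 x2)
    · exact n01 ⟨c0, e⟩
    · exact n03 ⟨c0, e⟩
  by_cases c1 : g * b + (g + 1) * c = h
  · obtain ⟨x, hx, hxh, hx1, hx2⟩ := hf.exists_ne hm !₂[0, g, g + 1] !₂[0, -g, g + 1]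
    rcases hcases x hx hxh with ⟨e, -⟩ | ⟨-, x0, x1, x2⟩ | ⟨e, -⟩
    · exact c0 e
    · rcases habs hg0.le x1 with x1 | x1
      · exact hx1 (ext_coord x0 x1 x2)
      · exact hx2 (ext_coord x0 x1 x2)
    · exact n13 ⟨c1, e⟩
  · obtain ⟨x, hx, hxh, hx1, hx2⟩ := hf.exists_ne hm !₂[g, g + 1, 0] !₂[-g, g + 1, 0]
    rcases hcases x hx hxh with ⟨e, -⟩ | ⟨e, -⟩ | ⟨-, x2, x0, x1⟩
    · exact c0 e
    · exact c1 e
    · rcases habs hg0.le x0 with x0 | x0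
      · exact hx1 (ext_coord x0 x1 x2)
      · exact hx2 (ext_coord x0 x1 x2)

/-- If among four candidates `vᵢ` with conditions `Pᵢ` there is always one other than two given
points that satisfies its condition, then at least three of the conditions hold. -/
theorem false_of_pairs {α : Type*} {v₀ v₁ v₂ v₃ : α} {P₀ P₁ P₂ P₃ : Prop}
    (pair : ∀ p q, ∃ x, x ≠ p ∧ x ≠ q ∧
      ((P₀ ∧ x = v₀) ∨ (P₁ ∧ x = v₁) ∨ (P₂ ∧ x = v₂) ∨ (P₃ ∧ x = v₃)))
    (h₃ : P₀ → P₁ → P₂ → False) (h₁ : P₀ → P₂ → P₃ → False) (h₂ : P₀ → P₃ → P₁ → False)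
    (h₀ : P₁ → P₂ → P₃ → False) : False := by
  obtain ⟨x, x1, x2, hx⟩ := pair v₀ v₁
  obtain ⟨y, y1, y2, hy⟩ := pair v₀ v₂
  obtain ⟨z, z1, z2, hz⟩ := pair v₀ v₃
  obtain ⟨p, p1, p2, hp⟩ := pair v₁ v₂
  obtain ⟨q, q1, q2, hq⟩ := pair v₁ v₃
  obtain ⟨r, r1, r2, hr⟩ := pair v₂ v₃
  simp only [x1, x2, y1, y2, z1, z2, p1, p2, q1, q2, r1, r2, and_false, false_or, or_false]
    at hx hy hz hp hq hr
  by_cases c : P₀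
  · rcases hx with ⟨c', -⟩ | ⟨c', -⟩
    · rcases hy with ⟨c'', -⟩ | ⟨c'', -⟩
      exacts [h₃ c c'' c', h₁ c c' c'']
    · rcases hz with ⟨c'', -⟩ | ⟨c'', -⟩
      exacts [h₂ c c' c'', h₁ c c'' c']
  · simp only [c, false_and, false_or] at hp hq hr
    exact h₀ hr.1 hq.1 hp.1

/-- A face of the dodecahedron whose normal points into an open octant would contain three of the
four vertices in that octant. These triples do not span faces. -/
theorem not_isFacet_dodecahedron_of_pos {m : E3} {h : ℝ}
    (hf : IsFacet dodecahedronVertices m h) (h0 : 0 < m 0) (h1 : 0 < m 1) (h2 : 0 < m 2) :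
    False := by
  have hm : m ≠ 0 := by
    rintro rfl
    exact lt_irrefl _ h0
  obtain ⟨l0, l1, l2, l3⟩ := inner_le_of_isFacet_dodecahedron hf
  have hval : ∀ x : E3, (inner ℝ m x : ℝ) = m 0 * x 0 + m 1 * x 1 + m 2 * x 2 := inner_eq m
  have hmem := fun x => mem_dodecahedronVertices_iff (x := x)
  have hlt := goldenRatio_lt_two
  obtain ⟨g, hg⟩ : ∃ g, g = goldenRatio - 1 := ⟨_, rfl⟩
  have hgg : g * g = 1 - g := by rw [hg]; linear_combination goldenRatio_sq
  have hg0 : 0 < g := by linarith [one_lt_goldenRatio]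
  have hff : goldenRatio = g + 1 := by linarith
  rw [← hg] at l1 l2 l3
  simp only [← hg] at hmem
  rw [hff] at l1 l2 l3 hmem hlt
  set a := m 0
  set b := m 1
  set c := m 2
  have hcases : ∀ x ∈ dodecahedronVertices, (inner ℝ m x : ℝ) = h →
      (a + b + c = h ∧ x = !₂[1, 1, 1]) ∨
      (g * b + (g + 1) * c = h ∧ x = !₂[0, g, g + 1]) ∨
      (g * c + (g + 1) * a = h ∧ x = !₂[g + 1, 0, g]) ∨
      (g * a + (g + 1) * b = h ∧ x = !₂[g, g + 1, 0]) := by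
    intro x hx hxh
    rw [hval] at hxh
    have hle : ∀ {y z : ℝ}, |y| = z → y ≤ z := fun hy => (le_abs_self _).trans_eq hy
    rcases (hmem x).1 hx with ⟨x0, x1, x2⟩ | ⟨x0, x1, x2⟩ | ⟨x1, x2, x0⟩ | ⟨x2, x0, x1⟩
    · left
      have j0 := mul_le_mul_of_nonneg_left (hle x0) h0.le
      have j1 := mul_le_mul_of_nonneg_left (hle x1) h1.le
      have j2 := mul_le_mul_of_nonneg_left (hle x2) h2.le
      exact ⟨by linarith, ext_coord (eq_of_mul_le_mul (p := 1) h0 (hle x0) (by linarith))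
        (eq_of_mul_le_mul (p := 1) h1 (hle x1) (by linarith))
        (eq_of_mul_le_mul (p := 1) h2 (hle x2) (by linarith))⟩
    · right; left
      rw [x0] at hxh
      have j1 := mul_le_mul_of_nonneg_left (hle x1) h1.le
      have j2 := mul_le_mul_of_nonneg_left (hle x2) h2.le
      exact ⟨by linarith, ext_coord x0
        (eq_of_mul_le_mul (p := g) h1 (hle x1) (by linarith))
        (eq_of_mul_le_mul (p := g + 1) h2 (hle x2) (by linarith))⟩
    · right; right; left
      rw [x1] at hxh
      have j0 := mul_le_mul_of_nonneg_left (hle x0) h0.le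
      have j2 := mul_le_mul_of_nonneg_left (hle x2) h2.le
      exact ⟨by linarith, ext_coord (eq_of_mul_le_mul (p := g + 1) h0 (hle x0) (by linarith)) x1
        (eq_of_mul_le_mul (p := g) h2 (hle x2) (by linarith))⟩
    · right; right; right
      rw [x2] at hxh
      have j0 := mul_le_mul_of_nonneg_left (hle x0) h0.le
      have j1 := mul_le_mul_of_nonneg_left (hle x1) h1.le
      exact ⟨by linarith, ext_coord (eq_of_mul_le_mul (p := g) h0 (hle x0) (by linarith))
        (eq_of_mul_le_mul (p := g + 1) h1 (hle x1) (by linarith)) x2⟩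
  -- The plane of `(1, 1, 1)` and two of the other vertices has its normal on a coordinate plane.
  have key : ∀ a b c : ℝ, 0 < b → a + b + c = h → g * b + (g + 1) * c = h →
      g * c + (g + 1) * a = h → False := by
    intro a b c hb e0 e1 e2
    have : b * (2 * g) = 0 := by
      linear_combination -g * (e1 - e0) - (e2 - e0) + (b + c) * hgg
    exact (mul_pos hb (mul_pos two_pos hg0)).ne' this
  have hnot : ¬(g * b + (g + 1) * c = h ∧ g * c + (g + 1) * a = h ∧ g * a + (g + 1) * b = h) := by
    rintro ⟨e1, e2, e3⟩
    have : 0 < (1 - g) * (a + b + c) := mul_pos (by linarith) (by linarith)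
    linarith
  have pair : ∀ p q, ∃ x, x ≠ p ∧ x ≠ q ∧ ((a + b + c = h ∧ x = !₂[1, 1, 1]) ∨
      (g * b + (g + 1) * c = h ∧ x = !₂[0, g, g + 1]) ∨
      (g * c + (g + 1) * a = h ∧ x = !₂[g + 1, 0, g]) ∨
      (g * a + (g + 1) * b = h ∧ x = !₂[g, g + 1, 0])) := by
    intro p q
    obtain ⟨x, hx, hxh, hp, hq⟩ := hf.exists_ne hm p q
    exact ⟨x, hp, hq, hcases x hx hxh⟩
  refine false_of_pairs pair (key a b c h1) (fun e0 e2 e3 => key b c a h2 (by linarith) e2 e3)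
    (fun e0 e3 e1 => key c a b h0 (by linarith) e3 e1) fun e1 e2 e3 => hnot ⟨e1, e2, e3⟩

/-- The normals of the faces of the dodecahedron are the cyclic permutations of `(0, ±φ, ±1)`, up to
a factor. -/
theorem abs_eq_of_isFacet_dodecahedron {m : E3} {h : ℝ} (hm : m ≠ 0)
    (hf : IsFacet dodecahedronVertices m h) :
    ∃ i : Fin 3, m i = 0 ∧ m (i + 1) ^ 2 = goldenRatio ^ 2 * m (i + 2) ^ 2 := by
  -- Reflections in the coordinate planes move the normal to the closed positive octant.
  set σ : E3 ≃ₗᵢ[ℝ] E3 := LinearIsometryEquiv.piLpCongrRight 2 fun i : Fin 3 =>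
    if m i < 0 then LinearIsometryEquiv.neg ℝ else LinearIsometryEquiv.refl ℝ ℝ with hσ
  have hσabs : ∀ (x : E3) i, |σ x i| = |x i| := by
    intro x i
    by_cases hi : m i < 0 <;> simp [hσ, hi]
  have hσm : ∀ i, σ m i = |m i| := by
    intro i
    by_cases hi : m i < 0
    · simp [hσ, hi, abs_of_neg hi]
    · simp [hσ, hi, abs_of_nonneg (not_lt.1 hi)]
  have hf1 := hf.map σ fun x => by
    have hz : ∀ i, σ x i = 0 ↔ x i = 0 := fun i => by
      rw [← abs_eq_zero, hσabs, abs_eq_zero]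
    simp only [mem_dodecahedronVertices_iff, hσabs, hz]
  obtain ⟨i, hi⟩ : ∃ i, m i = 0 := by
    by_contra! hcon
    refine not_isFacet_dodecahedron_of_pos hf1 ?_ ?_ ?_ <;> rw [hσm] <;>
      exact abs_pos.2 (hcon _)
  -- A cyclic permutation of the coordinates makes the first one vanish.
  set τ : E3 ≃ₗᵢ[ℝ] E3 := LinearIsometryEquiv.piLpCongrLeft 2 ℝ ℝ (Equiv.subRight i) with hτ
  have hτx : ∀ (x : E3) j, τ x j = x (j + i) := fun x j => by
    simp [hτ, Equiv.piCongrLeft']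
  have hf2 := hf1.map τ fun x => by
    simp only [mem_dodecahedronVertices_iff, hτx]
    fin_cases i <;> simp <;> tauto
  have hne : τ (σ m) ≠ 0 := by simpa using hm
  have := eq_of_isFacet_dodecahedron_of_zero hne hf2 (by rw [hτx, hσm, zero_add, hi, abs_zero])
    (by rw [hτx, hσm]; exact abs_nonneg _) (by rw [hτx, hσm]; exact abs_nonneg _)
  rw [hτx, hτx, hσm, hσm, add_comm 1 i, add_comm 2 i] at this
  exact ⟨i, hi, by rw [← sq_abs, this, mul_pow, sq_abs]⟩

theorem inner_eq_add (i : Fin 3) (x y : E3) :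
    (inner ℝ x y : ℝ) = x i * y i + x (i + 1) * y (i + 1) + x (i + 2) * y (i + 2) := by
  rw [inner_eq]
  fin_cases i
  · rfl
  · change _ = x 1 * y 1 + x 2 * y 2 + x 0 * y 0
    ring
  · change _ = x 2 * y 2 + x 0 * y 0 + x 1 * y 1
    ring

/-- Normals of the dodecahedron of squared length `3` have inner products whose squares are `9 / 5`
or `9`, so that none of them is `-1`. -/
theorem not_admitsFaceEmbedding_dodecahedron {S : Set E3} (hS : IsSimilar S dodecahedron) :
    ¬ AdmitsFaceEmbedding 4 S tetrahedron := by
  intro h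
  obtain ⟨m, hfac, hself, hne, -⟩ :=
    exists_normals_of_admitsFaceEmbedding (W := dodecahedronVertices) hS h
  have axis : ∀ a, ∃ i : Fin 3, m a i = 0 ∧ m a (i + 1) ^ 2 = goldenRatio ^ 2 * m a (i + 2) ^ 2 :=
    fun a => by
      obtain ⟨k, hk⟩ := hfac a
      exact abs_eq_of_isFacet_dodecahedron (ne_zero_of_inner_self (hself a)) hk
  obtain ⟨f, hf⟩ : ∃ f, f = goldenRatio := ⟨_, rfl⟩
  have hff : f ^ 2 = f + 1 := by rw [hf, goldenRatio_sq]
  rw [← hf] at axis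
  have hnorm : ∀ a i, m a i = 0 → m a (i + 1) ^ 2 = f ^ 2 * m a (i + 2) ^ 2 →
      (f ^ 2 + 1) * m a (i + 2) ^ 2 = 3 := by
    intro a i h0 h1
    have := hself a
    rw [inner_eq_add i, h0] at this
    linarith
  obtain ⟨i, hi0, hi1⟩ := axis 0
  obtain ⟨j, hj0, hj1⟩ := axis 1
  have hi2 := hnorm 0 i hi0 hi1
  have hj2 := hnorm 1 j hj0 hj1
  set s := m 0 (i + 2) ^ 2 with hs
  have hs' : m 1 (j + 2) ^ 2 = s := by
    have h1 : 0 < f ^ 2 + 1 := by positivity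
    exact mul_left_cancel₀ h1.ne' (hj2.trans hi2.symm)
  rw [hs'] at hj1
  have hss : f ^ 2 * s * s = 9 / 5 := by
    have h1 : ((f ^ 2 + 1) * s) ^ 2 = 9 := by rw [hi2]; norm_num
    have h2 : (f ^ 2 + 1) ^ 2 = 5 * f ^ 2 := by
      linear_combination (f ^ 2 + f - 1) * hff
    rw [mul_pow, h2] at h1
    linarith
  have h01 := hne 0 1 (by decide)
  rw [inner_eq_add i, hi0] at h01
  have hij : j = i ∨ j = i + 1 ∨ j = i + 2 := by
    have : ∀ i j : Fin 3, j = i ∨ j = i + 1 ∨ j = i + 2 := by decide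
    exact this i j
  have hadd : ∀ i : Fin 3, i + 1 + 1 = i + 2 ∧ i + 2 + 2 = i + 1 := by decide
  rcases hij with rfl | rfl | rfl
  -- Normals in the same coordinate plane: `A ^ 2`, `B ^ 2` and `A + B = -1` are not compatible.
  · have hA : (m 0 (j + 1) * m 1 (j + 1)) ^ 2 = f ^ 2 * (f ^ 2 * s * s) := by
      rw [mul_pow, hi1, hj1]; ring
    have hB : (m 0 (j + 2) * m 1 (j + 2)) ^ 2 = s * s := by rw [mul_pow, hs']
    set A := m 0 (j + 1) * m 1 (j + 1)
    set B := m 0 (j + 2) * m 1 (j + 2)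
    have hAB : A + B = -1 := by linarith
    have h1 : A ^ 2 + B ^ 2 = 27 / 5 := by
      have h4 : f ^ 2 * f ^ 2 + 1 = 3 * f ^ 2 := by linear_combination (f ^ 2 + f - 1) * hff
      rw [hA, hB]
      linear_combination 3 * hss + s * s * h4
    have h2 : A ^ 2 * B ^ 2 = 81 / 25 := by
      rw [hA, hB]
      linear_combination (f ^ 2 * s * s + 9 / 5) * hss
    have h3 : (2 * (A * B)) = 1 - 27 / 5 := by
      rw [← h1]
      linear_combination (A + B - 1) * hAB
    have h4 : 4 * (A ^ 2 * B ^ 2) = (1 - 27 / 5) ^ 2 := by rw [← h3]; ring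
    rw [h2] at h4
    norm_num at h4
  -- Normals in different coordinate planes have only one common coordinate that does not vanish.
  · rw [(hadd i).1] at hj1
    rw [hj0] at h01
    have h1 : (m 0 (i + 2) * m 1 (i + 2)) ^ 2 = 9 / 5 := by
      rw [mul_pow, hj1, ← hs, ← hss]; ring
    rw [show m 0 (i + 2) * m 1 (i + 2) = -1 by linarith] at h1
    norm_num at h1
  · rw [(hadd i).2] at hs'
    rw [hj0] at h01
    have h1 : (m 0 (i + 1) * m 1 (i + 1)) ^ 2 = 9 / 5 := by
      rw [mul_pow, hi1, hs', ← hss]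
    rw [show m 0 (i + 1) * m 1 (i + 1) = -1 by linarith] at h1
    norm_num at h1

/-! ### Solids with a 4-face embedding -/

/-- A uniform polyhedron outside the list on the right is Platonic, a prism or an antiprism, and
each of these is excluded by its normals. Conversely, the symmetry group of an Archimedean solid
cannot preserve a line, and no vertex lies on an axis of order three of the tetrahedron. -/
theorem admitsFaceEmbedding_tetrahedron_iff {S : Set E3} (hS : IsUniform S) :
    AdmitsFaceEmbedding 4 S tetrahedron ↔
      IsSimilar S icosahedron ∨ IsSimilar S octahedron ∨ IsArchimedean S := by
  constructor
  · intro h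
    by_contra! hcon
    obtain ⟨hico, hoct, harch⟩ := hcon
    refine harch ⟨hS, ?_, fun n hn hp => not_admitsFaceEmbedding_prism hn hp h, fun n hn hp => ?_⟩
    · rintro (h' | h' | h' | h' | h')
      exacts [not_admitsFaceEmbedding_tetrahedron h' h, not_admitsFaceEmbedding_cube h' h,
        hoct h', not_admitsFaceEmbedding_dodecahedron h' h, hico h']
    · rcases hn.eq_or_lt with rfl | hn
      · exact hoct (hp.trans isSimilar_antiprism_three)
      · exact not_admitsFaceEmbedding_antiprism hn hp h
  · rintro (h | h | ⟨⟨hpoly, hreg, htrans⟩, hplat, hprism, hanti⟩)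
    · exact admitsFaceEmbedding_icosahedron.congr h
    · exact admitsFaceEmbedding_octahedron.congr h
    obtain ⟨c, W, hfin, hSW, hsolid, hW⟩ := exists_center hpoly htrans
    have hsim : IsSimilar S (convexHull ℝ W) := by
      rw [hSW]
      simpa using (isSimilar_convexHull_image W c one_ne_zero (LinearIsometryEquiv.refl ℝ E3)).symm
    rcases exists_axes_or_exists_line (finite_symmetryGroup hfin hsolid) with hax | ⟨e, he, hG⟩
    · rcases admitsFaceEmbedding_or_isPlatonic hfin hsolid hW hax with h | h
      · exact h.congr hsim
      · exact absurd (h.congr hsim) hplat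
    · rw [hSW] at hreg
      rcases isSimilar_of_axis hsolid hW hreg he hG with h | ⟨n, hn, h | h⟩
      · exact absurd (.inl (hsim.trans h)) hplat
      · exact absurd (hsim.trans h) (hprism n hn)
      · exact absurd (hsim.trans h) (hanti n hn)

end

end Solid

theorem mainTheorem1 (S : Set Solid.E3) (hS : Solid.IsUniform S) :
    Solid.AdmitsFaceEmbedding 4 S Solid.tetrahedron ↔
      Solid.IsSimilar S Solid.icosahedron ∨ Solid.IsSimilar S Solid.octahedron ∨
        Solid.IsArchimedean S :=
  Solid.admitsFaceEmbedding_tetrahedron_iff hS
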